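/- **Regularity Lemma, including a Counting Lemma.** *Setting.* Let $\mathfrak r$ be a finite index set with $|\mathfrak r|=r$, and for each $i\in\mathfrak r$ let $\Omega_i$ be a finite probability space in which every subset is an event. For $I\subseteq\mathfrak r$, an index-$I$ edge is an element $e=(e_i)_{i\in I}$ of $\Omega_I=\prod_{i\in I}\Omega_i$; for $J\subseteq I$ let $e|_J$ be its restriction. A random $e\in\Omega_I$ has independent coordinates $e_i\in\Omega_i$. Let $\mathcal I_k$ be the set of all $I\subseteq\mathfrak r$ with $1\le|I|\le k$. For $\vec b=(b_1,\dots,b_k)$, a ($k$-bounded) $\vec b$-colored graph $G$ on $\Omega=(\Omega_i)_i$ consists of a set $C_I(G)$ of exactly $b_{|I|}$ colors and a map $e\mapsto G(e)$ from $\Omega_I$ to $C_I(G)$, for every $I\in\mathcal I_k$. In general a $k$-bounded graph is the same with arbitrary finite color sets. Put $G\langle e\rangle=(G(e|_J))_{\emptyset\ne J\subseteq I}$ and $G(\partial e)=(G(e|_J))_{\emptyset\ne J\subsetneq I}$ for $e\in\Omega_I$. *Random maps.* $\Phi(m)$ is the set of families $\varphi=(\varphi_i)_{i\in\mathfrak r}$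 of maps $\varphi_i:\{1,\dots,m\}\to\Omega_i$; a random $\varphi$ takes all its $rm$ values independently, those of $\varphi_i$ according to $\Omega_i$. $\Phi(m_1,\dots,m_{k-1})=\Phi(m_1)\times\dots\times\Phi(m_{k-1})$, with independent components. *Regularization.* For $1\le s<k$ and $\varphi\in\Phi(m)$, the graph $G/^s\varphi$ on $\Omega$ is obtained from $G$ by recoloring each index-$I$ edge $e$ with $|I|\le s$ by the vector of the colors $G(e\cup f)$, where $J$ runs over the subsets of $\mathfrak r\setminus I$ with $|I|+|J|\le s+1$ and $f=(\varphi_i(g_i))_{i\in J}$ with $g$ running over all maps $J\to\{1,\dots,m\}$; the new set $C_I(G/^s\varphi)$ is the set of all vectors with entries in the corresponding sets $C_{I\cup J}(G)$. Edges of size larger than $s$ keep their colors. For $\vec\varphi=(\varphi_1,\dots,\varphi_{k-1})$ put $G/\vec\varphi=((G/^{k-1}\varphi_{k-1})/^{k-2}\varphi_{k-2})\cdots/^1\varphi_1$ (so $G/\vec\varphi=G$ if $k=1$). *Regularity.* For $I\in\mathcal I_k$ and $\vec c=(c_J)_{\emptyset\ne J\subseteq I}$ with $c_J\in C_J(G)$,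 let $d_G(\vec c)=\mathbb P_{e\in\Omega_I}[G(e)=c_I\mid G(\partial e)=(c_J)_{J\subsetneq I}]$, and $d_G(\vec c)=1$ if the condition has probability $0$. Let $\mathcal S_{k,h,G}$ be the set of all $S$ that assign to each $e\in\{1,\dots,h\}^I$, $I\in\mathcal I_k$, either a color $S(e)\in C_I(G)$ ($e$ is then visible) or the value "invisible", such that $e$ is invisible whenever some $e|_J$, $\emptyset\neq J\subseteq I$, is invisible. Let $\mathbb V(S)$ be the set of visible edges, and $S\langle e\rangle=(S(e|_J))_{\emptyset\neq J\subseteq I}$ for a visible index-$I$ edge $e$. For $\varphi\in\Phi(h)$ put $\varphi(e)=(\varphi_i(e_i))_{i\in I}$. The graph $G$ is $(\epsilon,k,h)$-regular if there is a function $\delta\ge 0$ of the color vectors $\vec c$ such that (i) for every $S\in\mathcal S_{k,h,G}$ there are real numbers $a_e$, $e\in\mathbb V(S)$, with $\max\{0,d_G(S\langle e\rangle)-\delta(S\langle e\rangle)\}\le a_e\le\min\{1,d_G(S\langle e\rangle)+\delta(S\langle e\rangle)\}$ and $\mathbb P_{\varphi\in\Phi(h)}[G(\varphi(e))=S(e)\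 \forall e\in\mathbb V(S)]=\prod_{e\in\mathbb V(S)}a_e$; (ii) $\mathbb E_{e\in\Omega_I}[\delta(G\langle e\rangle)]\le\epsilon/|C_I(G)|$ for every $I\in\mathcal I_k$. Let $\mathrm{reg}_{k,h}(G)$ be the minimum of all $\epsilon\ge0$ such that $G$ is $(\epsilon,k,h)$-regular. *Statement.* For all integers $r\ge k\ge1$, $h\ge1$, all $\vec b=(b_i)_{1\le i\le k}$ and all $\epsilon>0$ there are integers $\widetilde m_1,\dots,\widetilde m_{k-1}$ such that for every $\mathfrak r$ with $|\mathfrak r|=r$, every $\Omega$ and every $\vec b$-colored graph $G$ on $\Omega$ the following holds. There are integers $0\le m_i\le\widetilde m_i$ $(1\le i\le k-1)$ with $$\mathbb E_{\vec\varphi\in\Phi(m_1,\dots,m_{k-1})}\big[\mathrm{reg}_{k,h}(G/\vec\varphi)\big]\le\epsilon.$$ Moreover, for any $m_1,\dots,m_{k-1}\ge0$ satisfying this inequality, with probability at least $1-\sqrt\epsilon$ over random $\vec\varphi\in\Phi(m_1,\dots,m_{k-1})$, we have $\mathrm{reg}_{k,h}(G/\vec\varphi)\le\sqrt\epsilon$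 and $G/\vec\varphi$ is $(\sqrt\epsilon,k,h)$-regular. -/

import Mathlib

set_option linter.unusedSectionVars false

universe v w

namespace PartiteRegularity

/-! ### Finite probability spaces

A probability measure on a finite set (all subsets being events) is a point `p` of the standard
simplex, that is, a nonnegative real weight on points of total mass `1`. -/

/-- The probability of the event `A` for the weights `p` on a finite set. -/
noncomputable def prob {α : Type*} [Fintype α] (p : α → ℝ) (A : Set α) : ℝ :=
  ∑ a, A.indicator p a

/-- The expectation of `f` for the weights `p` on a finite set. -/
noncomputable def expect {α : Type*} [Fintype α] (p : α → ℝ) (f : α → ℝ) : ℝ :=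
  ∑ a, p a * f a

theorem prob_nonneg {α : Type*} [Fintype α] {p : α → ℝ} (hp : ∀ a, 0 ≤ p a) (A : Set α) :
    0 ≤ prob p A := Finset.sum_nonneg fun a _ => Set.indicator_nonneg (fun a _ => hp a) a

theorem prob_mono {α : Type*} [Fintype α] {p : α → ℝ} (hp : ∀ a, 0 ≤ p a) {A B : Set α}
    (h : A ⊆ B) : prob p A ≤ prob p B :=
  Finset.sum_le_sum fun a _ => Set.indicator_le_indicator_of_subset h (fun a => hp a) a

theorem prob_univ {α : Type*} [Fintype α] {p : α → ℝ} : prob p Set.univ = ∑ a, p a := by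
  simp [prob]

/-! ### Colored hypergraphs -/

/-- The nonempty index sets `I ⊆ ι` of size at most `k`. -/
abbrev EdgeIndex (ι : Type) (k : ℕ) : Type :=
  {I : Finset ι // I.Nonempty ∧ I.card ≤ k}

/-- An index-`I` edge: one vertex from each of the vertex sets `V i`, `i ∈ I`. -/
abbrev Edge {ι : Type} (V : ι → Type v) (I : Finset ι) : Type v :=
  ∀ i : I, V i

/-- The restriction `e|_J` of an index-`I` edge to `J ⊆ I`. -/
def Edge.restrict {ι : Type} {V : ι → Type v} {I J : Finset ι} (e : Edge V I) (hJI : J ⊆ I) :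
    Edge V J :=
  fun i => e ⟨i.1, hJI i.2⟩

/-- A `k`-bounded colored `ι`-partite hypergraph on the vertex sets `V i`, `i ∈ ι`: for every
nonempty index set `I` of size at most `k`, a finite set of colors and a coloring of all
index-`I` edges. -/
structure ColoredHypergraph {ι : Type} (k : ℕ) (V : ι → Type v) where
  /-- The set of index-`I` colors. -/
  Color : EdgeIndex ι k → Type w
  finite_color : ∀ I, Finite (Color I)
  /-- The (face-)color of an index-`I` edge. -/
  color : ∀ I : EdgeIndex ι k, Edge V I.1 → Color I

/-- A partitionwise map from `ι` disjoint sets of `m` points each to the sets `Ω i`. -/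
abbrev PartMap {ι : Type} (Ω : ι → Type v) (m : ℕ) : Type v :=
  ∀ i : ι, Fin m → Ω i

/-- The image `φ(e)` of an edge `e` on the points `Fin h` under a partitionwise map `φ`. -/
def PartMap.mapEdge {ι : Type} {Ω : ι → Type v} {h : ℕ} (φ : PartMap Ω h) {I : Finset ι}
    (e : Edge (fun _ : ι => Fin h) I) : Edge Ω I :=
  fun i => φ i (e i)

/-- The law of a random index-`I` edge: independent random vertices. -/
noncomputable def edgeLaw {ι : Type} {Ω : ι → Type v} (p : ∀ i, Ω i → ℝ) (I : Finset ι) :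
    Edge Ω I → ℝ :=
  fun e => ∏ i : I, p i (e i)

/-- The law of a random partitionwise map: every point is mapped independently. -/
noncomputable def mapLaw {ι : Type} [Fintype ι] {Ω : ι → Type v} (p : ∀ i, Ω i → ℝ) (m : ℕ) :
    PartMap Ω m → ℝ :=
  fun φ => ∏ i, ∏ j, p i (φ i j)

/-- The law of a random element of `Φ(m₁) × ⋯ × Φ(mₙ)`, with independent components. -/
noncomputable def mapsLaw {ι : Type} [Fintype ι] {Ω : ι → Type v} (p : ∀ i, Ω i → ℝ) {n : ℕ}
    (m : Fin n → ℕ) : (∀ t, PartMap Ω (m t)) → ℝ :=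
  fun φ => ∏ t, mapLaw p (m t) (φ t)

namespace ColoredHypergraph

section

variable {ι : Type} {k : ℕ} {V : ι → Type v}

/-- `G` is `(b_i)_{1 ≤ i ≤ k}`-colored: there are exactly `b_{|I|}` colors of index `I`. -/
def IsColored (G : ColoredHypergraph.{v, w} k V) (b : ℕ → ℕ) : Prop :=
  ∀ I : EdgeIndex ι k, Nat.card (G.Color I) = b I.1.card

/-- Vectors `(c_J)_{∅ ≠ J ⊆ I}` of colors. -/
abbrev ColorVector (G : ColoredHypergraph.{v, w} k V) (I : EdgeIndex ι k) : Type w :=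
  ∀ J : {J : EdgeIndex ι k // J.1 ⊆ I.1}, G.Color J.1

/-- The total color `G⟨e⟩ = (G(e|_J))_{∅ ≠ J ⊆ I}` of an index-`I` edge. -/
def totalColor (G : ColoredHypergraph.{v, w} k V) (I : EdgeIndex ι k) (e : Edge V I.1) :
    G.ColorVector I :=
  fun J => G.color J.1 (Edge.restrict e J.2)

/-- The set of index-`I` edges `e` with frame-color `G(∂e) = (c_J)_{∅ ≠ J ⊊ I}`. -/
def frameEvent (G : ColoredHypergraph.{v, w} k V) (I : EdgeIndex ι k) (c : G.ColorVector I) :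
    Set (Edge V I.1) :=
  {e | ∀ J : {J : EdgeIndex ι k // J.1 ⊆ I.1}, J.1 ≠ I → G.totalColor I e J = c J}

/-- The set of index-`I` edges `e` with `G(e) = c_I`. -/
def faceEvent (G : ColoredHypergraph.{v, w} k V) (I : EdgeIndex ι k) (c : G.ColorVector I) :
    Set (Edge V I.1) :=
  {e | G.color I e = c ⟨I, subset_rfl⟩}

/-- A simplicial-complex on `h` vertices in each vertex set `Fin h`, whose visible index-`I` colors
are colors of `G`. The value `none` is the invisible color. Every edge containing an invisible edge
is invisible. -/
structure Complex (G : ColoredHypergraph.{v, w} k V) (h : ℕ) where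
  color : ∀ I : EdgeIndex ι k, Edge (fun _ : ι => Fin h) I.1 → Option (G.Color I)
  invisible_of_subset : ∀ (I J : EdgeIndex ι k) (hJI : J.1 ⊆ I.1)
    (e : Edge (fun _ : ι => Fin h) I.1),
    color J (Edge.restrict e hJI) = none → color I e = none

/-- The visible edges of a simplicial-complex. -/
abbrev Complex.Visible {G : ColoredHypergraph.{v, w} k V} {h : ℕ} (S : G.Complex h) : Type :=
  {x : Σ I : EdgeIndex ι k, Edge (fun _ : ι => Fin h) I.1 // (S.color x.1 x.2).isSome}

/-- The total color `S⟨e⟩` of a visible edge of a simplicial-complex. -/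
def Complex.totalColor {G : ColoredHypergraph.{v, w} k V} {h : ℕ} (S : G.Complex h)
    (x : S.Visible) : G.ColorVector x.1.1 :=
  fun J => (S.color J.1 (Edge.restrict x.1.2 J.2)).get (by
    rw [Option.isSome_iff_ne_none]
    intro hn
    have hs := x.2
    rw [S.invisible_of_subset x.1.1 J.1 J.2 x.1.2 hn] at hs
    simp at hs)

end

section

variable {ι : Type} [Fintype ι] [DecidableEq ι] {k : ℕ} {Ω : ι → Type v}

/-- The event that `G(φ(e)) = S(e)` for all visible edges `e` of `S`. -/
def copyEvent (G : ColoredHypergraph.{v, w} k Ω) {h : ℕ} (S : G.Complex h) :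
    Set (PartMap Ω h) :=
  {φ | ∀ x : S.Visible, some (G.color x.1.1 (φ.mapEdge x.1.2)) = S.color x.1.1 x.1.2}

variable [∀ i, Fintype (Ω i)]

open Classical in
/-- The relative density `P[G(e) = c_I | G(∂e) = (c_J)_{J ⊊ I}]`, defined to be `1` when the
condition has probability `0`. -/
noncomputable def relDensity (G : ColoredHypergraph.{v, w} k Ω) (p : ∀ i, Ω i → ℝ)
    (I : EdgeIndex ι k) (c : G.ColorVector I) : ℝ :=
  if prob (edgeLaw p I.1) (G.frameEvent I c) = 0 then 1
  else prob (edgeLaw p I.1) (G.faceEvent I c ∩ G.frameEvent I c) /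
    prob (edgeLaw p I.1) (G.frameEvent I c)

/-- `δ` is an error function of `G` for the counts of complexes with `h` vertices in each vertex
set: the probability of `S` is a product of numbers `a_e` with
`max(0, d - δ) ≤ a_e ≤ min(1, d + δ)`, where `d = d_G(S⟨e⟩)`, `δ = δ(S⟨e⟩)`. -/
def IsErrorFunction (G : ColoredHypergraph.{v, w} k Ω) (p : ∀ i, Ω i → ℝ) (h : ℕ)
    (δ : ∀ I : EdgeIndex ι k, G.ColorVector I → ℝ) : Prop :=
  (∀ I c, 0 ≤ δ I c) ∧
  ∀ S : G.Complex h, ∃ a : S.Visible → ℝ,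
    (∀ x, max 0 (G.relDensity p x.1.1 (S.totalColor x) - δ x.1.1 (S.totalColor x)) ≤ a x ∧
      a x ≤ min 1 (G.relDensity p x.1.1 (S.totalColor x) + δ x.1.1 (S.totalColor x))) ∧
    prob (mapLaw p h) (G.copyEvent S) = ∏ x, a x

/-- `G` is `(ε, k, h)`-regular. -/
def IsRegular (G : ColoredHypergraph.{v, w} k Ω) (p : ∀ i, Ω i → ℝ) (h : ℕ) (ε : ℝ) : Prop :=
  ∃ δ : ∀ I : EdgeIndex ι k, G.ColorVector I → ℝ, G.IsErrorFunction p h δ ∧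
    ∀ I : EdgeIndex ι k,
      expect (edgeLaw p I.1) (fun e => δ I (G.totalColor I e)) ≤ ε / Nat.card (G.Color I)

/-- `reg_{k,h}(G)`: the least `ε ≥ 0` such that `G` is `(ε, k, h)`-regular (`isLeast_reg` shows that
the infimum is attained). -/
noncomputable def reg (G : ColoredHypergraph.{v, w} k Ω) (p : ∀ i, Ω i → ℝ) (h : ℕ) : ℝ :=
  sInf {ε : ℝ | 0 ≤ ε ∧ G.IsRegular p h ε}

theorem relDensity_mem (G : ColoredHypergraph.{v, w} k Ω) (p : ∀ i, Ω i → ℝ)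
    (hp : ∀ i, p i ∈ stdSimplex ℝ (Ω i)) (I : EdgeIndex ι k) (c : G.ColorVector I) :
    0 ≤ G.relDensity p I c ∧ G.relDensity p I c ≤ 1 := by
  have h0 : ∀ e, 0 ≤ edgeLaw p I.1 e := fun e => Finset.prod_nonneg fun i _ => (hp i).1 _
  unfold relDensity
  split_ifs with h
  · simp
  · exact ⟨div_nonneg (prob_nonneg h0 _) (prob_nonneg h0 _),
      div_le_one_of_le₀ (prob_mono h0 Set.inter_subset_right) (prob_nonneg h0 _)⟩

theorem sum_mapLaw (p : ∀ i, Ω i → ℝ) (hp : ∀ i, p i ∈ stdSimplex ℝ (Ω i)) (m : ℕ) :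
    ∑ φ, mapLaw p m φ = 1 := by
  have h1 : ∀ i, ∑ f : Fin m → Ω i, ∏ j, p i (f j) = 1 := fun i => by
    have := Fintype.prod_sum (fun (_ : Fin m) (x : Ω i) => p i x)
    rw [← this]; simp [(hp i).2]
  unfold mapLaw
  have := Fintype.prod_sum (fun (i : ι) (f : Fin m → Ω i) => ∏ j, p i (f j))
  rw [← this]; simp [h1]

theorem prob_mapLaw_mem (p : ∀ i, Ω i → ℝ) (hp : ∀ i, p i ∈ stdSimplex ℝ (Ω i)) (m : ℕ)
    (A : Set (PartMap Ω m)) : 0 ≤ prob (mapLaw p m) A ∧ prob (mapLaw p m) A ≤ 1 := by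
  have h0 : ∀ φ, 0 ≤ mapLaw p m φ := fun φ =>
    Finset.prod_nonneg fun i _ => Finset.prod_nonneg fun j _ => (hp i).1 _
  refine ⟨prob_nonneg h0 _, ?_⟩
  rw [← sum_mapLaw p hp m, ← prob_univ]
  exact prob_mono h0 (Set.subset_univ _)

/-- The constant `1` is an error function, so that the set in the definition of `reg` is nonempty. -/
theorem isErrorFunction_one (G : ColoredHypergraph.{v, w} k Ω) (p : ∀ i, Ω i → ℝ)
    (hp : ∀ i, p i ∈ stdSimplex ℝ (Ω i)) (h : ℕ) : G.IsErrorFunction p h fun _ _ => 1 := by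
  classical
  refine ⟨fun _ _ => zero_le_one, fun S => ?_⟩
  have hP := prob_mapLaw_mem p hp h (G.copyEvent S)
  have key : ∀ (x : S.Visible) (t : ℝ), 0 ≤ t → t ≤ 1 →
      max 0 (G.relDensity p x.1.1 (S.totalColor x) - 1) ≤ t ∧
      t ≤ min 1 (G.relDensity p x.1.1 (S.totalColor x) + 1) := fun x t h0 h1 => by
    have := G.relDensity_mem p hp x.1.1 (S.totalColor x)
    exact ⟨max_le h0 (by linarith), le_min h1 (by linarith)⟩
  rcases isEmpty_or_nonempty S.Visible with hE | ⟨⟨x₀⟩⟩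
  · refine ⟨fun _ => 1, fun x => hE.elim x, ?_⟩
    have : G.copyEvent S = Set.univ := Set.eq_univ_of_forall fun φ x => hE.elim x
    simp [this, prob_univ, sum_mapLaw p hp]
  · refine ⟨fun x => if x = x₀ then prob (mapLaw p h) (G.copyEvent S) else 1, fun x => ?_, ?_⟩
    · apply key <;> dsimp only <;> split_ifs <;> simp [hP]
    · simp

/-- The minimum in the definition of `reg` is attained. -/
theorem isLeast_reg (G : ColoredHypergraph.{v, w} k Ω) (p : ∀ i, Ω i → ℝ)
    (hp : ∀ i, p i ∈ stdSimplex ℝ (Ω i)) (h : ℕ) :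
    IsLeast {ε : ℝ | 0 ≤ ε ∧ G.IsRegular p h ε} (G.reg p h) := by
  classical
  have hfin := G.finite_color
  have he0 : ∀ (I : EdgeIndex ι k) e, 0 ≤ edgeLaw p I.1 e :=
    fun I e => Finset.prod_nonneg fun i _ => (hp i).1 _
  set A : Set ℝ := {ε : ℝ | 0 ≤ ε ∧ G.IsRegular p h ε} with hA
  have hne : A.Nonempty := by
    let f : EdgeIndex ι k → ℝ := fun I =>
      Nat.card (G.Color I) * expect (edgeLaw p I.1) (fun _ => 1)
    have hf0 : ∀ I, 0 ≤ f I := fun I => mul_nonneg (Nat.cast_nonneg _)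
      (Finset.sum_nonneg fun e _ => by simpa using he0 I e)
    refine ⟨∑ I, f I, Finset.sum_nonneg fun I _ => hf0 I, _, G.isErrorFunction_one p hp h,
      fun I => ?_⟩
    rcases isEmpty_or_nonempty (Edge Ω I.1) with hemp | ⟨⟨e⟩⟩
    · simp only [expect, Finset.univ_eq_empty, Finset.sum_empty]
      exact div_nonneg (Finset.sum_nonneg fun I _ => hf0 I) (Nat.cast_nonneg _)
    · have : Nonempty (G.Color I) := ⟨G.color I e⟩
      have hc : (0 : ℝ) < Nat.card (G.Color I) := by exact_mod_cast Nat.card_pos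
      rw [le_div_iff₀ hc, mul_comm]
      exact Finset.single_le_sum (f := f) (fun I _ => hf0 I) (Finset.mem_univ I)
  obtain ⟨M, hM⟩ := hne
  let X := ℝ × ((∀ I : EdgeIndex ι k, G.ColorVector I → ℝ) ×
    (∀ S : G.Complex h, S.Visible → ℝ))
  let Z : Set X := {z | z ∈ Set.Icc (0 : X) (M, (fun _ _ => 1), (fun _ _ => 1)) ∧
    (∀ (S : G.Complex h) (x : S.Visible),
      max 0 (G.relDensity p x.1.1 (S.totalColor x) - z.2.1 x.1.1 (S.totalColor x)) ≤ z.2.2 S x ∧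
      z.2.2 S x ≤ min 1 (G.relDensity p x.1.1 (S.totalColor x) + z.2.1 x.1.1 (S.totalColor x))) ∧
    (∀ S : G.Complex h, prob (mapLaw p h) (G.copyEvent S) = ∏ x, z.2.2 S x) ∧
    ∀ I : EdgeIndex ι k,
      expect (edgeLaw p I.1) (fun e => z.2.1 I (G.totalColor I e)) ≤ z.1 / Nat.card (G.Color I)}
  have hZc : IsCompact Z := by
    have hI : IsCompact (Set.Icc (0 : X) (M, (fun _ _ => 1), (fun _ _ => 1))) := by
      rw [← Prod.mk_zero_zero, ← Prod.mk_zero_zero, ← Set.Icc_prod_Icc, ← Set.Icc_prod_Icc]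
      refine isCompact_Icc.prod (IsCompact.prod ?_ ?_)
      · rw [← Set.pi_univ_Icc]
        refine isCompact_univ_pi fun I => ?_
        rw [← Set.pi_univ_Icc]
        exact isCompact_univ_pi fun _ => isCompact_Icc
      · rw [← Set.pi_univ_Icc]
        refine isCompact_univ_pi fun I => ?_
        rw [← Set.pi_univ_Icc]
        exact isCompact_univ_pi fun _ => isCompact_Icc
    have c1 : ∀ I c, Continuous fun z : X => z.2.1 I c := fun I c => by fun_prop
    have c2 : ∀ S x, Continuous fun z : X => z.2.2 S x := fun I c => by fun_prop
    have k1 : IsClosed {z : X | ∀ (S : G.Complex h) (x : S.Visible),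
        max 0 (G.relDensity p x.1.1 (S.totalColor x) - z.2.1 x.1.1 (S.totalColor x)) ≤ z.2.2 S x ∧
        z.2.2 S x ≤
          min 1 (G.relDensity p x.1.1 (S.totalColor x) + z.2.1 x.1.1 (S.totalColor x))} := by
      simp only [Set.ofPred_forall, Set.ofPred_and]
      refine isClosed_iInter fun S => isClosed_iInter fun x => IsClosed.inter ?_ ?_
      · exact isClosed_le (continuous_const.max (continuous_const.sub (c1 _ _))) (c2 _ _)
      · exact isClosed_le (c2 _ _) (continuous_const.min (continuous_const.add (c1 _ _)))
    have k2 : IsClosed {z : X | ∀ S : G.Complex h,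
        prob (mapLaw p h) (G.copyEvent S) = ∏ x, z.2.2 S x} := by
      simp only [Set.ofPred_forall]
      exact isClosed_iInter fun S => isClosed_eq continuous_const
        (continuous_finsetProd _ fun x _ => c2 _ _)
    have k3 : IsClosed {z : X | ∀ I : EdgeIndex ι k,
        expect (edgeLaw p I.1) (fun e => z.2.1 I (G.totalColor I e)) ≤
          z.1 / Nat.card (G.Color I)} := by
      simp only [Set.ofPred_forall]
      refine isClosed_iInter fun I => isClosed_le ?_ (continuous_fst.div_const _)
      unfold expect
      exact continuous_finsetSum _ fun e _ => continuous_const.mul (c1 _ _)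
    exact hI.inter_right (k1.inter (k2.inter k3))
  have hproj : Prod.fst '' Z = A ∩ Set.Iic M := by
    ext ε
    constructor
    · rintro ⟨z, ⟨hz, h1, h2, h3⟩, rfl⟩
      exact ⟨⟨hz.1.1, z.2.1, ⟨fun I c => hz.1.2.1 I c, fun S => ⟨z.2.2 S, h1 S, h2 S⟩⟩, h3⟩,
        hz.2.1⟩
    · rintro ⟨⟨h0, δ, ⟨hδ0, hδ⟩, hE⟩, hεM⟩
      choose a ha hP using hδ
      refine ⟨(ε, (fun I c => min (δ I c) 1), a), ⟨⟨⟨h0, ?_, ?_⟩, ⟨hεM, ?_, ?_⟩⟩, ?_, hP, ?_⟩, rfl⟩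
      · exact fun I c => le_min (hδ0 I c) zero_le_one
      · exact fun S x => (le_max_left _ _).trans (ha S x).1
      · exact fun I c => min_le_right _ _
      · exact fun S x => (ha S x).2.trans (min_le_left _ _)
      · intro S x
        have hd := G.relDensity_mem p hp x.1.1 (S.totalColor x)
        obtain ⟨l, u⟩ := ha S x
        have l0 := (le_max_left _ _).trans l
        have l1 := (le_max_right _ _).trans l
        have u0 := u.trans (min_le_left _ _)
        have u1 := u.trans (min_le_right _ _)
        dsimp only
        rcases min_cases (δ x.1.1 (S.totalColor x)) 1 with ⟨e, _⟩ | ⟨e, _⟩ <;> rw [e]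
        · exact ⟨l, u⟩
        · exact ⟨max_le l0 (by linarith), le_min u0 (by linarith)⟩
      · intro I
        refine le_trans (Finset.sum_le_sum fun e _ => ?_) (hE I)
        exact mul_le_mul_of_nonneg_left (min_le_left _ _) (he0 I e)
  have hAM : IsCompact (A ∩ Set.Iic M) := hproj ▸ hZc.image continuous_fst
  obtain ⟨ε₀, hε₀, hle⟩ := hAM.exists_isLeast ⟨M, hM, le_refl M⟩
  have hleast : IsLeast A ε₀ := by
    refine ⟨hε₀.1, fun ε hε => ?_⟩
    rcases le_total ε M with h' | h'
    · exact hle ⟨hε, h'⟩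
    · exact (hle ⟨hM, le_refl M⟩).trans h'
  have : G.reg p h = ε₀ := hleast.csInf_eq
  rw [this]; exact hleast

end

section

variable {ι : Type} [Fintype ι] [DecidableEq ι] {k : ℕ} {Ω : ι → Type v}

/-- The `s`-regularization `G /^s φ`, `1 ≤ s < k`. The new color of an index-`I` edge `e` is the
vector of the old colors of all edges `e ∪ f`, where `f` is an index-`J` edge with vertices in the
range of `φ`, `J` is disjoint from `I`, and `|I ∪ J| ≤ s + 1`. Here `K = I ∪ J`, and `f` is given
by `g : K \ I → Fin m`, with `f_i = φ_i(g_i)`. When `|I| > s` the only possibility is `K = I`, so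
that the color does not change (it becomes a vector with one coordinate). -/
def regularizeStep (G : ColoredHypergraph.{v, w} k Ω) (s : ℕ) {m : ℕ} (φ : PartMap Ω m) :
    ColoredHypergraph.{v, w} k Ω where
  Color I := ∀ K : {K : EdgeIndex ι k // I.1 ⊆ K.1 ∧ (K = I ∨ K.1.card ≤ s + 1)},
    (↥(K.1.1 \ I.1) → Fin m) → G.Color K.1
  finite_color I := by
    have := G.finite_color
    infer_instance
  color I e := fun K g => G.color K.1 fun i =>
    if hi : i.1 ∈ I.1 then e ⟨i.1, hi⟩
    else φ i.1 (g ⟨i.1, Finset.mem_sdiff.2 ⟨i.2, hi⟩⟩)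

/-- `((G /^n φ_n) /^{n-1} φ_{n-1}) ⋯ /^1 φ_1`, where `φ t` stands for `φ_{t+1}`, `t < n`. With
`n = k - 1` this is the regularization of `G` by `(φ_1, …, φ_{k-1})`. -/
def regularize : (n : ℕ) → (G : ColoredHypergraph.{v, w} k Ω) → {m : Fin n → ℕ} →
    (∀ t, PartMap Ω (m t)) → ColoredHypergraph.{v, w} k Ω
  | 0, G, _, _ => G
  | n + 1, G, _, φ =>
    regularize n (G.regularizeStep (n + 1) (φ (Fin.last n))) (fun t => φ t.castSucc)

end

end ColoredHypergraph

end PartiteRegularity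

/-! The proof joins an energy increment argument to a counting lemma. The energy of an index set is
the expected relative density of a random edge, that is, the sum over the colors of the squared L²
norms of their conditional probabilities given the frame-color. It lies between 0 and 1. Refining
the frames raises it by exactly the mean square change of these conditional probabilities
(`energy_sub`). Enlarging the sample of a level refines at least as much as one further
regularization at that level (`regularize_refinesFrom_regularizeStep`). Hence a pigeonhole argument
over all levels (`exists_small_increments`) gives bounded sample sizes at which `l` further points
at any single level would hardly raise the mean energy.

At such sizes most edges have a typical color vector: its density is not too small and hardly
changes when `l` further points are sampled. For the counting, a pattern is compared with the same
pattern plus one edge e₀ (`sq_copyProb_insert_sub_le`). Once the vertices outside e₀ are mapped to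
sample points, the other conditions depend only on the frame-color of e₀ in the further
regularization. So the color of e₀ may be replaced by its conditional probability, and
Cauchy–Schwarz bounds the error by the deviation times the probability of two copies of the pattern
glued along e₀. Only the smaller edges are kept in the glued pattern, so that induction on the edge
size evaluates it (`copyProb_estimate`). Atypical color vectors get the trivial error 1
(`isErrorFunction_goodError`); they are rare by Markov's inequality.

The order of the parameters is decisive. The deviation tolerated for edges of size s depends only on
a bound for the numbers of colors of sizes at least s, hence only on the samples of levels at least
s. The possibly much smaller densities of smaller edges influence only `l`. The probability
statement is Markov's inequality for the regularity of the random regularization. -/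

/-! ### Refinement of colorings under regularization -/

namespace PartiteRegularity

/-- The index-`K` edge that agrees with `e` on `I` and with `f` outside `I`. -/
def Edge.glue {ι : Type} [DecidableEq ι] {V : ι → Type v} {I K : Finset ι} (e : Edge V I)
    (f : Edge V K) : Edge V K :=
  fun i => if hi : i.1 ∈ I then e ⟨i.1, hi⟩ else f i

theorem Edge.glue_self {ι : Type} [DecidableEq ι] {V : ι → Type v} {I : Finset ι} (e f : Edge V I) :
    e.glue f = e := by
  funext i
  simp [Edge.glue]

namespace ColoredHypergraph

variable {ι : Type} [Fintype ι] [DecidableEq ι] {k : ℕ} {Ω : ι → Type v}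

/-- On edges of size at least `s`, the coloring of `G'` is finer than that of `G`. -/
def RefinesFrom (s : ℕ) (G' G : ColoredHypergraph.{v, w} k Ω) : Prop :=
  ∀ I : EdgeIndex ι k, s ≤ I.1.card → ∀ e e' : Edge Ω I.1,
    G'.color I e = G'.color I e' → G.color I e = G.color I e'

theorem RefinesFrom.refl (s : ℕ) (G : ColoredHypergraph.{v, w} k Ω) : RefinesFrom s G G :=
  fun _ _ _ _ h => h

theorem RefinesFrom.trans {s : ℕ} {G₁ G₂ G₃ : ColoredHypergraph.{v, w} k Ω}
    (h₁ : RefinesFrom s G₁ G₂) (h₂ : RefinesFrom s G₂ G₃) : RefinesFrom s G₁ G₃ :=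
  fun I hI e e' h => h₂ I hI e e' (h₁ I hI e e' h)

theorem RefinesFrom.mono {s t : ℕ} (hst : s ≤ t) {G₁ G₂ : ColoredHypergraph.{v, w} k Ω}
    (h : RefinesFrom s G₁ G₂) : RefinesFrom t G₁ G₂ :=
  fun I hI => h I (hst.trans hI)

/-- Only the range of `φ` matters for the induced partition. In this form colorings built from
samples of different sizes, with different color types, become comparable. -/
theorem regularizeStep_color_eq_iff (G : ColoredHypergraph.{v, w} k Ω) (s : ℕ) {m : ℕ}
    (φ : PartMap Ω m) (I : EdgeIndex ι k) (e e' : Edge Ω I.1) :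
    (G.regularizeStep s φ).color I e = (G.regularizeStep s φ).color I e' ↔
      ∀ K : EdgeIndex ι k, I.1 ⊆ K.1 → (K = I ∨ K.1.card ≤ s + 1) → ∀ f : Edge Ω K.1,
        (∀ i : K.1, i.1 ∉ I.1 → f i ∈ Set.range (φ i.1)) →
        G.color K (e.glue f) = G.color K (e'.glue f) := by
  constructor
  · intro h K hIK hK f hf
    choose g hg using hf
    have := congrFun (congrFun h ⟨K, hIK, hK⟩)
      (fun i => g ⟨i.1, (Finset.mem_sdiff.1 i.2).1⟩ (Finset.mem_sdiff.1 i.2).2)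
    simp only [regularizeStep] at this
    convert this using 2 <;>
    · funext i
      simp only [Edge.glue]
      split_ifs with hi
      · rfl
      · exact (hg i hi).symm
  · intro h
    funext K g
    have := h K.1 K.2.1 K.2.2 (fun i => if hi : i.1 ∈ I.1 then e ⟨i.1, hi⟩
      else φ i.1 (g ⟨i.1, Finset.mem_sdiff.2 ⟨i.2, hi⟩⟩)) (fun i hi => by simp [hi])
    simp only [regularizeStep]
    convert this using 2 <;>
    · funext i
      simp only [Edge.glue]
      split_ifs with hi <;> rfl

theorem regularizeStep_refinesFrom (G : ColoredHypergraph.{v, w} k Ω) (s : ℕ) {m : ℕ}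
    (φ : PartMap Ω m) : RefinesFrom 0 (G.regularizeStep s φ) G := by
  intro I _ e e' h
  rw [regularizeStep_color_eq_iff] at h
  have := h I subset_rfl (Or.inl rfl) e (fun i hi => absurd i.2 hi)
  simpa only [Edge.glue_self] using this

/-- Regularization does not change the partition of the edges larger than its level. -/
theorem refinesFrom_regularizeStep (G : ColoredHypergraph.{v, w} k Ω) {s t : ℕ} (hst : s < t)
    {m : ℕ} (φ : PartMap Ω m) : RefinesFrom t G (G.regularizeStep s φ) := by
  intro I hI e e' h
  rw [regularizeStep_color_eq_iff]
  intro K hIK hK f _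
  have hKI : K = I := by
    rcases hK with hK | hK
    · exact hK
    · exact Subtype.ext (Finset.eq_of_subset_of_card_le hIK (by omega)).symm
  subst hKI
  simpa only [Edge.glue_self] using h

/-- New colors of an edge are old colors of edges containing it, so sizes below `t` never enter. If
`s < t` the step does not touch the partition of the edges concerned, and the samples need not be
related. -/
theorem RefinesFrom.regularizeStep {s t : ℕ} {G' G : ColoredHypergraph.{v, w} k Ω}
    (h : RefinesFrom t G' G) {m' m : ℕ} {φ' : PartMap Ω m'} {φ : PartMap Ω m}
    (hφ : t ≤ s → ∀ i, Set.range (φ i) ⊆ Set.range (φ' i)) :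
    RefinesFrom t (G'.regularizeStep s φ') (G.regularizeStep s φ) := by
  rcases lt_or_ge s t with hst | hst
  · exact (((G'.regularizeStep_refinesFrom s φ').mono (Nat.zero_le t)).trans h).trans
      (G.refinesFrom_regularizeStep hst φ)
  · intro I hI e e' he
    rw [regularizeStep_color_eq_iff] at he ⊢
    exact fun K hIK hK f hf => h K (hI.trans (Finset.card_le_card hIK)) _ _
      (he K hIK hK f fun i hi => hφ hst i.1 (hf i hi))

theorem RefinesFrom.regularize {t : ℕ} : ∀ (n : ℕ) {G' G : ColoredHypergraph.{v, w} k Ω}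
    (_ : RefinesFrom t G' G) {m' m : Fin n → ℕ} {φ' : ∀ u, PartMap Ω (m' u)}
    {φ : ∀ u, PartMap Ω (m u)}
    (_ : ∀ u : Fin n, t ≤ u + 1 → ∀ i, Set.range (φ u i) ⊆ Set.range (φ' u i)),
    RefinesFrom t (G'.regularize n φ') (G.regularize n φ)
  | 0, _, _, h, _, _, _, _, _ => h
  | n + 1, _, _, h, _, _, _, _, hφ => RefinesFrom.regularize n
      (h.regularizeStep fun hst => hφ (Fin.last n) (by simpa using hst))
      fun u hu => hφ u.castSucc (by simpa using hu)

/-- Regularizing at a higher level first gives the finer coloring. -/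
theorem regularizeStep_comm (G : ColoredHypergraph.{v, w} k Ω) {u n : ℕ} (hun : u ≤ n)
    {m l : ℕ} (φ : PartMap Ω m) (ψ : PartMap Ω l) :
    RefinesFrom 0 ((G.regularizeStep n ψ).regularizeStep u φ)
      ((G.regularizeStep u φ).regularizeStep n ψ) := by
  intro I _ e e' he
  rw [regularizeStep_color_eq_iff] at he ⊢
  intro K hIK hK f hf
  rw [regularizeStep_color_eq_iff]
  intro K₂ hKK hK₂ f₂ hf₂
  -- The points over `K₂ \ K` come from `φ` and those over `K \ I` from ψ. In the other order the
  -- `φ`-part is attached first, which leads through this `K'`. It lies in `K₂`, so the size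
  -- condition for level `u` is inherited; if `K₂ = K` it is just `I`.
  let K' : EdgeIndex ι k := ⟨I.1 ∪ (K₂.1 \ K.1), I.2.1.mono Finset.subset_union_left,
    (Finset.card_le_card (Finset.union_subset (hIK.trans hKK) Finset.sdiff_subset)).trans K₂.2.2⟩
  have hK'K₂ : K'.1 ⊆ K₂.1 := Finset.union_subset (hIK.trans hKK) Finset.sdiff_subset
  have hIK' : I.1 ⊆ K'.1 := Finset.subset_union_left
  have hK' : K₂ = K → K' = I := by
    rintro rfl
    exact Subtype.ext (by simp [K'])
  have h1 := he K' hIK'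
    (hK₂.imp hK' fun h => (Finset.card_le_card hK'K₂).trans h)
    (Edge.restrict f₂ hK'K₂) (fun i hi => hf₂ ⟨i.1, hK'K₂ i.2⟩ (by
      have := i.2
      simp only [K', Finset.mem_union, Finset.mem_sdiff] at this
      tauto))
  rw [regularizeStep_color_eq_iff] at h1
  have h2 := h1 K₂ hK'K₂
    (by
      rcases hK₂ with rfl | h
      · rcases hK with rfl | h'
        · exact Or.inl (hK' rfl).symm
        · exact Or.inr h'
      · exact Or.inr (by omega))
    (f.glue f₂) (fun i hi => by
      have hiK : i.1 ∈ K.1 := by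
        by_contra hn
        exact hi (Finset.mem_union_right _ (Finset.mem_sdiff.2 ⟨i.2, hn⟩))
      have hiI : i.1 ∉ I.1 := fun h => hi (hIK' h)
      simpa [Edge.glue, hiK] using hf ⟨i.1, hiK⟩ hiI)
  have key : ∀ e : Edge Ω I.1,
      (e.glue (Edge.restrict f₂ hK'K₂)).glue (f.glue f₂) = (e.glue f).glue f₂ := by
    intro e
    funext i
    by_cases hiI : i.1 ∈ I.1
    · simp [Edge.glue, hiI, hIK hiI, hIK' hiI]
    · by_cases hiK : i.1 ∈ K.1
      · have : i.1 ∉ K'.1 := by simp [K', hiI, hiK]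
        simp [Edge.glue, hiI, hiK, this]
      · simp [Edge.glue, Edge.restrict, hiI, hiK]
  rwa [key, key] at h2

/-- Two steps of the same level look at edges extended by points of both samples, and a single
sample containing all these points sees the same extensions. -/
theorem regularizeStep_regularizeStep (G : ColoredHypergraph.{v, w} k Ω) {n : ℕ}
    {m m' l : ℕ} {φ' : PartMap Ω m'} {φ : PartMap Ω m} {ψ : PartMap Ω l}
    (hφ : ∀ i, Set.range (φ i) ⊆ Set.range (φ' i)) (hψ : ∀ i, Set.range (ψ i) ⊆ Set.range (φ' i)) :
    RefinesFrom 0 (G.regularizeStep n φ') ((G.regularizeStep n φ).regularizeStep n ψ) := by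
  intro I _ e e' he
  rw [regularizeStep_color_eq_iff] at he ⊢
  intro K hIK hK f hf
  rw [regularizeStep_color_eq_iff]
  intro K₂ hKK hK₂ f₂ hf₂
  have h2 := he K₂ (hIK.trans hKK) (by
      rcases hK₂ with rfl | h
      · exact hK
      · exact Or.inr h)
    (f.glue f₂) (fun i hi => by
      by_cases hiK : i.1 ∈ K.1
      · simpa [Edge.glue, hiK] using hψ _ (hf ⟨i.1, hiK⟩ hi)
      · simpa [Edge.glue, hiK] using hφ _ (hf₂ i hiK))
  have key : ∀ e : Edge Ω I.1, e.glue (f.glue f₂) = (e.glue f).glue f₂ := by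
    intro e
    funext i
    by_cases hiI : i.1 ∈ I.1
    · simp [Edge.glue, hiI, hIK hiI]
    · by_cases hiK : i.1 ∈ K.1 <;> simp [Edge.glue, hiI, hiK]
  rwa [key, key] at h2

theorem regularize_regularizeStep_comm {N : ℕ} {l : ℕ} (ψ : PartMap Ω l) :
    ∀ (n : ℕ) (_ : n ≤ N) (G : ColoredHypergraph.{v, w} k Ω) {m : Fin n → ℕ}
      (φ : ∀ u, PartMap Ω (m u)),
      RefinesFrom 0 ((G.regularizeStep N ψ).regularize n φ)
        ((G.regularize n φ).regularizeStep N ψ)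
  | 0, _, G, _, _ => RefinesFrom.refl _ _
  | n + 1, hn, G, _, φ => RefinesFrom.trans
      (RefinesFrom.regularize n (G.regularizeStep_comm hn (φ (Fin.last n)) ψ)
        fun _ _ _ => subset_rfl)
      (regularize_regularizeStep_comm ψ n (by omega) _ _)

/-- Enlarging the sample of one level is at least as good as regularizing once more at this
level. -/
theorem regularize_refinesFrom_regularizeStep {l : ℕ} {ψ : PartMap Ω l} :
    ∀ (n : ℕ) (G : ColoredHypergraph.{v, w} k Ω) {m' m : Fin n → ℕ}
      {φ' : ∀ u, PartMap Ω (m' u)} {φ : ∀ u, PartMap Ω (m u)}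
      (_ : ∀ u i, Set.range (φ u i) ⊆ Set.range (φ' u i)) (t : Fin n)
      (_ : ∀ i, Set.range (ψ i) ⊆ Set.range (φ' t i)),
      RefinesFrom 0 (G.regularize n φ') ((G.regularize n φ).regularizeStep (t + 1) ψ)
  | 0, _, _, _, _, _, _, t, _ => t.elim0
  | n + 1, G, _, _, _, φ, hφ, t, hψ => by
    -- At the top level, the extra step moves inwards past all lower levels and is absorbed by the
    -- larger sample. At a lower level, the top step only passes to a larger sample and the
    -- recursion does the rest.
    induction t using Fin.lastCases with
    | last =>
      exact (RefinesFrom.regularize n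
        (G.regularizeStep_regularizeStep (hφ (Fin.last n)) hψ)
        fun u _ => hφ u.castSucc).trans
        (regularize_regularizeStep_comm ψ n (by simp) _ _)
    | cast t =>
      have h1 := regularize_refinesFrom_regularizeStep n
        (G.regularizeStep (n + 1) (φ (Fin.last n))) (fun u => hφ u.castSucc) t hψ
      refine RefinesFrom.trans (RefinesFrom.regularize n ?_ fun _ _ _ => subset_rfl) h1
      exact (RefinesFrom.refl 0 G).regularizeStep fun _ => hφ (Fin.last n)

end ColoredHypergraph
end PartiteRegularity

/-! ### Expectations over random partitionwise maps -/

namespace PartiteRegularity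

section Expect

variable {α β : Type*} [Fintype α] [Fintype β] {p : α → ℝ} {q : β → ℝ}

theorem expect_mono (hp : ∀ a, 0 ≤ p a) {f g : α → ℝ} (h : ∀ a, f a ≤ g a) :
    expect p f ≤ expect p g :=
  Finset.sum_le_sum fun a _ => mul_le_mul_of_nonneg_left (h a) (hp a)

theorem expect_nonneg (hp : ∀ a, 0 ≤ p a) {f : α → ℝ} (h : ∀ a, 0 ≤ f a) : 0 ≤ expect p f :=
  Finset.sum_nonneg fun a _ => mul_nonneg (hp a) (h a)

theorem expect_const (hp : ∑ a, p a = 1) (c : ℝ) : expect p (fun _ => c) = c := by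
  simp [expect, ← Finset.sum_mul, hp]

theorem expect_add (f g : α → ℝ) :
    expect p (fun a => f a + g a) = expect p f + expect p g := by
  simp [expect, mul_add, Finset.sum_add_distrib]

theorem expect_sub (f g : α → ℝ) :
    expect p (fun a => f a - g a) = expect p f - expect p g := by
  simp [expect, mul_sub, Finset.sum_sub_distrib]

theorem expect_const_mul (c : ℝ) (f : α → ℝ) :
    expect p (fun a => c * f a) = c * expect p f := by
  simp [expect, Finset.mul_sum, mul_left_comm]

theorem expect_sum {γ : Type*} (s : Finset γ) (f : γ → α → ℝ) :
    expect p (fun a => ∑ c ∈ s, f c a) = ∑ c ∈ s, expect p (f c) := by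
  simp only [expect, Finset.mul_sum]
  exact Finset.sum_comm

theorem expect_mul_sq_le (hp : ∀ a, 0 ≤ p a) (f g : α → ℝ) :
    expect p (fun a => f a * g a) ^ 2 ≤
      expect p (fun a => f a ^ 2) * expect p fun a => g a ^ 2 :=
  Finset.sum_sq_le_sum_mul_sum_of_sq_le_mul _
    (fun a _ => mul_nonneg (hp a) (sq_nonneg _)) (fun a _ => mul_nonneg (hp a) (sq_nonneg _))
    fun a _ => le_of_eq (by ring)

theorem expect_expect_eq (f : α → β → ℝ) :
    expect p (fun a => expect q (f a)) =
      expect (fun x : α × β => p x.1 * q x.2) fun x => f x.1 x.2 := by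
  simp only [expect, Fintype.sum_prod_type, Finset.mul_sum, mul_assoc]

theorem expect_expect_mul_sq_le (hp : ∀ a, 0 ≤ p a) (hq : ∀ b, 0 ≤ q b) (f g : α → β → ℝ) :
    expect p (fun a => expect q fun b => f a b * g a b) ^ 2 ≤
      expect p (fun a => expect q fun b => f a b ^ 2) *
        expect p fun a => expect q fun b => g a b ^ 2 := by
  simp only [expect_expect_eq]
  exact expect_mul_sq_le (fun x => mul_nonneg (hp _) (hq _)) _ _

theorem prob_eq_expect (A : Set α) [DecidablePred (· ∈ A)] :
    prob p A = expect p fun a => if a ∈ A then 1 else 0 := by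
  simp only [prob, expect, mul_ite, mul_one, mul_zero, Set.indicator_apply]

/-- Markov's inequality. -/
theorem one_sub_le_prob (hp : ∀ a, 0 ≤ p a) (hp1 : ∑ a, p a = 1) {f : α → ℝ} (hf : ∀ a, 0 ≤ f a)
    {c : ℝ} (hc : 0 < c) (h : expect p f ≤ c ^ 2) : 1 - c ≤ prob p {a | f a ≤ c} := by
  classical
  rw [prob_eq_expect]
  have h1 : c * expect p (fun a => 1 - if a ∈ {a | f a ≤ c} then 1 else 0) ≤ expect p f := by
    rw [← expect_const_mul]
    refine expect_mono hp fun a => ?_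
    by_cases ha : f a ≤ c
    · simpa [ha] using hf a
    · simpa [ha] using (not_le.1 ha).le
  rw [expect_sub, expect_const hp1] at h1
  have h2 := le_of_mul_le_mul_left ((h1.trans h).trans_eq (sq c)) hc
  linarith

end Expect

/-! ### Independent sampling of points in the vertex sets -/

section PartLaw

variable {ι : Type} [Fintype ι] [DecidableEq ι] {Ω : ι → Type v}

/-- The law of a random family of maps `W i → Ω i`: every point is mapped independently. -/
noncomputable def partLaw (p : ∀ i, Ω i → ℝ) (W : ι → Type) [∀ i, Fintype (W i)]
    (x : ∀ i, W i → Ω i) : ℝ :=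
  ∏ i, ∏ a, p i (x i a)

variable [∀ i, Fintype (Ω i)] {p : ∀ i, Ω i → ℝ}
  {A : ι → Type} [∀ i, Fintype (A i)] [∀ i, DecidableEq (A i)]
  {B : ι → Type} [∀ i, Fintype (B i)] [∀ i, DecidableEq (B i)]

theorem partLaw_nonneg (hp : ∀ i, p i ∈ stdSimplex ℝ (Ω i)) (x : ∀ i, A i → Ω i) :
    0 ≤ partLaw p A x :=
  Finset.prod_nonneg fun i _ => Finset.prod_nonneg fun _ _ => (hp i).1 _

theorem edgeLaw_nonneg (hp : ∀ i, p i ∈ stdSimplex ℝ (Ω i)) (I : Finset ι) (e : Edge Ω I) :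
    0 ≤ edgeLaw p I e :=
  Finset.prod_nonneg fun i _ => (hp i).1 _

theorem mapLaw_nonneg (hp : ∀ i, p i ∈ stdSimplex ℝ (Ω i)) {m : ℕ} (x : PartMap Ω m) :
    0 ≤ mapLaw p m x :=
  Finset.prod_nonneg fun i _ => Finset.prod_nonneg fun _ _ => (hp i).1 _

theorem mapsLaw_nonneg (hp : ∀ i, p i ∈ stdSimplex ℝ (Ω i)) {n : ℕ} {m : Fin n → ℕ}
    (x : ∀ t, PartMap Ω (m t)) : 0 ≤ mapsLaw p m x :=
  Finset.prod_nonneg fun _ _ => mapLaw_nonneg hp _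

/-- The restriction of a random map to part of the points is again a random map. -/
theorem expect_partLaw_comp (hp : ∀ i, p i ∈ stdSimplex ℝ (Ω i)) {σ : ∀ i, B i → A i}
    (hσ : ∀ i, Function.Injective (σ i)) (Φ : (∀ i, B i → Ω i) → ℝ) :
    expect (partLaw p A) (fun x => Φ fun i b => x i (σ i b)) = expect (partLaw p B) Φ := by
  classical
  unfold expect
  rw [← Finset.sum_fiberwise Finset.univ (fun (x : ∀ i, A i → Ω i) i b => x i (σ i b))]
  refine Finset.sum_congr rfl fun y _ => ?_
  -- The fiber is a product set: the values on the range of `σ i` are pinned, and every other point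
  -- contributes total mass 1.
  have h1 : ∀ i, (∑ f : A i → Ω i with (fun b => f (σ i b)) = y i, ∏ a, p i (f a)) =
      ∏ b, p i (y i b) := by
    intro i
    have hset : (Finset.univ.filter fun f : A i → Ω i => (fun b => f (σ i b)) = y i) =
        Fintype.piFinset fun a => Finset.univ.filter fun v => ∀ b, σ i b = a → v = y i b := by
      ext f
      simp only [Finset.mem_filter, Finset.mem_univ, true_and, Fintype.mem_piFinset, funext_iff]
      exact ⟨fun h a b hb => hb ▸ h b, fun h b => h _ b rfl⟩
    rw [hset, ← Finset.prod_univ_sum]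
    refine (Fintype.prod_of_injective _ (hσ i) _ _ ?_ ?_).symm
    · intro a ha
      have : (Finset.univ.filter fun v : Ω i => ∀ b, σ i b = a → v = y i b) = Finset.univ :=
        Finset.filter_true_of_mem fun v _ b hb => absurd ⟨b, hb⟩ ha
      rw [this, (hp i).2]
    · intro b
      have : (Finset.univ.filter fun v : Ω i => ∀ b', σ i b' = σ i b → v = y i b') = {y i b} := by
        ext v
        simp only [Finset.mem_filter, Finset.mem_univ, true_and, Finset.mem_singleton]
        exact ⟨fun h => h b rfl, fun h b' hb => by rw [hσ i hb, h]⟩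
      rw [this, Finset.sum_singleton]
  have h2 : (Finset.univ.filter fun x : ∀ i, A i → Ω i => (fun i b => x i (σ i b)) = y) =
      Fintype.piFinset fun i =>
        Finset.univ.filter fun f : A i → Ω i => (fun b => f (σ i b)) = y i := by
    ext x
    simp [Fintype.mem_piFinset, funext_iff]
  have h3 : ∑ x : (∀ i, A i → Ω i) with (fun i b => x i (σ i b)) = y, partLaw p A x =
      partLaw p B y := by
    rw [h2]
    unfold partLaw
    rw [← Finset.prod_univ_sum (fun i => Finset.univ.filter fun f : A i → Ω i =>
      (fun b => f (σ i b)) = y i) (fun i f => ∏ a, p i (f a))]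
    exact Finset.prod_congr rfl fun i _ => h1 i
  rw [← h3, Finset.sum_mul]
  refine Finset.sum_congr rfl fun x hx => ?_
  exact congrArg (fun z => partLaw p A x * Φ z) (Finset.mem_filter.1 hx).2

theorem sum_partLaw (hp : ∀ i, p i ∈ stdSimplex ℝ (Ω i)) : ∑ x, partLaw p A x = 1 := by
  have h1 : ∀ i, ∑ f : A i → Ω i, ∏ j, p i (f j) = 1 := fun i => by
    have := Fintype.prod_sum (fun (_ : A i) (x : Ω i) => p i x)
    rw [← this]; simp [(hp i).2]
  unfold partLaw
  have := Fintype.prod_sum (fun (i : ι) (f : A i → Ω i) => ∏ j, p i (f j))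
  rw [← this]; simp [h1]

/-- The image of an edge under a random map is a random edge. -/
theorem expect_partLaw_edge (hp : ∀ i, p i ∈ stdSimplex ℝ (Ω i)) {I : Finset ι} (e₀ : Edge A I)
    (Ψ : Edge Ω I → ℝ) :
    expect (partLaw p A) (fun x => Ψ fun i => x i.1 (e₀ i)) = expect (edgeLaw p I) Ψ := by
  -- One point over each `i ∈ I` and none elsewhere. An edge has at most one vertex over each index,
  -- so injectivity is automatic.
  have h := expect_partLaw_comp (A := A) (B := fun i => PLift (i ∈ I)) hp
    (σ := fun i u => e₀ ⟨i, u.down⟩) (fun i _ _ _ => Subsingleton.elim _ _)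
    (fun y => Ψ fun i => y i.1 ⟨i.2⟩)
  refine h.trans ?_
  let E : (∀ i, PLift (i ∈ I) → Ω i) ≃ Edge Ω I :=
    { toFun := fun y i => y i.1 ⟨i.2⟩
      invFun := fun e i u => e ⟨i, u.down⟩
      left_inv := fun _ => rfl
      right_inv := fun _ => rfl }
  refine Fintype.sum_equiv E _ _ fun y => ?_
  congr 1
  refine (Fintype.prod_of_injective (fun i : I => i.1) Subtype.val_injective _ _ ?_ ?_).symm
  · intro i hi
    have : IsEmpty (PLift (i ∈ I)) := ⟨fun u => hi ⟨⟨i, u.down⟩, rfl⟩⟩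
    exact Finset.prod_of_isEmpty _
  · intro i
    have : Unique (PLift (i.1 ∈ I)) := ⟨⟨⟨i.2⟩⟩, fun _ => Subsingleton.elim _ _⟩
    rw [Fintype.prod_unique]
    rfl

theorem expect_edgeLaw_restrict (hp : ∀ i, p i ∈ stdSimplex ℝ (Ω i)) {I J : Finset ι}
    (hJI : J ⊆ I) (Ψ : Edge Ω J → ℝ) :
    expect (edgeLaw p I) (fun e => Ψ (e.restrict hJI)) = expect (edgeLaw p J) Ψ := by
  rw [← expect_partLaw_edge hp (A := fun _ => Unit) (fun _ => ()) (fun e => Ψ (e.restrict hJI)),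
    ← expect_partLaw_edge hp (A := fun _ => Unit) (fun _ => ()) Ψ]
  rfl

theorem sum_edgeLaw (hp : ∀ i, p i ∈ stdSimplex ℝ (Ω i)) (I : Finset ι) :
    ∑ e, edgeLaw p I e = 1 := by
  have h := expect_partLaw_edge hp (A := fun _ => Unit) (I := I) (fun _ => ()) (fun _ => 1)
  rw [expect_const (sum_partLaw hp)] at h
  simpa [expect] using h.symm

/-- Maps on two disjoint sets of points are independent. -/
theorem expect_partLaw_sum (Φ : (∀ i, A i → Ω i) → (∀ i, B i → Ω i) → ℝ) :
    expect (partLaw p fun i => A i ⊕ B i)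
        (fun x => Φ (fun i a => x i (Sum.inl a)) fun i b => x i (Sum.inr b)) =
      expect (partLaw p A) fun x => expect (partLaw p B) fun y => Φ x y := by
  rw [expect_expect_eq]
  let E : (∀ i, A i ⊕ B i → Ω i) ≃ (∀ i, A i → Ω i) × (∀ i, B i → Ω i) :=
    { toFun := fun x => (fun i a => x i (Sum.inl a), fun i b => x i (Sum.inr b))
      invFun := fun y i => Sum.elim (y.1 i) (y.2 i)
      left_inv := fun x => by
        funext i a
        cases a <;> rfl
      right_inv := fun _ => rfl }
  refine Fintype.sum_equiv E _ _ fun x => ?_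
  simp only [partLaw, Fintype.prod_sum_type, Finset.prod_mul_distrib]
  rfl

theorem expect_mapsLaw_eq {n : ℕ} (m : Fin n → ℕ) (Φ : (∀ t, PartMap Ω (m t)) → ℝ) :
    expect (mapsLaw p m) Φ =
      expect (partLaw p fun _ => Σ t, Fin (m t)) fun x => Φ fun t i j => x i ⟨t, j⟩ := by
  let E : (∀ _ : ι, (Σ t, Fin (m t)) → Ω ‹ι›) ≃ (∀ t, PartMap Ω (m t)) :=
    { toFun := fun x t i j => x i ⟨t, j⟩
      invFun := fun φ i a => φ a.1 i a.2
      left_inv := fun _ => rfl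
      right_inv := fun _ => rfl }
  refine (Fintype.sum_equiv E _ _ fun x => ?_).symm
  congr 1
  simp only [partLaw, mapsLaw, mapLaw, E, Equiv.coe_fn_mk, Fintype.prod_sigma]
  exact Finset.prod_comm

theorem sum_mapsLaw (hp : ∀ i, p i ∈ stdSimplex ℝ (Ω i)) {n : ℕ} (m : Fin n → ℕ) :
    ∑ φ, mapsLaw p m φ = 1 := by
  have h := expect_mapsLaw_eq (p := p) m (fun _ => 1)
  rw [expect_const (sum_partLaw hp)] at h
  simpa [expect] using h

/-- The truncation of a family of maps. -/
def truncate {n : ℕ} {m m' : Fin n → ℕ} (hm : m ≤ m') (φ : ∀ t, PartMap Ω (m' t)) :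
    ∀ t, PartMap Ω (m t) :=
  fun t i j => φ t i (Fin.castLE (hm t) j)

theorem expect_truncate (hp : ∀ i, p i ∈ stdSimplex ℝ (Ω i)) {n : ℕ} {m m' : Fin n → ℕ}
    (hm : m ≤ m') (Φ : (∀ t, PartMap Ω (m t)) → ℝ) :
    expect (mapsLaw p m') (fun φ => Φ (truncate hm φ)) = expect (mapsLaw p m) Φ := by
  rw [expect_mapsLaw_eq, expect_mapsLaw_eq]
  refine expect_partLaw_comp (A := fun _ => Σ t, Fin (m' t)) (B := fun _ => Σ t, Fin (m t)) hp
    (σ := fun _ a => ⟨a.1, Fin.castLE (hm a.1) a.2⟩) (fun _ => ?_)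
    (fun x => Φ fun t i j => x i ⟨t, j⟩)
  rintro ⟨t, a⟩ ⟨u, b⟩ h
  simp only [Sigma.mk.injEq] at h
  obtain ⟨rfl, h⟩ := h
  simpa using h

/-- A random family of maps, enlarged at `t`, consists of a random family of maps and of a further
random map. -/
theorem expect_truncate_natAdd (hp : ∀ i, p i ∈ stdSimplex ℝ (Ω i)) {n : ℕ} {m m' : Fin n → ℕ}
    (hm : m ≤ m') (t : Fin n) {l : ℕ} (ht : m t + l = m' t)
    (Φ : (∀ t, PartMap Ω (m t)) → PartMap Ω l → ℝ) :
    expect (mapsLaw p m') (fun φ => Φ (truncate hm φ)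
        fun i j => φ t i (Fin.cast ht (Fin.natAdd (m t) j))) =
      expect (mapsLaw p m) fun φ => expect (mapLaw p l) (Φ φ) := by
  rw [expect_mapsLaw_eq, expect_mapsLaw_eq]
  refine Eq.trans ?_ (expect_partLaw_sum (A := fun _ => Σ t, Fin (m t)) (B := fun _ => Fin l)
    fun x ψ => Φ (fun t i j => x i ⟨t, j⟩) ψ)
  refine expect_partLaw_comp (A := fun _ => Σ t, Fin (m' t))
    (B := fun _ => (Σ t, Fin (m t)) ⊕ Fin l) hp
    (σ := fun _ => Sum.elim (fun a => ⟨a.1, Fin.castLE (hm a.1) a.2⟩)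
      (fun j => ⟨t, Fin.cast ht (Fin.natAdd (m t) j)⟩)) (fun _ => ?_)
    (fun x => Φ (fun t i j => x i (Sum.inl ⟨t, j⟩)) fun i j => x i (Sum.inr j))
  rintro (⟨u, a⟩ | a) (⟨u', b⟩ | b) h <;>
    simp only [Sum.elim_inl, Sum.elim_inr, Sigma.mk.injEq, true_and] at h
  · obtain ⟨rfl, h⟩ := h
    simpa using h
  · obtain ⟨rfl, h⟩ := h
    have := a.2
    simp [Fin.ext_iff] at h
    omega
  · obtain ⟨rfl, h⟩ := h
    have := b.2
    simp [Fin.ext_iff] at h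
    omega
  · simpa using h

end PartLaw

end PartiteRegularity

/-! ### Conditional expectations and energies -/

namespace PartiteRegularity

section CondExpect

variable {α τ τ' : Type*} [Fintype α]

open Classical in
/-- The conditional expectation of `f` with respect to the partition into the fibers of `T`. -/
noncomputable def condExpect (μ : α → ℝ) (T : α → τ) (f : α → ℝ) (x : α) : ℝ :=
  (∑ y with T y = T x, μ y * f y) / ∑ y with T y = T x, μ y

variable {μ : α → ℝ} {T : α → τ} {T' : α → τ'}

theorem condExpect_congr (f : α → ℝ) {x y : α} (h : T x = T y) :
    condExpect μ T f x = condExpect μ T f y := by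
  classical
  have h' : ∀ a, T a = T x ↔ T a = T y := fun a => by rw [h]
  unfold condExpect
  congr 1 <;> exact Finset.sum_congr (Finset.filter_congr fun a _ => h' a) fun _ _ => rfl

/-- After interchanging the two sums the mass of each fiber cancels. On fibers of mass 0 the
quotient is 0 by convention, which is harmless because all weights there vanish. -/
theorem expect_condExpect_mul (hμ : ∀ x, 0 ≤ μ x) (f : α → ℝ) {u : α → ℝ}
    (hu : ∀ x y, T x = T y → u x = u y) :
    expect μ (fun x => condExpect μ T f x * u x) = expect μ fun x => f x * u x := by
  classical
  have h1 : ∀ x, μ x * (condExpect μ T f x * u x) =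
      ∑ y, if T y = T x then μ x * (μ y * (f y * u y)) / (∑ z with T z = T y, μ z) else 0 := by
    intro x
    unfold condExpect
    rw [div_mul_eq_mul_div, Finset.sum_mul, Finset.sum_div, Finset.mul_sum, Finset.sum_filter]
    refine Finset.sum_congr rfl fun y _ => ?_
    split_ifs with h
    · rw [h, hu x y h.symm]
      ring
    · rfl
  unfold expect
  simp_rw [h1]
  rw [Finset.sum_comm]
  refine Finset.sum_congr rfl fun y _ => ?_
  have h2 : ∀ x, (if T y = T x then μ x * (μ y * (f y * u y)) / (∑ z with T z = T y, μ z) else 0) =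
      (if T x = T y then μ x else 0) * (μ y * (f y * u y)) / (∑ z with T z = T y, μ z) := by
    intro x
    by_cases h : T y = T x
    · simp [h]
    · simp [h, Ne.symm h]
  simp_rw [h2]
  rw [← Finset.sum_div, ← Finset.sum_mul, ← Finset.sum_filter]
  rcases eq_or_ne (∑ z with T z = T y, μ z) 0 with h0 | h0
  · have : μ y = 0 := (Finset.sum_eq_zero_iff_of_nonneg fun z _ => hμ z).1 h0 y (by simp)
    simp [this]
  · field_simp

/-- Pythagoras: conditional expectations are orthogonal projections, here onto nested spaces, and
the squared norm of a projection of `f` is its inner product with `f`. -/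
theorem expect_condExpect_sub_sq (hμ : ∀ x, 0 ≤ μ x) (hT : ∀ x y, T' x = T' y → T x = T y)
    (f : α → ℝ) :
    expect μ (fun x => (condExpect μ T' f x - condExpect μ T f x) ^ 2) =
      expect μ (fun x => f x * condExpect μ T' f x) -
        expect μ fun x => f x * condExpect μ T f x := by
  have h1 := expect_condExpect_mul (T := T') hμ f (u := condExpect μ T' f)
    fun x y h => condExpect_congr f h
  have h2 := expect_condExpect_mul (T := T') hμ f (u := condExpect μ T f)
    fun x y h => condExpect_congr f (hT x y h)
  have h3 := expect_condExpect_mul (T := T) hμ f (u := condExpect μ T f)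
    fun x y h => condExpect_congr f h
  rw [← h1, ← h3]
  have h4 : ∀ x, (condExpect μ T' f x - condExpect μ T f x) ^ 2 =
      condExpect μ T' f x * condExpect μ T' f x + condExpect μ T f x * condExpect μ T f x
        - 2 * (condExpect μ T' f x * condExpect μ T f x) := fun x => by ring
  simp_rw [h4]
  rw [expect_sub, expect_add, expect_const_mul, h2, h3]
  ring

open Classical in
/-- The expected conditional probability of the color class of a random point. -/
noncomputable def partEnergy {C : Type*} (μ : α → ℝ) (col : α → C) (T : α → τ) : ℝ :=
  expect μ fun x => condExpect μ T (fun y => if col y = col x then 1 else 0) x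

theorem partEnergy_congr {C C' : Type*} {col : α → C} {col' : α → C'}
    (h : ∀ x y, col x = col y ↔ col' x = col' y) : partEnergy μ col T = partEnergy μ col' T := by
  classical
  exact congrArg _ (funext fun x => congrArg (fun f => condExpect μ T f x)
    (funext fun y => if_congr (h y x) rfl rfl))

open Classical in
theorem partEnergy_eq_sum {C : Type*} [Fintype C] (col : α → C) :
    partEnergy μ col T = ∑ c, expect μ fun x => (if col x = c then 1 else 0) *
      condExpect μ T (fun y => if col y = c then 1 else 0) x := by
  rw [← expect_sum]
  simp [partEnergy]

open Classical in
theorem partEnergy_sub {C : Type*} [Fintype C] (hμ : ∀ x, 0 ≤ μ x)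
    (hT : ∀ x y, T' x = T' y → T x = T y) (col : α → C) :
    partEnergy μ col T' - partEnergy μ col T = ∑ c, expect μ fun x =>
      (condExpect μ T' (fun y => if col y = c then 1 else 0) x -
        condExpect μ T (fun y => if col y = c then 1 else 0) x) ^ 2 := by
  rw [partEnergy_eq_sum, partEnergy_eq_sum, ← Finset.sum_sub_distrib]
  exact Finset.sum_congr rfl fun c _ => (expect_condExpect_sub_sq hμ hT _).symm

end CondExpect

/-! ### Energy of a hypergraph and typical color vectors -/

namespace ColoredHypergraph

variable {ι : Type} {k : ℕ} {Ω : ι → Type v}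

noncomputable instance (G : ColoredHypergraph.{v, w} k Ω) (I : EdgeIndex ι k) :
    Fintype (G.Color I) :=
  have := G.finite_color I
  Fintype.ofFinite _

noncomputable instance (G : ColoredHypergraph.{v, w} k Ω) (I : EdgeIndex ι k) :
    DecidableEq (G.Color I) :=
  Classical.decEq _

/-- The frame-color of an edge. -/
def frame (G : ColoredHypergraph.{v, w} k Ω) (I : EdgeIndex ι k) (e : Edge Ω I.1) :
    ∀ J : {J : EdgeIndex ι k // J.1 ⊆ I.1}, J.1 ≠ I → G.Color J.1 :=
  fun J _ => G.totalColor I e J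

theorem mem_frameEvent_iff (G : ColoredHypergraph.{v, w} k Ω) {I : EdgeIndex ι k}
    {c : G.ColorVector I} {e : Edge Ω I.1} (he : e ∈ G.frameEvent I c) (e' : Edge Ω I.1) :
    e' ∈ G.frameEvent I c ↔ G.frame I e' = G.frame I e := by
  constructor
  · intro h
    funext J hJ
    exact (h J hJ).trans (he J hJ).symm
  · intro h J hJ
    exact (congrFun (congrFun h J) hJ).trans (he J hJ)

theorem mem_frameEvent_totalColor (G : ColoredHypergraph.{v, w} k Ω) (I : EdgeIndex ι k)
    (e : Edge Ω I.1) : e ∈ G.frameEvent I (G.totalColor I e) :=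
  fun _ _ => rfl

theorem mem_faceEvent_totalColor (G : ColoredHypergraph.{v, w} k Ω) (I : EdgeIndex ι k)
    (e : Edge Ω I.1) : e ∈ G.faceEvent I (G.totalColor I e) :=
  rfl

theorem RefinesFrom.frame_eq [Fintype ι] [DecidableEq ι] {G' G : ColoredHypergraph.{v, w} k Ω}
    (h : RefinesFrom 0 G' G) {I : EdgeIndex ι k} {e e' : Edge Ω I.1}
    (he : G'.frame I e = G'.frame I e') : G.frame I e = G.frame I e' := by
  funext J hJ
  exact h J.1 (Nat.zero_le _) _ _ (congrFun (congrFun he J) hJ)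

variable [Fintype ι] [DecidableEq ι] [∀ i, Fintype (Ω i)] {p : ∀ i, Ω i → ℝ}

open Classical in
theorem relDensity_eq_condExpect (G : ColoredHypergraph.{v, w} k Ω) {I : EdgeIndex ι k}
    {c : G.ColorVector I} {e : Edge Ω I.1} (he : e ∈ G.frameEvent I c)
    (h0 : prob (edgeLaw p I.1) (G.frameEvent I c) ≠ 0) :
    G.relDensity p I c = condExpect (edgeLaw p I.1) (G.frame I)
      (fun e' => if G.color I e' = c ⟨I, subset_rfl⟩ then 1 else 0) e := by
  rw [relDensity, if_neg h0, condExpect, prob_eq_expect, prob_eq_expect, expect, expect]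
  simp only [Finset.sum_filter, ← G.mem_frameEvent_iff he]
  congr 1 <;> refine Finset.sum_congr rfl fun e' _ => ?_
  · by_cases h1 : e' ∈ G.frameEvent I c <;>
      by_cases h2 : G.color I e' = c ⟨I, subset_rfl⟩ <;> simp [h1, h2, faceEvent]
  · simp

theorem prob_frameEvent_ne_zero (hp : ∀ i, p i ∈ stdSimplex ℝ (Ω i))
    (G : ColoredHypergraph.{v, w} k Ω) {I : EdgeIndex ι k} {c : G.ColorVector I} {e : Edge Ω I.1}
    (he : e ∈ G.frameEvent I c) (h0 : edgeLaw p I.1 e ≠ 0) :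
    prob (edgeLaw p I.1) (G.frameEvent I c) ≠ 0 := by
  classical
  intro h
  rw [prob, Finset.sum_eq_zero_iff_of_nonneg
    fun a _ => Set.indicator_nonneg (fun a _ => edgeLaw_nonneg hp _ a) a] at h
  have := h e (Finset.mem_univ _)
  rw [Set.indicator_of_mem he] at this
  exact h0 this

/-- The expected relative density of a random edge. -/
noncomputable def energy (G : ColoredHypergraph.{v, w} k Ω) (p : ∀ i, Ω i → ℝ)
    (I : EdgeIndex ι k) : ℝ :=
  expect (edgeLaw p I.1) fun e => G.relDensity p I (G.totalColor I e)

theorem energy_eq_partEnergy (hp : ∀ i, p i ∈ stdSimplex ℝ (Ω i))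
    (G : ColoredHypergraph.{v, w} k Ω) (I : EdgeIndex ι k) :
    G.energy p I = partEnergy (edgeLaw p I.1) (G.color I) (G.frame I) := by
  classical
  refine Finset.sum_congr rfl fun e _ => ?_
  rcases eq_or_ne (edgeLaw p I.1 e) 0 with h | h
  · simp [h]
  · dsimp only
    rw [G.relDensity_eq_condExpect (G.mem_frameEvent_totalColor I e)
      (G.prob_frameEvent_ne_zero hp (G.mem_frameEvent_totalColor I e) h)]
    rfl

theorem energy_nonneg (hp : ∀ i, p i ∈ stdSimplex ℝ (Ω i)) (G : ColoredHypergraph.{v, w} k Ω)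
    (I : EdgeIndex ι k) : 0 ≤ G.energy p I :=
  expect_nonneg (edgeLaw_nonneg hp _) fun _ => (G.relDensity_mem p hp _ _).1

theorem energy_le_one (hp : ∀ i, p i ∈ stdSimplex ℝ (Ω i)) (G : ColoredHypergraph.{v, w} k Ω)
    (I : EdgeIndex ι k) : G.energy p I ≤ 1 :=
  (expect_mono (edgeLaw_nonneg hp _) fun _ => (G.relDensity_mem p hp _ _).2).trans_eq
    (expect_const (sum_edgeLaw hp _) 1)

-- `G'` and `G` have different color sets but partition the edges of size at least `s` in the same
-- way. So both energies can be written with the colors of `G`, and only the conditioning on the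
-- frame differs.
open Classical in
theorem energy_sub (hp : ∀ i, p i ∈ stdSimplex ℝ (Ω i)) {G' G : ColoredHypergraph.{v, w} k Ω}
    (h : RefinesFrom 0 G' G) {s : ℕ} (h' : RefinesFrom s G G') {I : EdgeIndex ι k}
    (hI : s ≤ I.1.card) :
    G'.energy p I - G.energy p I = ∑ c : G.Color I, expect (edgeLaw p I.1) fun e =>
      (condExpect (edgeLaw p I.1) (G'.frame I) (fun e' => if G.color I e' = c then 1 else 0) e -
        condExpect (edgeLaw p I.1) (G.frame I)
          (fun e' => if G.color I e' = c then 1 else 0) e) ^ 2 := by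
  rw [energy_eq_partEnergy hp, energy_eq_partEnergy hp, partEnergy_congr (col' := G.color I)
    fun x y => ⟨h I (Nat.zero_le _) x y, h' I hI x y⟩]
  exact partEnergy_sub (edgeLaw_nonneg hp _) (fun x y hxy => h.frame_eq hxy) _

theorem energy_mono (hp : ∀ i, p i ∈ stdSimplex ℝ (Ω i)) {G' G : ColoredHypergraph.{v, w} k Ω}
    (h : RefinesFrom 0 G' G) {s : ℕ} (h' : RefinesFrom s G G') {I : EdgeIndex ι k}
    (hI : s ≤ I.1.card) : G.energy p I ≤ G'.energy p I := by
  rw [← sub_nonneg, energy_sub hp h h' hI]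
  exact Finset.sum_nonneg fun c _ => expect_nonneg (edgeLaw_nonneg hp _) fun e => sq_nonneg _

/-- The expected increment of the energy under one further regularization with `l` sample points. -/
noncomputable def irregularity (G : ColoredHypergraph.{v, w} k Ω) (p : ∀ i, Ω i → ℝ) (l : ℕ)
    (I : EdgeIndex ι k) : ℝ :=
  expect (mapLaw p l) (fun ψ => (G.regularizeStep (I.1.card - 1) ψ).energy p I) - G.energy p I

open Classical in
/-- The mean square of the change of the relative density of a color under one further
regularization with `l` sample points, on the edges of a given frame-color. -/
noncomputable def deviation (G : ColoredHypergraph.{v, w} k Ω) (p : ∀ i, Ω i → ℝ) (l : ℕ)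
    (I : EdgeIndex ι k) (c : G.ColorVector I) : ℝ :=
  expect (mapLaw p l) fun ψ => expect (edgeLaw p I.1) fun e =>
    (if e ∈ G.frameEvent I c then 1 else 0) *
      (condExpect (edgeLaw p I.1) ((G.regularizeStep (I.1.card - 1) ψ).frame I)
        (fun e' => if G.color I e' = c ⟨I, subset_rfl⟩ then 1 else 0) e - G.relDensity p I c) ^ 2

-- The edge `e` determines its frame-color, so among the vectors whose frame it has, the top color
-- determines the vector. The left side therefore visits each value of `F` at most once.
open Classical in
theorem sum_frameEvent_le (G : ColoredHypergraph.{v, w} k Ω) (I : EdgeIndex ι k) (e : Edge Ω I.1)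
    {F : G.Color I → ℝ} (hF : ∀ x, 0 ≤ F x) :
    ∑ c : G.ColorVector I, (if e ∈ G.frameEvent I c then 1 else 0) * F (c ⟨I, subset_rfl⟩) ≤
      ∑ x, F x := by
  simp only [ite_mul, one_mul, zero_mul, ← Finset.sum_filter]
  rw [← Finset.sum_image (f := F) (g := fun c : G.ColorVector I => c ⟨I, subset_rfl⟩)]
  · exact Finset.sum_le_sum_of_subset_of_nonneg (Finset.subset_univ _) fun x _ _ => hF x
  · intro c hc c' hc' h
    simp only [Finset.coe_filter, Finset.mem_univ, true_and, Set.mem_ofPred_eq] at hc hc'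
    funext J
    by_cases hJ : J.1 = I
    · obtain ⟨J, hJI⟩ := J
      dsimp only at hJ
      subst hJ
      exact h
    · exact (hc J hJ).symm.trans (hc' J hJ)

/-- On the frame event of `c` the relative density is the conditional expectation given the old
frame. Thus the deviations are pieces of the sum of squares by which the energy grows. -/
theorem sum_deviation_le (hp : ∀ i, p i ∈ stdSimplex ℝ (Ω i)) (G : ColoredHypergraph.{v, w} k Ω)
    (l : ℕ) (I : EdgeIndex ι k) : ∑ c, G.deviation p l I c ≤ G.irregularity p l I := by
  classical
  have hI : 0 < I.1.card := I.2.1.card_pos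
  unfold deviation irregularity
  rw [← expect_sum, ← expect_const (sum_mapLaw p hp l) (G.energy p I), ← expect_sub]
  refine expect_mono (mapLaw_nonneg hp) fun ψ => ?_
  rw [energy_sub hp (G.regularizeStep_refinesFrom _ ψ)
    (G.refinesFrom_regularizeStep (Nat.sub_lt hI one_pos) ψ) le_rfl, ← expect_sum, ← expect_sum]
  refine Finset.sum_le_sum fun e _ => ?_
  rcases eq_or_ne (edgeLaw p I.1 e) 0 with h0 | h0
  · simp [h0]
  refine mul_le_mul_of_nonneg_left ?_ (edgeLaw_nonneg hp _ e)
  refine le_trans (Finset.sum_le_sum fun c _ => ?_) (G.sum_frameEvent_le I e (F := fun x =>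
    (condExpect (edgeLaw p I.1) ((G.regularizeStep (I.1.card - 1) ψ).frame I)
        (fun e' => if G.color I e' = x then 1 else 0) e -
      condExpect (edgeLaw p I.1) (G.frame I)
        (fun e' => if G.color I e' = x then 1 else 0) e) ^ 2) fun x => sq_nonneg _)
  by_cases he : e ∈ G.frameEvent I c
  · rw [G.relDensity_eq_condExpect he (G.prob_frameEvent_ne_zero hp he h0)]
  · simp [he]

theorem deviation_nonneg (hp : ∀ i, p i ∈ stdSimplex ℝ (Ω i)) (G : ColoredHypergraph.{v, w} k Ω)
    (l : ℕ) (I : EdgeIndex ι k) (c : G.ColorVector I) : 0 ≤ G.deviation p l I c :=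
  expect_nonneg (mapLaw_nonneg hp) fun _ => expect_nonneg (edgeLaw_nonneg hp _) fun _ =>
    mul_nonneg (by split_ifs <;> simp) (sq_nonneg _)

/-- A color vector is `(θ, κ)`-typical if its relative density is at least `θ`, and changes by at
most `κ` in mean square under one further regularization. -/
def IsTypical (G : ColoredHypergraph.{v, w} k Ω) (p : ∀ i, Ω i → ℝ) (l : ℕ) (θ κ : ℝ)
    (I : EdgeIndex ι k) (c : G.ColorVector I) : Prop :=
  θ ≤ G.relDensity p I c ∧
    G.deviation p l I c ≤ κ * prob (edgeLaw p I.1) (G.frameEvent I c)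

theorem prob_face_inter_frame (hp : ∀ i, p i ∈ stdSimplex ℝ (Ω i))
    (G : ColoredHypergraph.{v, w} k Ω) (I : EdgeIndex ι k) (c : G.ColorVector I) :
    prob (edgeLaw p I.1) (G.faceEvent I c ∩ G.frameEvent I c) =
      G.relDensity p I c * prob (edgeLaw p I.1) (G.frameEvent I c) := by
  unfold relDensity
  split_ifs with h
  · rw [one_mul]
    exact le_antisymm (prob_mono (edgeLaw_nonneg hp _) Set.inter_subset_right)
      (h ▸ prob_nonneg (edgeLaw_nonneg hp _) _)
  · field_simp

-- For each top color the frame events are disjoint, so their probabilities over all vectors add up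
-- to at most the number of colors. Vectors of density below `θ` therefore carry mass at most `θ`
-- times this number. Vectors of large deviation are controlled by Markov's inequality and
-- `sum_deviation_le`.
open Classical in
theorem expect_not_isTypical_le (hp : ∀ i, p i ∈ stdSimplex ℝ (Ω i))
    (G : ColoredHypergraph.{v, w} k Ω) (l : ℕ) {θ κ : ℝ} (hθ : 0 ≤ θ) (hκ : 0 < κ)
    (I : EdgeIndex ι k) :
    expect (edgeLaw p I.1)
        (fun e => if G.IsTypical p l θ κ I (G.totalColor I e) then 0 else 1) ≤
      θ * Nat.card (G.Color I) + G.irregularity p l I / κ := by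
  have hμ := edgeLaw_nonneg hp I.1
  have h1 : ∑ c : G.ColorVector I, prob (edgeLaw p I.1) (G.frameEvent I c) ≤
      Nat.card (G.Color I) := by
    simp only [prob_eq_expect]
    rw [← expect_sum, ← expect_const (sum_edgeLaw hp I.1) (Nat.card (G.Color I) : ℝ)]
    refine expect_mono hμ fun e => ?_
    simpa using G.sum_frameEvent_le I e (F := fun _ => 1) fun _ => zero_le_one
  have h2 : expect (edgeLaw p I.1)
        (fun e => if G.IsTypical p l θ κ I (G.totalColor I e) then 0 else 1) ≤
      ∑ c : G.ColorVector I,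
        ((if G.relDensity p I c < θ then
            prob (edgeLaw p I.1) (G.faceEvent I c ∩ G.frameEvent I c) else 0) +
          if κ * prob (edgeLaw p I.1) (G.frameEvent I c) < G.deviation p l I c then
            prob (edgeLaw p I.1) (G.frameEvent I c) else 0) := by
    have h3 : ∀ c : G.ColorVector I,
        ((if G.relDensity p I c < θ then
            prob (edgeLaw p I.1) (G.faceEvent I c ∩ G.frameEvent I c) else 0) +
          if κ * prob (edgeLaw p I.1) (G.frameEvent I c) < G.deviation p l I c then
            prob (edgeLaw p I.1) (G.frameEvent I c) else 0) =
        expect (edgeLaw p I.1) fun e =>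
          (if G.relDensity p I c < θ then
            if e ∈ G.faceEvent I c ∩ G.frameEvent I c then 1 else 0 else 0) +
          if κ * prob (edgeLaw p I.1) (G.frameEvent I c) < G.deviation p l I c then
            if e ∈ G.frameEvent I c then 1 else 0 else 0 := by
      intro c
      rw [expect_add]
      congr 1
      · by_cases h : G.relDensity p I c < θ
        · simp only [h, if_true, prob_eq_expect]
        · simp [h, expect]
      · by_cases h : κ * prob (edgeLaw p I.1) (G.frameEvent I c) < G.deviation p l I c
        · simp only [h, if_true]
          rw [prob_eq_expect]
        · simp [h, expect]
    simp only [h3]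
    rw [← expect_sum]
    refine expect_mono hμ fun e => ?_
    have h0 : ∀ c : G.ColorVector I, 0 ≤ (if G.relDensity p I c < θ then
            if e ∈ G.faceEvent I c ∩ G.frameEvent I c then (1 : ℝ) else 0 else 0) +
          if κ * prob (edgeLaw p I.1) (G.frameEvent I c) < G.deviation p l I c then
            if e ∈ G.frameEvent I c then 1 else 0 else 0 := fun c => by
      refine add_nonneg ?_ ?_ <;> split_ifs <;> simp
    refine le_trans ?_ (Finset.single_le_sum (fun c _ => h0 c)
      (Finset.mem_univ (G.totalColor I e)))
    have hm1 := G.mem_frameEvent_totalColor I e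
    have hm2 := G.mem_faceEvent_totalColor I e
    by_cases ht : G.IsTypical p l θ κ I (G.totalColor I e)
    · simpa only [ht, if_true] using h0 _
    · simp only [ht, if_false, Set.mem_inter_iff, hm1, hm2, and_self, if_true]
      by_cases hd : G.relDensity p I (G.totalColor I e) < θ
      · simp only [hd, if_true]
        have : (0 : ℝ) ≤ if κ * prob (edgeLaw p I.1) (G.frameEvent I (G.totalColor I e)) <
          G.deviation p l I (G.totalColor I e) then 1 else 0 := by split_ifs <;> simp
        linarith
      · rw [IsTypical, not_and, not_le] at ht
        simp [hd, ht (not_lt.1 hd)]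
  refine h2.trans ?_
  rw [Finset.sum_add_distrib]
  refine add_le_add ?_ ?_
  · refine le_trans ?_ (mul_le_mul_of_nonneg_left h1 hθ)
    rw [Finset.mul_sum]
    refine Finset.sum_le_sum fun c _ => ?_
    have hP := prob_nonneg hμ (G.frameEvent I c)
    split_ifs with h
    · rw [prob_face_inter_frame hp]
      exact mul_le_mul_of_nonneg_right h.le hP
    · exact mul_nonneg hθ hP
  · rw [le_div_iff₀ hκ]
    refine le_trans ?_ (G.sum_deviation_le hp l I)
    rw [Finset.sum_mul]
    refine Finset.sum_le_sum fun c _ => ?_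
    split_ifs with h
    · linarith
    · simpa using G.deviation_nonneg hp l I c

end ColoredHypergraph
end PartiteRegularity

/-! ### Patterns and the removal of one edge -/

namespace PartiteRegularity

/-- The image of an edge under a family of maps. -/
def Edge.map {ι : Type} {W : ι → Type*} {V : ι → Type*} {I : Finset ι} (x : ∀ i, W i → V i)
    (e : ∀ i : I, W i) : ∀ i : I, V i :=
  fun i => x i.1 (e i)

/-- The edges of size at most `k` on the vertex sets `W i`. -/
abbrev PatternEdge {ι : Type} (k : ℕ) (W : ι → Type) : Type :=
  Σ I : EdgeIndex ι k, Edge W I.1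

section Mix

variable {ι : Type} [Fintype ι] [DecidableEq ι] {Ω : ι → Type v}
  {W : ι → Type} [∀ i, DecidableEq (W i)]

/-- `w` is a vertex of `e₀`. -/
abbrev Edge.HasVertex {I : Finset ι} (e₀ : Edge W I) {i : ι} (w : W i) : Prop :=
  ∃ hi : i ∈ I, e₀ ⟨i, hi⟩ = w

/-- The map that sends the edge `e₀` to `e`, and all other vertices as `z`. -/
def mix {I : Finset ι} (e₀ : Edge W I) (z : ∀ i, W i → Ω i) (e : Edge Ω I) : ∀ i, W i → Ω i :=
  fun i w => if h : e₀.HasVertex w then e ⟨i, h.fst⟩ else z i w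

theorem mix_map {I : Finset ι} (e₀ : Edge W I) (z x : ∀ i, W i → Ω i) :
    mix e₀ z (Edge.map x e₀) = fun i w => if e₀.HasVertex w then x i w else z i w := by
  funext i w
  unfold mix
  split_ifs with h
  · exact congrArg (x i) h.snd
  · rfl

theorem map_mix_self {I : Finset ι} (e₀ : Edge W I) (z : ∀ i, W i → Ω i) (e : Edge Ω I) :
    Edge.map (mix e₀ z e) e₀ = e := by
  funext i
  have h : e₀.HasVertex (e₀ i) := ⟨i.2, rfl⟩
  simp only [Edge.map, mix, dif_pos h]

/-- The embedding of `W` into the vertex sets `W i × Bool`, where the vertices of `e₀` always go to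
the copy `true`. -/
def duplicate {I : Finset ι} (e₀ : Edge W I) (b : Bool) (i : ι) (w : W i) : W i × Bool :=
  (w, if e₀.HasVertex w then true else b)

variable [∀ i, Fintype (Ω i)] [∀ i, Fintype (W i)] {p : ∀ i, Ω i → ℝ}

/-- A random map of the pattern may be produced by sampling the image of `e₀` and taking the other
vertices from the sample `ψ`, since all points used are distinct. -/
theorem expect_mix (hp : ∀ i, p i ∈ stdSimplex ℝ (Ω i)) {I : Finset ι} (e₀ : Edge W I) {l : ℕ}
    {τ : ∀ i, W i → Fin l} (hτ : ∀ i, Function.Injective (τ i)) (Φ : (∀ i, W i → Ω i) → ℝ) :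
    expect (mapLaw p l) (fun ψ => expect (edgeLaw p I) fun e =>
      Φ (mix e₀ (fun i w => ψ i (τ i w)) e)) = expect (partLaw p W) Φ := by
  simp_rw [← expect_partLaw_edge (A := W) hp e₀]
  have h1 : ∀ (ψ : PartMap Ω l) (x : ∀ i, W i → Ω i),
      mix e₀ (fun i w => ψ i (τ i w)) (fun i => x i.1 (e₀ i)) = _ :=
    fun ψ x => mix_map e₀ (fun i w => ψ i (τ i w)) x
  simp only [h1]
  refine (expect_partLaw_sum (A := fun _ => Fin l) (B := W) (p := p) fun ψ x =>
    Φ fun i w => if e₀.HasVertex w then x i w else ψ i (τ i w)).symm.trans ?_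
  rw [← expect_partLaw_comp (A := fun i => Fin l ⊕ W i) (B := W) hp
    (σ := fun i w => if e₀.HasVertex w then Sum.inr w else Sum.inl (τ i w))]
  · refine congrArg _ (funext fun x => congrArg Φ ?_)
    funext i w
    split_ifs <;> rfl
  · intro i w w' h
    dsimp only at h
    split_ifs at h
    · exact Sum.inr_injective h
    · exact hτ i (Sum.inl_injective h)

/-- Two disjoint blocks of sample points with a common image of `e₀` give a random map of two copies
of `W` glued along the vertices of `e₀`. -/
theorem expect_mix_mix (hp : ∀ i, p i ∈ stdSimplex ℝ (Ω i)) {I : Finset ι} (e₀ : Edge W I) {l : ℕ}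
    {τ τ' : ∀ i, W i → Fin l} (hτ : ∀ i, Function.Injective (τ i))
    (hτ' : ∀ i, Function.Injective (τ' i)) (hττ : ∀ i w w', τ i w ≠ τ' i w')
    (Φ : (∀ i, W i → Ω i) → (∀ i, W i → Ω i) → ℝ) :
    expect (mapLaw p l) (fun ψ => expect (edgeLaw p I) fun e =>
      Φ (mix e₀ (fun i w => ψ i (τ i w)) e) (mix e₀ (fun i w => ψ i (τ' i w)) e)) =
    expect (partLaw p fun i => W i × Bool) fun y =>
      Φ (fun i w => y i (duplicate e₀ true i w)) fun i w => y i (duplicate e₀ false i w) := by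
  simp_rw [← expect_partLaw_edge (A := W) hp e₀]
  have h1 : ∀ (τ : ∀ i, W i → Fin l) (ψ : PartMap Ω l) (x : ∀ i, W i → Ω i),
      mix e₀ (fun i w => ψ i (τ i w)) (fun i => x i.1 (e₀ i)) = _ :=
    fun τ ψ x => mix_map e₀ (fun i w => ψ i (τ i w)) x
  simp only [h1]
  refine (expect_partLaw_sum (A := fun _ => Fin l) (B := W) (p := p) fun ψ x =>
    Φ (fun i w => if e₀.HasVertex w then x i w else ψ i (τ i w))
      fun i w => if e₀.HasVertex w then x i w else ψ i (τ' i w)).symm.trans ?_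
  rw [← expect_partLaw_comp (A := fun i => Fin l ⊕ W i) (B := fun i => W i × Bool) hp
    (σ := fun i w => if w.2 then (if e₀.HasVertex w.1 then Sum.inr w.1 else Sum.inl (τ i w.1))
      else Sum.inl (τ' i w.1))]
  · refine congrArg _ (funext fun x => congrArg₂ Φ ?_ ?_) <;>
    · funext i w
      by_cases h : e₀.HasVertex w <;> simp [duplicate, h]
  · rintro i ⟨w, b⟩ ⟨w', b'⟩ h
    cases b <;> cases b' <;> simp only [Bool.false_eq_true, if_true, if_false] at h
    · rw [hτ' i (Sum.inl_injective h)]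
    · split_ifs at h
      exact absurd (Sum.inl_injective h).symm (hττ i w' w)
    · split_ifs at h
      exact absurd (Sum.inl_injective h) (hττ i w w')
    · split_ifs at h
      · rw [Sum.inr_injective h]
      · rw [hτ i (Sum.inl_injective h)]

end Mix

/-! ### Pattern probabilities and the effect of one edge -/

namespace ColoredHypergraph

variable {ι : Type} [Fintype ι] [DecidableEq ι] {k : ℕ} {Ω : ι → Type v}
  {W : ι → Type} [∀ i, Fintype (W i)] [∀ i, DecidableEq (W i)]

/-- The indicator of the event that all edges in `U` get the colors prescribed by `col`. -/
noncomputable def copies (G : ColoredHypergraph.{v, w} k Ω)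
    (col : ∀ I : EdgeIndex ι k, Edge W I.1 → G.Color I) (U : Finset (PatternEdge k W))
    (x : ∀ i, W i → Ω i) : ℝ :=
  if ∀ y ∈ U, G.color y.1 (Edge.map x y.2) = col y.1 y.2 then 1 else 0

/-- The color vector prescribed for the edge `y`. -/
def patternVector {G : ColoredHypergraph.{v, w} k Ω}
    (col : ∀ I : EdgeIndex ι k, Edge W I.1 → G.Color I) (y : PatternEdge k W) :
    G.ColorVector y.1 :=
  fun J => col J.1 (y.2.restrict J.2)

/-- The proper subedges of an edge. -/
def boundary (y : PatternEdge k W) : Finset (PatternEdge k W) :=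
  (Finset.univ.filter fun J : EdgeIndex ι k => J.1 ⊆ y.1.1 ∧ J ≠ y.1).attach.image fun J =>
    ⟨J.1, y.2.restrict (Finset.mem_filter.1 J.2).2.1⟩

theorem mem_boundary {y z : PatternEdge k W} :
    z ∈ boundary y ↔ ∃ (J : EdgeIndex ι k) (hJ : J.1 ⊆ y.1.1), J ≠ y.1 ∧
      z = ⟨J, y.2.restrict hJ⟩ := by
  rw [boundary, Finset.mem_image]
  constructor
  · rintro ⟨⟨J, hJ⟩, -, rfl⟩
    exact ⟨J, (Finset.mem_filter.1 hJ).2.1, (Finset.mem_filter.1 hJ).2.2, rfl⟩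
  · rintro ⟨J, h1, h2, rfl⟩
    exact ⟨⟨J, Finset.mem_filter.2 ⟨Finset.mem_univ _, h1, h2⟩⟩, Finset.mem_attach _ _, rfl⟩

/-- The edges of two copies of `U` glued along `e₀`. -/
def double {I : Finset ι} (e₀ : Edge W I) (U : Finset (PatternEdge k W)) :
    Finset (PatternEdge k fun i => W i × Bool) :=
  (U.image fun y => ⟨y.1, Edge.map (duplicate e₀ true) y.2⟩) ∪
    U.image fun y => ⟨y.1, Edge.map (duplicate e₀ false) y.2⟩

/-- The colors prescribed for a doubled pattern. -/
def doubleColor {G : ColoredHypergraph.{v, w} k Ω}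
    (col : ∀ I : EdgeIndex ι k, Edge W I.1 → G.Color I) :
    ∀ I : EdgeIndex ι k, Edge (fun i => W i × Bool) I.1 → G.Color I :=
  fun I e => col I (Edge.map (fun _ => Prod.fst) e)

section

variable {G : ColoredHypergraph.{v, w} k Ω}
  (col : ∀ I : EdgeIndex ι k, Edge W I.1 → G.Color I)

theorem copies_nonneg (U : Finset (PatternEdge k W)) (x : ∀ i, W i → Ω i) :
    0 ≤ G.copies col U x := by
  unfold copies
  split_ifs <;> simp

theorem copies_le_one (U : Finset (PatternEdge k W)) (x : ∀ i, W i → Ω i) :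
    G.copies col U x ≤ 1 := by
  unfold copies
  split_ifs <;> simp

theorem copies_anti {U V : Finset (PatternEdge k W)} (h : U ⊆ V) (x : ∀ i, W i → Ω i) :
    G.copies col V x ≤ G.copies col U x := by
  unfold copies
  split_ifs with h1 h2
  · rfl
  · exact absurd (fun y hy => h1 y (h hy)) h2
  · exact zero_le_one
  · rfl

theorem copies_insert (y : PatternEdge k W) (U : Finset (PatternEdge k W)) (x : ∀ i, W i → Ω i) :
    G.copies col (insert y U) x =
      (if G.color y.1 (Edge.map x y.2) = col y.1 y.2 then 1 else 0) * G.copies col U x := by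
  simp only [copies, Finset.forall_mem_insert]
  split_ifs <;> simp_all

theorem ite_and_one_zero (P Q : Prop) [Decidable P] [Decidable Q] [Decidable (P ∧ Q)] :
    (if P ∧ Q then (1 : ℝ) else 0) = (if P then 1 else 0) * if Q then 1 else 0 := by
  by_cases hP : P <;> by_cases hQ : Q <;> simp [hP, hQ]

theorem copies_double {I : Finset ι} (e₀ : Edge W I) (U : Finset (PatternEdge k W))
    (x : ∀ i, W i × Bool → Ω i) :
    G.copies (doubleColor col) (double e₀ U) x =
      G.copies col U (fun i w => x i (duplicate e₀ true i w)) *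
        G.copies col U fun i w => x i (duplicate e₀ false i w) := by
  have h : (∀ y ∈ double e₀ U, G.color y.1 (Edge.map x y.2) = doubleColor col y.1 y.2) ↔
      (∀ y ∈ U, G.color y.1 (Edge.map (fun i w => x i (duplicate e₀ true i w)) y.2) =
        col y.1 y.2) ∧
      ∀ y ∈ U, G.color y.1 (Edge.map (fun i w => x i (duplicate e₀ false i w)) y.2) =
        col y.1 y.2 := by
    simp only [double, Finset.forall_mem_union, Finset.forall_mem_image]
    rfl
  classical
  unfold copies
  exact (if_congr h rfl rfl).trans (ite_and_one_zero _ _)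

/-- The conditions on a pattern with an edge `e₀` removed are visible in the frame of `e₀` after a
further regularization, if all other vertices are sampled. -/
theorem copies_mix_eq {y₀ : PatternEdge k W} {V : Finset (PatternEdge k W)}
    (hV : ∀ y ∈ V, y.1.1.card ≤ y₀.1.1.card) (hy₀ : y₀ ∉ V) {l : ℕ} (ψ : PartMap Ω l)
    (τ : ∀ i, W i → Fin l) {e e' : Edge Ω y₀.1.1}
    (he : (G.regularizeStep (y₀.1.1.card - 1) ψ).frame y₀.1 e =
      (G.regularizeStep (y₀.1.1.card - 1) ψ).frame y₀.1 e') :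
    G.copies col V (mix y₀.2 (fun i w => ψ i (τ i w)) e) =
      G.copies col V (mix y₀.2 (fun i w => ψ i (τ i w)) e') := by
  suffices h : ∀ y ∈ V, G.color y.1 (Edge.map (mix y₀.2 (fun i w => ψ i (τ i w)) e) y.2) =
      G.color y.1 (Edge.map (mix y₀.2 (fun i w => ψ i (τ i w)) e') y.2) by
    refine if_congr ⟨fun h' y hy => ?_, fun h' y hy => ?_⟩ rfl rfl
    · rw [← h y hy, h' y hy]
    · rw [h y hy, h' y hy]
  rintro ⟨K, f⟩ hy
  have hK := hV _ hy
  obtain ⟨I, e₀⟩ := y₀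
  dsimp only at *
  -- `J` records where `f` meets `e₀`; the image of `f` depends on `e` only through its restriction
  -- to `J`.
  let J : Finset ι := K.1.filter fun i => ∃ h : i ∈ K.1, e₀.HasVertex (f ⟨i, h⟩)
  have hJK : J ⊆ K.1 := Finset.filter_subset _ _
  have hJI : J ⊆ I.1 := fun i hi => (Finset.mem_filter.1 hi).2.snd.fst
  have hmem : ∀ i : K.1, i.1 ∈ J ↔ e₀.HasVertex (f i) := fun i =>
    ⟨fun h => (Finset.mem_filter.1 h).2.snd, fun h => Finset.mem_filter.2 ⟨i.2, i.2, h⟩⟩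
  rcases J.eq_empty_or_nonempty with h0 | h0
  · congr 1
    funext i
    have : ¬ e₀.HasVertex (f i) := by rw [← hmem, h0]; simp
    simp only [Edge.map, mix, dif_neg this]
  · let J' : EdgeIndex ι k := ⟨J, h0, (Finset.card_le_card hJI).trans I.2.2⟩
    -- If `J` were all of `I`, the size bound would force `K = I` and then `f = e₀`, which is not in
    -- `V`.
    have hJ' : J' ≠ I := by
      rintro h
      have hJI' : J = I.1 := congrArg Subtype.val h
      have hIK : I = K := by
        refine Subtype.ext (Finset.eq_of_subset_of_card_le ?_ hK)
        exact hJI' ▸ hJK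
      subst hIK
      refine hy₀ ?_
      have : f = e₀ := by
        funext i
        have : i.1 ∈ J := hJI'.symm ▸ i.2
        exact ((hmem i).1 this).snd.symm
      rwa [this] at hy
    have h1 := congrFun (congrFun he ⟨J', hJI⟩) hJ'
    -- Since `|K| ≤ |I| = (|I| - 1) + 1`, the color of the image of `f` is one coordinate of the new
    -- color of the proper subedge over `J`.
    have h2 := (G.regularizeStep_color_eq_iff _ ψ J' _ _).1 h1 K hJK
      (Or.inr (by have := I.2.1.card_pos; omega))
      (Edge.map (fun i w => ψ i (τ i w)) f) fun i _ => ⟨τ i.1 (f i), rfl⟩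
    have key : ∀ e : Edge Ω I.1, (Edge.restrict e hJI).glue
        (Edge.map (fun i w => ψ i (τ i w)) f) =
        Edge.map (mix e₀ (fun i w => ψ i (τ i w)) e) f := by
      intro e
      funext i
      by_cases hi : i.1 ∈ J
      · simp only [Edge.glue, Edge.map, mix, Edge.restrict, dif_pos hi, dif_pos ((hmem i).1 hi)]
      · simp only [Edge.glue, Edge.map, mix, dif_neg hi, dif_neg (fun h => hi ((hmem i).2 h))]
    have h3 := key e
    have h4 := key e'
    rw [← h3, ← h4]
    exact h2

theorem mem_frameEvent_of_copies {y₀ : PatternEdge k W} {V : Finset (PatternEdge k W)}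
    (hb : boundary y₀ ⊆ V) {z : ∀ i, W i → Ω i} {e : Edge Ω y₀.1.1}
    (h : G.copies col V (mix y₀.2 z e) ≠ 0) : e ∈ G.frameEvent y₀.1 (patternVector col y₀) := by
  have h1 : ∀ y ∈ V, G.color y.1 (Edge.map (mix y₀.2 z e) y.2) = col y.1 y.2 := by
    by_contra hn
    exact h (if_neg hn)
  intro J hJ
  have h2 := h1 _ (hb (mem_boundary.2 ⟨J.1, J.2, hJ, rfl⟩))
  have h3 : Edge.map (mix y₀.2 z e) (y₀.2.restrict J.2) = e.restrict J.2 := by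
    exact congrArg (fun f => Edge.restrict f J.2) (map_mix_self y₀.2 z e)
  rw [h3] at h2
  exact h2

variable [∀ i, Fintype (Ω i)] {p : ∀ i, Ω i → ℝ}

/-- The probability of a pattern. -/
noncomputable def copyProb (G : ColoredHypergraph.{v, w} k Ω) (p : ∀ i, Ω i → ℝ)
    (col : ∀ I : EdgeIndex ι k, Edge W I.1 → G.Color I) (U : Finset (PatternEdge k W)) : ℝ :=
  expect (partLaw p W) (G.copies col U)

/-- The point is to average over `M` disjoint blocks of sample points before applying
Cauchy–Schwarz. In the second moment of the average only a fraction `1 / M` of the terms uses one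
block twice; every other term is the probability of two copies glued along `y₀`. With a single block
the second factor would be the probability of the pattern itself, which is too large when the
smaller edges have small densities. Passing from `V` to `V'` leaves only edges that an induction can
handle. -/
theorem sq_copyProb_insert_sub_le (hp : ∀ i, p i ∈ stdSimplex ℝ (Ω i)) {y₀ : PatternEdge k W}
    {V V' : Finset (PatternEdge k W)} (hV : ∀ y ∈ V, y.1.1.card ≤ y₀.1.1.card) (hy₀ : y₀ ∉ V)
    (hb : boundary y₀ ⊆ V) (hV' : V' ⊆ V) {M l : ℕ} (hM : 0 < M)
    (hl : ∀ i, M * Fintype.card (W i) ≤ l) :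
    (G.copyProb p col (insert y₀ V) -
        G.relDensity p y₀.1 (patternVector col y₀) * G.copyProb p col V) ^ 2 ≤
      G.deviation p l y₀.1 (patternVector col y₀) *
        (1 / M + G.copyProb p (doubleColor col) (double y₀.2 V')) := by
  classical
  have hτ : ∀ i, ∃ τ : Fin M × W i → Fin l, Function.Injective τ := fun i => by
    have : Fintype.card (Fin M × W i) ≤ Fintype.card (Fin l) := by simpa using hl i
    obtain ⟨f⟩ := Function.Embedding.nonempty_of_card_le this
    exact ⟨f, f.injective⟩
  choose τ hτ using hτ
  have hτ' : ∀ t i, Function.Injective fun w => τ i (t, w) := fun t i w w' h =>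
    (Prod.mk.inj (hτ i h)).2
  set d := G.relDensity p y₀.1 (patternVector col y₀) with hd
  let F : Fin M → PartMap Ω l → Edge Ω y₀.1.1 → ℝ := fun t ψ e =>
    G.copies col V (mix y₀.2 (fun i w => ψ i (τ i (t, w))) e)
  let A : PartMap Ω l → Edge Ω y₀.1.1 → ℝ := fun ψ e => 1 / M * ∑ t, F t ψ e
  let f : Edge Ω y₀.1.1 → ℝ := fun e => if G.color y₀.1 e = col y₀.1 y₀.2 then 1 else 0
  let g : PartMap Ω l → Edge Ω y₀.1.1 → ℝ := fun ψ =>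
    condExpect (edgeLaw p y₀.1.1) ((G.regularizeStep (y₀.1.1.card - 1) ψ).frame y₀.1) f
  let χ : Edge Ω y₀.1.1 → ℝ := fun e =>
    if e ∈ G.frameEvent y₀.1 (patternVector col y₀) then 1 else 0
  have hMR : (0 : ℝ) < M := by exact_mod_cast hM
  have h1 : ∀ t, G.copyProb p col (insert y₀ V) - d * G.copyProb p col V =
      expect (mapLaw p l) fun ψ => expect (edgeLaw p y₀.1.1) fun e => (f e - d) * F t ψ e := by
    intro t
    unfold copyProb
    rw [← expect_const_mul, ← expect_sub, ← expect_mix hp y₀.2 (hτ' t)]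
    refine congrArg _ (funext fun ψ => congrArg _ (funext fun e => ?_))
    rw [copies_insert, map_mix_self]
    ring
  have h2 : G.copyProb p col (insert y₀ V) - d * G.copyProb p col V =
      expect (mapLaw p l) fun ψ => expect (edgeLaw p y₀.1.1) fun e => (f e - d) * A ψ e := by
    have : ∀ ψ e, (f e - d) * A ψ e = 1 / M * ∑ t, (f e - d) * F t ψ e := fun ψ e => by
      simp only [A]
      rw [← Finset.mul_sum]
      ring
    simp only [this, expect_const_mul, expect_sum]
    rw [← Finset.sum_congr rfl fun t _ => h1 t]
    simp
    field_simp
  -- `A ψ` is constant on the frame classes of the regularized hypergraph, so `f` may be replaced by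
  -- its conditional expectation. It vanishes off the frame event, because the boundary belongs to
  -- `V`, so the cutoff `χ` is free.
  have h3 : ∀ ψ, expect (edgeLaw p y₀.1.1) (fun e => (f e - d) * A ψ e) =
      expect (edgeLaw p y₀.1.1) fun e => χ e * (g ψ e - d) * A ψ e := by
    intro ψ
    have h4 := expect_condExpect_mul (edgeLaw_nonneg hp y₀.1.1) f (u := A ψ)
      (T := (G.regularizeStep (y₀.1.1.card - 1) ψ).frame y₀.1) fun e e' he => by
        simp only [A, F]
        congr 1
        exact Finset.sum_congr rfl fun t _ => copies_mix_eq col hV hy₀ ψ _ he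
    have h5 : ∀ e, χ e * (g ψ e - d) * A ψ e = g ψ e * A ψ e - d * A ψ e := by
      intro e
      rcases eq_or_ne (A ψ e) 0 with h0 | h0
      · simp [h0]
      · obtain ⟨t, -, ht⟩ := Finset.exists_ne_zero_of_sum_ne_zero (right_ne_zero_of_mul h0)
        have : χ e = 1 := if_pos (mem_frameEvent_of_copies col hb ht)
        rw [this]
        ring
    simp only [h5, sub_mul, expect_sub]
    rw [h4]
  have h6 : expect (mapLaw p l) (fun ψ => expect (edgeLaw p y₀.1.1) fun e => A ψ e ^ 2) ≤
      1 / M + G.copyProb p (doubleColor col) (double y₀.2 V') := by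
    have hP : 0 ≤ G.copyProb p (doubleColor col) (double y₀.2 V') :=
      expect_nonneg (partLaw_nonneg hp) fun _ => copies_nonneg _ _ _
    have h7 : ∀ t t', expect (mapLaw p l) (fun ψ => expect (edgeLaw p y₀.1.1) fun e =>
        F t ψ e * F t' ψ e) ≤
        (if t = t' then 1 else 0) + G.copyProb p (doubleColor col) (double y₀.2 V') := by
      intro t t'
      by_cases htt : t = t'
      · rw [if_pos htt]
        refine le_trans ?_ (le_add_of_nonneg_right hP)
        refine le_trans (expect_mono (mapLaw_nonneg hp) (g := fun _ => 1) fun ψ => ?_)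
          (expect_const (sum_mapLaw p hp l) 1).le
        refine le_trans (expect_mono (edgeLaw_nonneg hp _) (g := fun _ => 1) fun e => ?_)
          (expect_const (sum_edgeLaw hp _) 1).le
        exact mul_le_one₀ (copies_le_one _ _ _) (copies_nonneg _ _ _) (copies_le_one _ _ _)
      · rw [if_neg htt, zero_add]
        rw [expect_mix_mix hp y₀.2 (hτ' t) (hτ' t')
          (fun i w w' h => htt (Prod.mk.inj (hτ i h)).1)
          fun x x' => G.copies col V x * G.copies col V x']
        refine expect_mono (partLaw_nonneg hp) fun x => ?_
        rw [copies_double]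
        exact mul_le_mul (copies_anti col hV' _) (copies_anti col hV' _) (copies_nonneg _ _ _)
          (copies_nonneg _ _ _)
    have h8 : ∀ ψ e, A ψ e ^ 2 = (1 / M) ^ 2 * ∑ t, ∑ t', F t ψ e * F t' ψ e := fun ψ e => by
      rw [← Finset.sum_mul_sum]
      simp only [A]
      ring
    simp only [h8, expect_const_mul, expect_sum]
    calc _ ≤ (1 / (M : ℝ)) ^ 2 * ∑ t : Fin M, ∑ t' : Fin M, ((if t = t' then 1 else 0) +
          G.copyProb p (doubleColor col) (double y₀.2 V')) := by
          gcongr with t _ t' _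
          exact h7 t t'
      _ = _ := by
          simp [Finset.sum_add_distrib]
          field_simp
  rw [h2]
  simp only [h3]
  refine (expect_expect_mul_sq_le (mapLaw_nonneg hp) (edgeLaw_nonneg hp _) _ _).trans ?_
  refine mul_le_mul ?_ h6 ?_ (deviation_nonneg hp _ _ _ _)
  · refine expect_mono (mapLaw_nonneg hp) fun ψ => expect_mono (edgeLaw_nonneg hp _) fun e => ?_
    refine le_of_eq ?_
    have : χ e ^ 2 = χ e := by
      simp only [χ]
      split_ifs <;> simp
    rw [mul_pow, this]
    simp only [χ, g, f, hd]
    congr!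
  · exact expect_nonneg (mapLaw_nonneg hp) fun _ => expect_nonneg (edgeLaw_nonneg hp _) fun _ =>
      sq_nonneg _

end

end ColoredHypergraph
end PartiteRegularity

/-! ### Counting patterns with typical colors -/

namespace PartiteRegularity

/-- The relations between the parameters of the counting lemma for vertex sets of size at most `R`,
where `θ s` bounds the relative densities of the edges of size `s` from below, `κ s` bounds their
mean square deviations for samples of size `l`, and `δ s` is the error of the relative densities. -/
structure CountingParameters (k R N l : ℕ) (θ δ κ : ℕ → ℝ) : Prop where
  θ_pos : ∀ s, 0 < θ s
  θ_le : ∀ s, θ s ≤ 1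
  δ_pos : ∀ s, 0 < δ s
  δ_le : ∀ s, δ s ≤ 1
  κ_pos : ∀ s, 0 < κ s
  κ_le : ∀ s, ∃ ρ : ℝ, 0 ≤ ρ ∧ 2 * 16 ^ k * κ s ≤ ρ ^ 2 ∧ N * ρ ≤ δ s * θ s ^ N / 2
  sample : ∃ (M : ℕ) (ϑ : ℝ), 0 < M ∧ M * R ≤ l ∧ 0 < ϑ ∧ ϑ ≤ 1 ∧ (∀ s, 1 ≤ s → s ≤ k → ϑ ≤ θ s) ∧
    1 / M ≤ ϑ ^ N

theorem pow_le_prod {α : Type*} {T : Finset α} {d : α → ℝ} {θ : ℝ} {N : ℕ} (hθ : 0 ≤ θ)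
    (hθ1 : θ ≤ 1) (hd : ∀ y ∈ T, θ ≤ d y) (hT : T.card ≤ N) : θ ^ N ≤ ∏ y ∈ T, d y :=
  (pow_le_pow_of_le_one hθ hθ1 hT).trans
    ((Finset.prod_const θ).symm.trans_le (Finset.prod_le_prod (fun _ _ => hθ) hd))

/-- A number close to the product of the `d y` is a product of numbers close to the `d y`. -/
theorem exists_prod_eq {α : Type*} {T : Finset α} {d : α → ℝ} {θ δ t : ℝ} {N : ℕ}
    (hθ : 0 ≤ θ) (hθ1 : θ ≤ 1) (hδ : 0 ≤ δ) (hd : ∀ y ∈ T, θ ≤ d y) (hd1 : ∀ y ∈ T, d y ≤ 1)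
    (ht : 0 ≤ t) (ht1 : t ≤ 1) (hT : T.card ≤ N) (hT0 : T = ∅ → t = 1)
    (h : |t - ∏ y ∈ T, d y| ≤ δ * θ ^ N) :
    ∃ a : α → ℝ, (∀ y ∈ T, max 0 (d y - δ) ≤ a y ∧ a y ≤ min 1 (d y + δ)) ∧ ∏ y ∈ T, a y = t := by
  classical
  rw [abs_le] at h
  have hd0 : ∀ y ∈ T, 0 ≤ d y := fun y hy => hθ.trans (hd y hy)
  have hmul : ∀ y ∈ T, δ * θ ^ N ≤ δ * ∏ z ∈ T.erase y, d z := fun y hy =>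
    mul_le_mul_of_nonneg_left (pow_le_prod hθ hθ1 (fun z hz => hd z (Finset.mem_of_mem_erase hz))
      ((Finset.card_le_card (Finset.erase_subset _ _)).trans hT)) hδ
  -- Lowering a single factor by `δ` already lowers the product by at least `δ * θ ^ N`; the other
  -- factors are only bounded by the `d z`. The upper bound is analogous.
  have hlo : ∏ y ∈ T, max 0 (d y - δ) ≤ t := by
    rcases T.eq_empty_or_nonempty with rfl | ⟨y, hy⟩
    · simp [hT0 rfl]
    rw [← Finset.mul_prod_erase _ _ hy]
    rcases le_total (d y - δ) 0 with h0 | h0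
    · rw [max_eq_left h0, zero_mul]
      exact ht
    · rw [max_eq_right h0]
      have h1 : ∏ z ∈ T.erase y, max 0 (d z - δ) ≤ ∏ z ∈ T.erase y, d z :=
        Finset.prod_le_prod (fun _ _ => le_max_left _ _) fun z hz =>
          max_le (hd0 z (Finset.mem_of_mem_erase hz)) (by linarith)
      have h2 := mul_le_mul_of_nonneg_left h1 h0
      have h3 := Finset.mul_prod_erase T d hy
      have h4 := hmul y hy
      have h5 : (d y - δ) * ∏ z ∈ T.erase y, d z = ∏ z ∈ T, d z - δ * ∏ z ∈ T.erase y, d z := by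
        rw [sub_mul, h3]
      linarith
  have hup : t ≤ ∏ y ∈ T, min 1 (d y + δ) := by
    by_cases h0 : ∀ y ∈ T, 1 ≤ d y + δ
    · rw [Finset.prod_congr rfl fun y hy => min_eq_left (h0 y hy)]
      simpa using ht1
    · push Not at h0
      obtain ⟨y, hy, hy1⟩ := h0
      rw [← Finset.mul_prod_erase _ _ hy, min_eq_right hy1.le]
      have h1 : ∏ z ∈ T.erase y, d z ≤ ∏ z ∈ T.erase y, min 1 (d z + δ) :=
        Finset.prod_le_prod (fun z hz => hd0 z (Finset.mem_of_mem_erase hz)) fun z hz =>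
          le_min (hd1 z (Finset.mem_of_mem_erase hz)) (by linarith)
      have h2 := mul_le_mul_of_nonneg_left h1 (add_nonneg (hd0 y hy) hδ)
      have h3 := Finset.mul_prod_erase T d hy
      have h4 := hmul y hy
      have h5 : (d y + δ) * ∏ z ∈ T.erase y, d z = ∏ z ∈ T, d z + δ * ∏ z ∈ T.erase y, d z := by
        rw [add_mul, h3]
      linarith
  -- All factors move simultaneously from their lower to their upper limits, and the intermediate
  -- value theorem finds the product `t`.
  let f : ℝ → ℝ := fun x => ∏ y ∈ T,
    (max 0 (d y - δ) + x * (min 1 (d y + δ) - max 0 (d y - δ)))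
  have hf : ContinuousOn f (Set.Icc 0 1) := by
    refine Continuous.continuousOn ?_
    exact continuous_finsetProd _ fun y _ => by fun_prop
  obtain ⟨x, hx, hxt⟩ := intermediate_value_Icc zero_le_one hf
    (show t ∈ Set.Icc (f 0) (f 1) by simpa [f] using ⟨hlo, hup⟩)
  refine ⟨_, fun y hy => ?_, hxt⟩
  have h1 : max 0 (d y - δ) ≤ min 1 (d y + δ) :=
    max_le (le_min zero_le_one (add_nonneg (hd0 y hy) hδ))
      (le_min (by linarith [hd1 y hy]) (by linarith))
  have h2 := mul_nonneg hx.1 (sub_nonneg.2 h1)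
  have h3 := mul_le_mul_of_nonneg_right hx.2 (sub_nonneg.2 h1)
  exact ⟨by linarith, by linarith⟩

/-- `A`, `B`, `C` are the density products over the smaller edges, over the boundary of the added
edge, and over the rest; the glued pattern has product `A * C`. As `B * (A * C) = A ^ 2`, no density
remains in the condition relating `K` and `ρ`. Each of four estimates costs a factor `2 ^ s`, the
one for `P` being squared, whence `16 ^ k`. -/
theorem deviation_bound {A B C D K P Pb Pd m ρ : ℝ} {s k : ℕ} (hK : 0 ≤ K) (hB : 0 ≤ B)
    (hC : 0 ≤ C) (hsk : s + 1 ≤ k + 1) (hA : C * B = A) (hD : D ≤ K * Pb) (hPb : Pb ≤ 2 ^ s * B)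
    (hm : m ≤ A * C) (hPd : Pd ≤ 2 ^ s * (A * C)) (hmP : 0 ≤ m + Pd) (hP : A ≤ 2 ^ s * P)
    (hρ : 2 * 16 ^ k * K ≤ ρ ^ 2) : D * (m + Pd) ≤ (ρ * P) ^ 2 := by
  have hA0 : 0 ≤ A := hA ▸ mul_nonneg hC hB
  have h2s : (1 : ℝ) ≤ 2 ^ s := one_le_pow₀ one_le_two
  have hAC := mul_nonneg hA0 hC
  have h1 : m + Pd ≤ 2 * 2 ^ s * (A * C) := by nlinarith
  have h2 : D ≤ K * (2 ^ s * B) := hD.trans (mul_le_mul_of_nonneg_left hPb hK)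
  have h3 : (0 : ℝ) ≤ 2 * (2 ^ s * 2 ^ s) * K := by positivity
  have h4 : (16 : ℝ) ^ s ≤ 16 ^ k := pow_le_pow_right₀ (by norm_num) (by omega)
  calc D * (m + Pd) ≤ (K * (2 ^ s * B)) * (2 * 2 ^ s * (A * C)) :=
        mul_le_mul h2 h1 hmP (by positivity)
    _ = 2 * (2 ^ s * 2 ^ s) * K * A ^ 2 := by
        rw [← hA]
        ring
    _ ≤ 2 * (2 ^ s * 2 ^ s) * K * (2 ^ s * P) ^ 2 :=
        mul_le_mul_of_nonneg_left (pow_le_pow_left₀ hA0 hP 2) h3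
    _ = 2 * 16 ^ s * K * P ^ 2 := by
        rw [show (16 : ℝ) ^ s = (2 ^ s) ^ 4 by rw [← pow_mul, mul_comm, pow_mul]; norm_num]
        ring
    _ ≤ 2 * 16 ^ k * K * P ^ 2 :=
        mul_le_mul_of_nonneg_right (mul_le_mul_of_nonneg_right
          (mul_le_mul_of_nonneg_left h4 zero_le_two) hK) (sq_nonneg _)
    _ ≤ ρ ^ 2 * P ^ 2 := mul_le_mul_of_nonneg_right hρ (sq_nonneg _)
    _ = (ρ * P) ^ 2 := by ring

namespace ColoredHypergraph

variable {ι : Type} [Fintype ι] [DecidableEq ι] {k : ℕ} {Ω : ι → Type v}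

theorem card_patternEdge_le {W : ι → Type} [∀ i, Fintype (W i)] [∀ i, DecidableEq (W i)] {R : ℕ}
    (hR : ∀ i, Fintype.card (W i) ≤ R) :
    Fintype.card (PatternEdge k W) ≤ 2 ^ Fintype.card ι * (R + 1) ^ Fintype.card ι := by
  rw [Fintype.card_sigma]
  have h1 : ∀ I : EdgeIndex ι k, Fintype.card (Edge W I.1) ≤ (R + 1) ^ Fintype.card ι := fun I => by
    rw [Fintype.card_pi]
    refine (Finset.prod_le_pow_card Finset.univ (fun i : I.1 => Fintype.card (W i.1)) (R + 1) fun i _ =>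
       (hR i).trans (Nat.le_succ R)).trans ?_
    exact Nat.pow_le_pow_right (Nat.succ_pos R) (by simpa using Finset.card_le_univ I.1)
  refine (Finset.sum_le_card_nsmul _ _ _ fun I _ => h1 I).trans ?_
  rw [smul_eq_mul]
  refine Nat.mul_le_mul_right _ ?_
  rw [Finset.card_univ, ← Fintype.card_finset]
  exact Fintype.card_subtype_le _

/-- The set `U` contains all subedges of its edges. -/
def IsDownClosed {W : ι → Type} (U : Finset (PatternEdge k W)) : Prop :=
  ∀ y ∈ U, ∀ (J : EdgeIndex ι k) (hJ : J.1 ⊆ y.1.1), (⟨J, y.2.restrict hJ⟩ : PatternEdge k W) ∈ U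

section

variable {W : ι → Type} [∀ i, Fintype (W i)] [∀ i, DecidableEq (W i)]

theorem IsDownClosed.boundary_subset {U : Finset (PatternEdge k W)} (hU : IsDownClosed U)
    {y : PatternEdge k W} (hy : y ∈ U) :
    boundary y ⊆ U.filter fun z => z.1.1.card < y.1.1.card := by
  intro z hz
  obtain ⟨J, hJ, hJy, rfl⟩ := mem_boundary.1 hz
  refine Finset.mem_filter.2 ⟨hU y hy J hJ, ?_⟩
  exact Finset.card_lt_card (hJ.ssubset_of_ne fun h => hJy (Subtype.ext h))

theorem isDownClosed_boundary (y : PatternEdge k W) : IsDownClosed (boundary y) := by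
  intro z hz J hJ
  obtain ⟨K, hK, hKy, rfl⟩ := mem_boundary.1 hz
  refine mem_boundary.2 ⟨J, hJ.trans hK, ?_, rfl⟩
  rintro rfl
  exact hKy (Subtype.ext (hK.antisymm hJ))

theorem IsDownClosed.filter_card {U : Finset (PatternEdge k W)} (hU : IsDownClosed U) (s : ℕ) :
    IsDownClosed (U.filter fun z => z.1.1.card < s) := by
  intro z hz J hJ
  rw [Finset.mem_filter] at hz ⊢
  exact ⟨hU z hz.1 J hJ, (Finset.card_le_card hJ).trans_lt hz.2⟩

theorem IsDownClosed.double {U : Finset (PatternEdge k W)} (hU : IsDownClosed U) {I : Finset ι}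
    (e₀ : Edge W I) : IsDownClosed (double e₀ U) := by
  intro z hz J hJ
  rcases Finset.mem_union.1 hz with hz | hz
  · obtain ⟨y, hy, rfl⟩ := Finset.mem_image.1 hz
    exact Finset.mem_union_left _ (Finset.mem_image.2 ⟨_, hU y hy J hJ, rfl⟩)
  · obtain ⟨y, hy, rfl⟩ := Finset.mem_image.1 hz
    exact Finset.mem_union_right _ (Finset.mem_image.2 ⟨_, hU y hy J hJ, rfl⟩)

/-- The two copies share exactly those edges of `U` whose vertices all belong to `y₀`. These are its
proper subedges, as all edges of `U` are smaller, and they are counted once. -/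
theorem prod_double {y₀ : PatternEdge k W} {U : Finset (PatternEdge k W)}
    (hU : ∀ y ∈ U, y.1.1.card < y₀.1.1.card) (f : PatternEdge k W → ℝ) :
    ∏ z ∈ double y₀.2 U, f ⟨z.1, Edge.map (fun _ => Prod.fst) z.2⟩ =
      (∏ y ∈ U, f y) * ∏ y ∈ U \ boundary y₀, f y := by
  let P : Bool → PatternEdge k W → PatternEdge k fun i => W i × Bool := fun b y =>
    ⟨y.1, Edge.map (duplicate y₀.2 b) y.2⟩
  let Q : (PatternEdge k fun i => W i × Bool) → PatternEdge k W := fun z =>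
    ⟨z.1, Edge.map (fun _ => Prod.fst) z.2⟩
  have hQP : ∀ b y, Q (P b y) = y := fun b y => rfl
  have hinj : ∀ b, Function.Injective (P b) := fun b => Function.LeftInverse.injective (hQP b)
  have hbd : ∀ y ∈ boundary y₀, P false y = P true y := by
    intro y hy
    obtain ⟨J, hJ, -, rfl⟩ := mem_boundary.1 hy
    simp only [P]
    congr 1
    funext i
    have : y₀.2.HasVertex (y₀.2.restrict hJ i) := ⟨hJ i.2, rfl⟩
    simp only [Edge.map, duplicate, if_pos this]
  have h1 : double y₀.2 U = U.image (P true) ∪ (U \ boundary y₀).image (P false) := by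
    refine le_antisymm (Finset.union_subset Finset.subset_union_left ?_)
      (Finset.union_subset Finset.subset_union_left ?_)
    · intro z hz
      obtain ⟨y, hy, rfl⟩ := Finset.mem_image.1 hz
      by_cases hyb : y ∈ boundary y₀
      · exact Finset.mem_union_left _ (Finset.mem_image.2 ⟨y, hy, (hbd y hyb).symm⟩)
      · exact Finset.mem_union_right _
          (Finset.mem_image.2 ⟨y, Finset.mem_sdiff.2 ⟨hy, hyb⟩, rfl⟩)
    · exact (Finset.image_subset_image Finset.sdiff_subset).trans Finset.subset_union_right
  have h2 : Disjoint (U.image (P true)) ((U \ boundary y₀).image (P false)) := by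
    rw [Finset.disjoint_left]
    intro z hz hz'
    obtain ⟨y, hy, rfl⟩ := Finset.mem_image.1 hz
    obtain ⟨y', hy', hyy⟩ := Finset.mem_image.1 hz'
    have : y' = y := by rw [← hQP false y', hyy, hQP]
    subst this
    have hyb := (Finset.mem_sdiff.1 hy').2
    obtain ⟨J, e⟩ := y'
    have hfun : Edge.map (duplicate y₀.2 false) e = Edge.map (duplicate y₀.2 true) e := by
      simpa [P] using hyy
    have hv : ∀ i : J.1, y₀.2.HasVertex (e i) := by
      intro i
      have := congrFun hfun i
      by_contra hn
      simp [Edge.map, duplicate, hn] at this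
    have hJ : J.1 ⊆ y₀.1.1 := fun i hi => (hv ⟨i, hi⟩).fst
    refine hyb (mem_boundary.2 ⟨J, hJ, ?_, ?_⟩)
    · rintro rfl
      exact lt_irrefl _ (hU ⟨_, e⟩ hy)
    · congr 1
      funext i
      exact (hv i).snd.symm
  rw [h1, Finset.prod_union h2, Finset.prod_image fun _ _ _ _ h => hinj _ h,
    Finset.prod_image fun _ _ _ _ h => hinj _ h]
  rfl

end

variable [∀ i, Fintype (Ω i)] {p : ∀ i, Ω i → ℝ} {G : ColoredHypergraph.{v, w} k Ω}

section

variable {W : ι → Type} [∀ i, Fintype (W i)] [∀ i, DecidableEq (W i)]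
  (col : ∀ I : EdgeIndex ι k, Edge W I.1 → G.Color I)

theorem copyProb_boundary (hp : ∀ i, p i ∈ stdSimplex ℝ (Ω i)) (y : PatternEdge k W) :
    G.copyProb p col (boundary y) =
      prob (edgeLaw p y.1.1) (G.frameEvent y.1 (patternVector col y)) := by
  classical
  rw [prob_eq_expect, ← expect_partLaw_edge hp y.2]
  unfold copyProb
  congr 1
  funext x
  unfold copies
  refine if_congr ?_ rfl rfl
  constructor
  · intro h J hJ
    have := h ⟨J.1, y.2.restrict J.2⟩ (mem_boundary.2 ⟨J.1, J.2, hJ, rfl⟩)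
    exact this
  · intro h z hz
    obtain ⟨J, hJ, hJy, rfl⟩ := mem_boundary.1 hz
    exact h ⟨J, hJ⟩ hJy

theorem copyProb_nonneg (hp : ∀ i, p i ∈ stdSimplex ℝ (Ω i)) (U : Finset (PatternEdge k W)) :
    0 ≤ G.copyProb p col U :=
  expect_nonneg (partLaw_nonneg hp) fun _ => copies_nonneg _ _ _

theorem copyProb_anti (hp : ∀ i, p i ∈ stdSimplex ℝ (Ω i)) {U V : Finset (PatternEdge k W)}
    (h : U ⊆ V) : G.copyProb p col V ≤ G.copyProb p col U :=
  expect_mono (partLaw_nonneg hp) fun _ => copies_anti _ h _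

theorem copyProb_empty (hp : ∀ i, p i ∈ stdSimplex ℝ (Ω i)) :
    G.copyProb p col (∅ : Finset (PatternEdge k W)) = 1 := by
  have : G.copies col (∅ : Finset (PatternEdge k W)) = fun _ => 1 := by
    funext x
    simp [copies]
  rw [copyProb, this, expect_const (sum_partLaw hp)]

theorem eq_empty_of_card_le_zero {U : Finset (PatternEdge k W)} (h : ∀ y ∈ U, y.1.1.card ≤ 0) :
    U = ∅ := by
  refine Finset.eq_empty_of_forall_notMem fun y hy => ?_
  have := y.1.2.1.card_pos
  have := h y hy
  omega

end

/-- The probability of a pattern with typical colors is approximately the product of the relative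
densities. -/
theorem copyProb_estimate (hp : ∀ i, p i ∈ stdSimplex ℝ (Ω i)) {R N l : ℕ} {θ δ κ : ℕ → ℝ}
    (hpar : CountingParameters k R N l θ δ κ)
    (hN : 2 ^ Fintype.card ι * (R + 1) ^ Fintype.card ι ≤ N) (s : ℕ) :
    s ≤ k → ∀ (W : ι → Type) [∀ i, Fintype (W i)] [∀ i, DecidableEq (W i)],
    (∀ i, Fintype.card (W i) * 2 ^ s ≤ R) →
    ∀ (col : ∀ I : EdgeIndex ι k, Edge W I.1 → G.Color I) (U : Finset (PatternEdge k W)),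
    IsDownClosed U → (∀ y ∈ U, y.1.1.card ≤ s) →
    (∀ y ∈ U, G.IsTypical p l (θ y.1.1.card) (κ y.1.1.card) y.1 (patternVector col y)) →
    (∏ y ∈ U, G.relDensity p y.1 (patternVector col y) ≤ 2 ^ s * G.copyProb p col U ∧
      G.copyProb p col U ≤ 2 ^ s * ∏ y ∈ U, G.relDensity p y.1 (patternVector col y)) ∧
    |G.copyProb p col U - G.copyProb p col (U.filter fun y => y.1.1.card < s) *
      ∏ y ∈ U with y.1.1.card = s, G.relDensity p y.1 (patternVector col y)| ≤
      δ s * θ s ^ N / 2 * G.copyProb p col (U.filter fun y => y.1.1.card < s) := by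
  classical
  -- The vertex sets stay quantified in the induction, because the hypothesis is also applied to
  -- doubled ones. The factor `2 ^ s` in their size bound leaves room for one doubling per edge
  -- size.
  induction s with
  | zero =>
    intro _ W _ _ _ col U _ hU0 _
    rw [eq_empty_of_card_le_zero hU0]
    simp [copyProb_empty col hp]
    have := (hpar.δ_pos 0).le
    have := (hpar.θ_pos 0).le
    positivity
  | succ s ih =>
    intro hsk W _ _ hW col U hU hUs hUt
    have hW' : ∀ i, Fintype.card (W i) * 2 ^ s ≤ R := fun i =>
      (Nat.mul_le_mul_left _ (Nat.pow_le_pow_right two_pos s.le_succ)).trans (hW i)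
    have hWR : ∀ i, Fintype.card (W i) ≤ R := fun i =>
      (Nat.le_mul_of_pos_right _ (by positivity)).trans (hW i)
    have hcard : ∀ T : Finset (PatternEdge k W), T.card ≤ N := fun T =>
      (Finset.card_le_univ T).trans ((card_patternEdge_le hWR).trans hN)
    set d : PatternEdge k W → ℝ := fun y => G.relDensity p y.1 (patternVector col y) with hd
    have hd0 : ∀ y, 0 ≤ d y := fun y => (G.relDensity_mem p hp _ _).1
    have hd1 : ∀ y, d y ≤ 1 := fun y => (G.relDensity_mem p hp _ _).2
    set U' := U.filter fun y => y.1.1.card < s + 1 with hU'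
    set T := U.filter fun y => y.1.1.card = s + 1 with hT
    have hUU : U' ∪ T = U := by
      rw [hU', hT, ← Finset.filter_or]
      refine Finset.filter_true_of_mem fun y hy => ?_
      have := hUs y hy
      omega
    have hdisj : Disjoint U' T := by
      refine Finset.disjoint_filter.2 fun y _ h1 h2 => ?_
      omega
    have hU'U : U' ⊆ U := Finset.filter_subset _ _
    have hU's : ∀ y ∈ U', y.1.1.card ≤ s := fun y hy => Nat.lt_succ_iff.1 (Finset.mem_filter.1 hy).2
    have hU'd : IsDownClosed U' := hU.filter_card _
    obtain ⟨⟨hlow, hupp⟩, -⟩ := ih (by omega) W hW' col U' hU'd hU's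
      fun y hy => hUt y (hU'U hy)
    set P' := G.copyProb p col U' with hP'
    have hP'0 : 0 ≤ P' := copyProb_nonneg col hp U'
    obtain ⟨ρ, hρ0, hκρ, hNρ⟩ := hpar.κ_le (s + 1)
    obtain ⟨M, ϑ, hM0, hMl, hϑ0, hϑ1, hϑθ, hMϑ⟩ := hpar.sample
    -- Every error is measured relative to `P'`, the probability of the part with smaller edges, so
    -- errors of successively added edges simply add up.
    have hone : ∀ y ∈ T, ∀ V ⊆ T, y ∉ V →
        |G.copyProb p col (insert y (U' ∪ V)) - d y * G.copyProb p col (U' ∪ V)| ≤ ρ * P' := by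
      intro y hy V hV hyV
      obtain ⟨hyU, hys⟩ := Finset.mem_filter.1 hy
      have hb : boundary y ⊆ U' := by
        have := hU.boundary_subset hyU
        rwa [hys] at this
      have hyU' : y ∉ U' := fun h => by
        have := hU's y h
        omega
      have h1 := G.sq_copyProb_insert_sub_le (V := U' ∪ V) (V' := U') col hp (y₀ := y) (M := M)
        (l := l)
        (fun z hz => by
          rw [hys]
          rcases Finset.mem_union.1 hz with hz | hz
          · exact (hU's z hz).trans s.le_succ
          · exact (Finset.mem_filter.1 (hV hz)).2.le)
        (by simp [hyU', hyV]) (hb.trans Finset.subset_union_left) Finset.subset_union_left hM0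
        (fun i => (Nat.mul_le_mul_left _ (hWR i)).trans hMl)
      refine abs_le_of_sq_le_sq (h1.trans ?_) (mul_nonneg hρ0 hP'0)
      have ht := (hUt y hyU).2
      rw [hys] at ht
      have hbd := ih (by omega) W hW' col (boundary y) (isDownClosed_boundary y)
        (fun z hz => hU's z (hb hz)) fun z hz => hUt z (hU'U (hb hz))
      have hdb := ih (by omega) (fun i => W i × Bool)
        (fun i => by
          have := hW i
          rw [pow_succ] at this
          simp only [Fintype.card_prod, Fintype.card_bool]
          linarith)
        (doubleColor col) (double y.2 U') (hU'd.double _)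
        (fun z hz => by
          rcases Finset.mem_union.1 hz with hz | hz <;>
          · obtain ⟨x, hx, rfl⟩ := Finset.mem_image.1 hz
            exact hU's x hx)
        (fun z hz => by
          rcases Finset.mem_union.1 hz with hz | hz <;>
          · obtain ⟨x, hx, rfl⟩ := Finset.mem_image.1 hz
            exact hUt x (hU'U hx))
      have hPb := hbd.1.2
      have hPd := hdb.1.2
      rw [copyProb_boundary col hp] at hPb
      have hprod := prod_double (y₀ := y) (U := U')
        (fun z hz => by
          rw [hys]
          exact Nat.lt_succ_iff.2 (hU's z hz)) d
      have hprod' : ∏ z ∈ double y.2 U', G.relDensity p z.1 (patternVector (doubleColor col) z) =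
          (∏ z ∈ U', d z) * ∏ z ∈ U' \ boundary y, d z := hprod
      -- The common density threshold `ϑ` of all sizes is needed only to make `1 / M` smaller than
      -- the main term of the glued pattern.
      have hge : ϑ ^ N ≤ ∏ z ∈ double y.2 U',
          G.relDensity p z.1 (patternVector (doubleColor col) z) := by
        refine pow_le_prod hϑ0.le hϑ1 (fun z hz => ?_) ?_
        · refine (hϑθ z.1.1.card z.1.2.1.card_pos z.1.2.2).trans ?_
          rcases Finset.mem_union.1 hz with hz | hz <;>
          · obtain ⟨x, hx, rfl⟩ := Finset.mem_image.1 hz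
            exact (hUt x (hU'U hx)).1
        · refine (Finset.card_le_univ _).trans ((card_patternEdge_le fun i => ?_).trans hN)
          have h2 := hW i
          have h3 : Fintype.card (W i) * 2 ≤ Fintype.card (W i) * 2 ^ (s + 1) :=
            Nat.mul_le_mul_left _ (by rw [pow_succ]; exact Nat.le_mul_of_pos_left _ (by positivity))
          simpa using h3.trans h2
      rw [hprod'] at hge hPd
      have hsplit : (∏ z ∈ U' \ boundary y, d z) * ∏ z ∈ boundary y, d z = ∏ z ∈ U', d z :=
        Finset.prod_sdiff hb
      set A := ∏ z ∈ U', d z with hA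
      set B := ∏ z ∈ boundary y, d z with hB
      set C := ∏ z ∈ U' \ boundary y, d z with hC
      have hB0 : 0 ≤ B := Finset.prod_nonneg fun z _ => hd0 z
      have hC0 : 0 ≤ C := Finset.prod_nonneg fun z _ => hd0 z
      have hκ0 := (hpar.κ_pos (s + 1)).le
      have hPd0 : 0 ≤ G.copyProb p (doubleColor col) (double y.2 U') := copyProb_nonneg _ hp _
      exact deviation_bound hκ0 hB0 hC0 (by omega) hsplit ht hPb (hMϑ.trans hge) hPd
        (add_nonneg (by positivity) hPd0) hlow hκρ
    have hmany : ∀ V ⊆ T, |G.copyProb p col (U' ∪ V) - P' * ∏ y ∈ V, d y| ≤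
        V.card * (ρ * P') := by
      intro V
      induction V using Finset.induction_on with
      | empty => simp [hP']
      | insert y V hyV ihV =>
        intro hV
        have hVT := (Finset.subset_insert y V).trans hV
        have h1 := hone y (hV (Finset.mem_insert_self _ _)) V hVT hyV
        have h2 := ihV hVT
        rw [Finset.union_insert, Finset.prod_insert hyV, Finset.card_insert_of_notMem hyV]
        have h3 : G.copyProb p col (insert y (U' ∪ V)) - P' * (d y * ∏ z ∈ V, d z) =
            (G.copyProb p col (insert y (U' ∪ V)) - d y * G.copyProb p col (U' ∪ V)) +
              d y * (G.copyProb p col (U' ∪ V) - P' * ∏ z ∈ V, d z) := by ring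
        rw [h3]
        refine (abs_add_le _ _).trans ?_
        rw [abs_mul, abs_of_nonneg (hd0 y)]
        have h4 : d y * |G.copyProb p col (U' ∪ V) - P' * ∏ z ∈ V, d z| ≤ V.card * (ρ * P') :=
          (mul_le_of_le_one_left (abs_nonneg _) (hd1 y)).trans h2
        push_cast
        linarith
    have hmain : |G.copyProb p col U - P' * ∏ y ∈ T, d y| ≤ δ (s + 1) * θ (s + 1) ^ N / 2 * P' := by
      have := hmany T subset_rfl
      rw [hUU] at this
      refine this.trans ?_
      rw [← mul_assoc]
      refine mul_le_mul_of_nonneg_right (le_trans ?_ hNρ) hP'0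
      exact mul_le_mul_of_nonneg_right (by exact_mod_cast hcard T) hρ0
    refine ⟨?_, hmain⟩
    have hθN : θ (s + 1) ^ N ≤ ∏ y ∈ T, d y := by
      refine pow_le_prod (hpar.θ_pos _).le (hpar.θ_le _) (fun y hy => ?_) (hcard T)
      obtain ⟨hyU, hys⟩ := Finset.mem_filter.1 hy
      have := (hUt y hyU).1
      rwa [hys] at this
    have hθ0 := pow_pos (hpar.θ_pos (s + 1)) N
    -- The error is at most half of the main term, so each size costs one further factor 2 in the
    -- two-sided bound.
    have hδθ : δ (s + 1) * θ (s + 1) ^ N / 2 ≤ (∏ y ∈ T, d y) / 2 := by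
      have := mul_le_of_le_one_left hθ0.le (hpar.δ_le (s + 1))
      linarith
    have h1 := abs_le.1 (hmain.trans (mul_le_mul_of_nonneg_right hδθ hP'0))
    have hsplit : ∏ y ∈ U, d y = (∏ y ∈ U', d y) * ∏ y ∈ T, d y := by
      rw [← Finset.prod_union hdisj, hUU]
    have hT0 : 0 ≤ ∏ y ∈ T, d y := hθ0.le.trans hθN
    have h2 := mul_le_mul_of_nonneg_right hlow hT0
    have h3 := mul_le_mul_of_nonneg_right hupp hT0
    have hpow : (0 : ℝ) < 2 ^ s := by positivity
    have hPT : 0 ≤ P' * ∏ y ∈ T, d y := mul_nonneg hP'0 hT0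
    rw [hsplit, pow_succ]
    constructor
    · refine h2.trans ?_
      rw [mul_assoc, mul_assoc]
      refine mul_le_mul_of_nonneg_left ?_ hpow.le
      linarith
    · have h4 : G.copyProb p col U ≤ 2 * (P' * ∏ y ∈ T, d y) := by linarith
      refine h4.trans ?_
      nlinarith

end ColoredHypergraph
end PartiteRegularity

/-! ### Regularity from a small increment of the energy -/

namespace PartiteRegularity

namespace ColoredHypergraph

/-- The restriction of a color vector to a subedge. -/
def subvector {ι : Type} {k : ℕ} {V : ι → Type v} {G : ColoredHypergraph.{v, w} k V}
    {I : EdgeIndex ι k} (c : G.ColorVector I) (J : {J : EdgeIndex ι k // J.1 ⊆ I.1}) :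
    G.ColorVector J.1 :=
  fun K => c ⟨K.1, K.2.trans J.2⟩

variable {ι : Type} [Fintype ι] [DecidableEq ι] {k : ℕ} {Ω : ι → Type v}
  [∀ i, Fintype (Ω i)] {p : ∀ i, Ω i → ℝ}

/-- A color vector all of whose restrictions to subedges are typical. -/
def IsGood (G : ColoredHypergraph.{v, w} k Ω) (p : ∀ i, Ω i → ℝ) (l : ℕ) (θ κ : ℕ → ℝ)
    (I : EdgeIndex ι k) (c : G.ColorVector I) : Prop :=
  ∀ J : {J : EdgeIndex ι k // J.1 ⊆ I.1},
    G.IsTypical p l (θ J.1.1.card) (κ J.1.1.card) J.1 (subvector c J)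

open Classical in
/-- The error function that equals `δ` for good color vectors, and is trivial otherwise. -/
noncomputable def goodError (G : ColoredHypergraph.{v, w} k Ω) (p : ∀ i, Ω i → ℝ) (l : ℕ)
    (θ κ δ : ℕ → ℝ) (I : EdgeIndex ι k) (c : G.ColorVector I) : ℝ :=
  if G.IsGood p l θ κ I c then δ I.1.card else 1

variable {G : ColoredHypergraph.{v, w} k Ω}

/-- The probability of a pattern with typical colors is a product of numbers close to the relative
densities. -/
theorem exists_copyProb_eq_prod (hp : ∀ i, p i ∈ stdSimplex ℝ (Ω i)) {R N l : ℕ}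
    {θ δ κ : ℕ → ℝ} (hpar : CountingParameters k R N l θ δ κ)
    (hN : 2 ^ Fintype.card ι * (R + 1) ^ Fintype.card ι ≤ N)
    {W : ι → Type} [∀ i, Fintype (W i)] [∀ i, DecidableEq (W i)]
    (hW : ∀ i, Fintype.card (W i) * 2 ^ k ≤ R)
    (col : ∀ I : EdgeIndex ι k, Edge W I.1 → G.Color I) (s : ℕ) :
    s ≤ k → ∀ U : Finset (PatternEdge k W), IsDownClosed U → (∀ y ∈ U, y.1.1.card ≤ s) →
    (∀ y ∈ U, G.IsTypical p l (θ y.1.1.card) (κ y.1.1.card) y.1 (patternVector col y)) →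
    0 < G.copyProb p col U ∧ ∃ a : PatternEdge k W → ℝ, (∀ y ∈ U,
      max 0 (G.relDensity p y.1 (patternVector col y) - δ y.1.1.card) ≤ a y ∧
      a y ≤ min 1 (G.relDensity p y.1 (patternVector col y) + δ y.1.1.card)) ∧
      G.copyProb p col U = ∏ y ∈ U, a y := by
  classical
  induction s with
  | zero =>
    intro _ U _ hU0 _
    rw [eq_empty_of_card_le_zero hU0, copyProb_empty col hp]
    simp
  | succ s ih =>
    intro hsk U hU hUs hUt
    have hWs : ∀ i, Fintype.card (W i) * 2 ^ (s + 1) ≤ R := fun i =>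
      (Nat.mul_le_mul_left _ (Nat.pow_le_pow_right two_pos hsk)).trans (hW i)
    have hWR : ∀ i, Fintype.card (W i) ≤ R := fun i =>
      (Nat.le_mul_of_pos_right _ (by positivity)).trans (hW i)
    have hd1 : ∀ y : PatternEdge k W, G.relDensity p y.1 (patternVector col y) ≤ 1 := fun y =>
      (G.relDensity_mem p hp _ _).2
    obtain ⟨⟨hlow, -⟩, hest⟩ := copyProb_estimate hp hpar hN (s + 1) hsk W hWs col U hU hUs hUt
    set U' := U.filter fun y => y.1.1.card < s + 1 with hU'
    set T := U.filter fun y => y.1.1.card = s + 1 with hT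
    have hUU : U' ∪ T = U := by
      rw [hU', hT, ← Finset.filter_or]
      refine Finset.filter_true_of_mem fun y hy => ?_
      have := hUs y hy
      omega
    have hdisj : Disjoint U' T := by
      refine Finset.disjoint_filter.2 fun y _ h1 h2 => ?_
      omega
    have hU'U : U' ⊆ U := Finset.filter_subset _ _
    obtain ⟨hP', a, ha, haP⟩ := ih (by omega) U' (hU.filter_card _)
      (fun y hy => Nat.lt_succ_iff.1 (Finset.mem_filter.1 hy).2) fun y hy => hUt y (hU'U hy)
    have hpos : 0 < ∏ y ∈ U, G.relDensity p y.1 (patternVector col y) :=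
      Finset.prod_pos fun y hy => (hpar.θ_pos _).trans_le (hUt y hy).1
    have hP : 0 < G.copyProb p col U := by
      have := hpos.trans_le hlow
      exact pos_of_mul_pos_right this (by positivity)
    have hTt : ∀ y ∈ T, θ (s + 1) ≤ G.relDensity p y.1 (patternVector col y) := by
      intro y hy
      obtain ⟨hyU, hys⟩ := Finset.mem_filter.1 hy
      have := (hUt y hyU).1
      rwa [hys] at this
    -- The edges of the largest size share the conditional probability of `U` given `U'`, which is
    -- close to the product of their densities.
    obtain ⟨a', ha', haP'⟩ := exists_prod_eq (T := T) (t := G.copyProb p col U /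
        G.copyProb p col U') (N := N) (hpar.θ_pos (s + 1)).le (hpar.θ_le _) (hpar.δ_pos (s + 1)).le
      hTt (fun y _ => hd1 y) (div_nonneg hP.le hP'.le)
      (div_le_one_of_le₀ (copyProb_anti col hp hU'U) hP'.le)
      ((Finset.card_le_univ T).trans ((card_patternEdge_le hWR).trans hN))
      (fun h => by
        rw [h, Finset.union_empty] at hUU
        rw [hUU, div_self hP.ne'])
      (by
        have h1 : G.copyProb p col U / G.copyProb p col U' -
            ∏ y ∈ T, G.relDensity p y.1 (patternVector col y) =
            (G.copyProb p col U - G.copyProb p col U' *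
              ∏ y ∈ T, G.relDensity p y.1 (patternVector col y)) / G.copyProb p col U' := by
          field_simp
        rw [h1, abs_div, abs_of_pos hP', div_le_iff₀ hP']
        refine hest.trans (mul_le_mul_of_nonneg_right ?_ hP'.le)
        have := mul_pos (hpar.δ_pos (s + 1)) (pow_pos (hpar.θ_pos (s + 1)) N)
        linarith)
    refine ⟨hP, fun y => if y ∈ T then a' y else a y, fun y hy => ?_, ?_⟩
    · by_cases hyT : y ∈ T
      · have := ha' y hyT
        simp only [hyT, if_true]
        rwa [(Finset.mem_filter.1 hyT).2]
      · simp only [hyT, if_false]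
        rw [← hUU] at hy
        exact ha y ((Finset.mem_union.1 hy).resolve_right hyT)
    · have h2 : ∏ y ∈ U', (if y ∈ T then a' y else a y) = ∏ y ∈ U', a y :=
        Finset.prod_congr rfl fun y hy => if_neg (Finset.disjoint_left.1 hdisj hy)
      have h3 : ∏ y ∈ T, (if y ∈ T then a' y else a y) = ∏ y ∈ T, a' y :=
        Finset.prod_congr rfl fun y hy => if_pos hy
      have h4 : ∏ y ∈ U, (if y ∈ T then a' y else a y) =
          (∏ y ∈ U', a y) * ∏ y ∈ T, a' y := by
        rw [← h2, ← h3, ← Finset.prod_union hdisj, hUU]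
      rw [h4, ← haP, haP']
      field_simp

/-- Goodness passes to subedges, so the good visible edges form a down-closed pattern with typical
colors, which `exists_copyProb_eq_prod` handles. The remaining visible edges have error 1 and absorb
whatever factor is missing. -/
theorem isErrorFunction_goodError (hp : ∀ i, p i ∈ stdSimplex ℝ (Ω i)) {h N l : ℕ}
    {θ δ κ : ℕ → ℝ} (hpar : CountingParameters k (h * 2 ^ k) N l θ δ κ)
    (hN : 2 ^ Fintype.card ι * (h * 2 ^ k + 1) ^ Fintype.card ι ≤ N) :
    G.IsErrorFunction p h (G.goodError p l θ κ δ) := by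
  classical
  refine ⟨fun I c => ?_, fun S => ?_⟩
  · unfold goodError
    split_ifs
    · exact (hpar.δ_pos _).le
    · exact zero_le_one
  have hne : ∀ i, Nonempty (Ω i) := fun i => by
    by_contra hn
    rw [not_nonempty_iff] at hn
    simpa using (hp i).2
  let W : ι → Type := fun _ => Fin h
  -- Invisible edges get an arbitrary color; it plays no role, since `U` contains only visible
  -- edges.
  let col : ∀ I : EdgeIndex ι k, Edge W I.1 → G.Color I := fun I e =>
    (S.color I e).getD (G.color I fun i => (hne i.1).some)
  let U : Finset (PatternEdge k W) := Finset.univ.filter fun y => (S.color y.1 y.2).isSome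
  have hmemU : ∀ y, y ∈ U ↔ (S.color y.1 y.2).isSome := fun y => by simp [U]
  have hUd : IsDownClosed U := by
    intro y hy J hJ
    rw [hmemU, Option.isSome_iff_ne_none] at hy ⊢
    exact fun h0 => hy (S.invisible_of_subset y.1 J hJ y.2 h0)
  have hcol : ∀ y ∈ U, S.color y.1 y.2 = some (col y.1 y.2) := by
    intro y hy
    obtain ⟨c, hc⟩ := Option.isSome_iff_exists.1 ((hmemU y).1 hy)
    simp [col, hc]
  have htot : ∀ x : S.Visible, S.totalColor x = patternVector col x.1 := by
    intro x
    funext J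
    have := hcol _ (hUd x.1 ((hmemU _).2 x.2) J.1 J.2)
    unfold Complex.totalColor patternVector
    exact Option.get_of_eq_some _ this
  have hprob : prob (mapLaw p h) (G.copyEvent S) = G.copyProb p col U := by
    rw [prob_eq_expect]
    refine Finset.sum_congr rfl fun φ _ => congrArg (fun z => mapLaw p h φ * z) ?_
    unfold copies
    refine if_congr ?_ rfl rfl
    constructor
    · intro hφ y hy
      have := hφ ⟨y, (hmemU y).1 hy⟩
      dsimp only at this
      rw [hcol y hy] at this
      exact Option.some_injective _ this
    · intro hφ x
      have hx := (hmemU _).2 x.2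
      rw [hcol _ hx]
      exact congrArg some (hφ _ hx)
  let good : PatternEdge k W → Prop := fun y => G.IsGood p l θ κ y.1 (patternVector col y)
  let U' := U.filter good
  have hU'd : IsDownClosed U' := by
    intro y hy J hJ
    obtain ⟨hyU, hyg⟩ := Finset.mem_filter.1 hy
    exact Finset.mem_filter.2 ⟨hUd y hyU J hJ, fun K => hyg ⟨K.1, K.2.trans hJ⟩⟩
  obtain ⟨hP', a, ha, haP⟩ := exists_copyProb_eq_prod hp hpar hN (W := W) (by simp [W]) col k
    le_rfl U' hU'd (fun y _ => y.1.2.2)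
    fun y hy => (Finset.mem_filter.1 hy).2 ⟨y.1, subset_rfl⟩
  suffices hs : ∃ a : PatternEdge k W → ℝ, (∀ y ∈ U,
      max 0 (G.relDensity p y.1 (patternVector col y) -
        G.goodError p l θ κ δ y.1 (patternVector col y)) ≤ a y ∧
      a y ≤ min 1 (G.relDensity p y.1 (patternVector col y) +
        G.goodError p l θ κ δ y.1 (patternVector col y))) ∧
      G.copyProb p col U = ∏ y ∈ U, a y by
    obtain ⟨a, ha, haP⟩ := hs
    refine ⟨fun x => a x.1, fun x => ?_, ?_⟩
    · rw [htot]
      exact ha x.1 ((hmemU _).2 x.2)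
    · rw [hprob, haP]
      exact Finset.prod_subtype U hmemU a
  have hgood : ∀ y, good y → G.goodError p l θ κ δ y.1 (patternVector col y) = δ y.1.1.card :=
    fun y hy => if_pos hy
  have hbad : ∀ y, ¬ good y → G.goodError p l θ κ δ y.1 (patternVector col y) = 1 :=
    fun y hy => if_neg hy
  have hd := fun y : PatternEdge k W => G.relDensity_mem p hp y.1 (patternVector col y)
  by_cases hUU : ∃ z ∈ U, ¬ good z
  · obtain ⟨z, hzU, hz⟩ := hUU
    have hle := copyProb_anti (p := p) col hp (Finset.filter_subset good U)
    have h0 := copyProb_nonneg (p := p) col hp U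
    -- One bad edge carries the whole ratio of probabilities and the other bad edges get 1.
    -- Positivity of the good part's probability makes the ratio meaningful.
    refine ⟨fun y => if good y then a y else
      if y = z then G.copyProb p col U / G.copyProb p col U' else 1, fun y hy => ?_, ?_⟩
    · beta_reduce
      by_cases hyg : good y
      · rw [hgood y hyg, if_pos hyg]
        exact ha y (Finset.mem_filter.2 ⟨hy, hyg⟩)
      · rw [hbad y hyg, if_neg hyg]
        have hq : 0 ≤ (if y = z then G.copyProb p col U / G.copyProb p col U' else 1) ∧
            (if y = z then G.copyProb p col U / G.copyProb p col U' else 1) ≤ 1 := by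
          split_ifs
          · exact ⟨div_nonneg h0 hP'.le, div_le_one_of_le₀ hle hP'.le⟩
          · exact ⟨zero_le_one, le_rfl⟩
        exact ⟨max_le hq.1 (by linarith [(hd y).2]), le_min hq.2 (by linarith [(hd y).1])⟩
    · rw [Finset.prod_ite, ← haP, Finset.prod_ite_eq_of_mem' _ _ _
        (Finset.mem_filter.2 ⟨hzU, hz⟩)]
      field_simp
  · push Not at hUU
    have hU' : U' = U := Finset.filter_true_of_mem hUU
    rw [hU'] at ha haP
    refine ⟨a, fun y hy => ?_, haP⟩
    rw [hgood y (hUU y hy)]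
    exact ha y hy

theorem irregularity_nonneg (hp : ∀ i, p i ∈ stdSimplex ℝ (Ω i)) (l : ℕ) (I : EdgeIndex ι k) :
    0 ≤ G.irregularity p l I :=
  (Finset.sum_nonneg fun c _ => G.deviation_nonneg hp l I c).trans (G.sum_deviation_le hp l I)

/-- A union bound over the subedges: a color vector that is not good has an atypical restriction,
and a subedge of a random edge is a random edge. -/
theorem expect_goodError_le (hp : ∀ i, p i ∈ stdSimplex ℝ (Ω i)) (l : ℕ) {θ δ κ : ℕ → ℝ}
    (hθ : ∀ s, 0 ≤ θ s) (hδ : ∀ s, 0 ≤ δ s) (hκ : ∀ s, 0 < κ s) (I : EdgeIndex ι k) :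
    expect (edgeLaw p I.1) (fun e => G.goodError p l θ κ δ I (G.totalColor I e)) ≤
      δ I.1.card + ∑ J : EdgeIndex ι k with J.1 ⊆ I.1, (θ J.1.card * Nat.card (G.Color J) +
        G.irregularity p l J / κ J.1.card) := by
  classical
  have hsub : ∀ J : EdgeIndex ι k, J ∈ Finset.univ.filter (fun J : EdgeIndex ι k => J.1 ⊆ I.1) →
      J.1 ⊆ I.1 := fun J hJ => (Finset.mem_filter.1 hJ).2
  have h1 : ∀ e : Edge Ω I.1, G.goodError p l θ κ δ I (G.totalColor I e) ≤ δ I.1.card +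
      ∑ J : {J : EdgeIndex ι k // J.1 ⊆ I.1},
        if G.IsTypical p l (θ J.1.1.card) (κ J.1.1.card) J.1 (G.totalColor J.1 (e.restrict J.2))
          then 0 else 1 := by
    intro e
    have h0 : ∀ J : {J : EdgeIndex ι k // J.1 ⊆ I.1}, (0 : ℝ) ≤
        if G.IsTypical p l (θ J.1.1.card) (κ J.1.1.card) J.1 (G.totalColor J.1 (e.restrict J.2))
          then 0 else 1 := fun J => by split_ifs <;> simp
    unfold goodError
    split_ifs with hg
    · exact le_add_of_nonneg_right (Finset.sum_nonneg fun J _ => h0 J)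
    · unfold IsGood at hg
      push Not at hg
      obtain ⟨J, hJ⟩ := hg
      refine le_trans ?_ (le_add_of_nonneg_left (hδ _))
      refine le_trans (le_of_eq ?_) (Finset.single_le_sum (fun J _ => h0 J) (Finset.mem_univ J))
      exact (if_neg hJ).symm
  refine (expect_mono (edgeLaw_nonneg hp _) h1).trans ?_
  rw [expect_add, expect_const (sum_edgeLaw hp _), expect_sum]
  refine add_le_add_right ?_ _
  rw [Finset.sum_subtype (p := fun J : EdgeIndex ι k => J.1 ⊆ I.1) _ (fun J => by simp)]
  refine Finset.sum_le_sum fun J _ => ?_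
  rw [expect_edgeLaw_restrict hp J.2 fun e =>
    if G.IsTypical p l (θ J.1.1.card) (κ J.1.1.card) J.1 (G.totalColor J.1 e) then 0 else 1]
  exact G.expect_not_isTypical_le hp l (hθ _) (hκ _) J.1

/-- The bound of `expect_goodError_le` is multiplied by the number of colors of `I`. The `δ`-part
gives `ε / 4`. The low-density part gives `ε / 4` in total over at most `2 ^ r` subedges, `r` being
the number of vertex sets; here `Γ` is squared because the colors of both `I` and `J` are counted.
The energy increments are left for averaging over the samples. -/
theorem reg_le (hp : ∀ i, p i ∈ stdSimplex ℝ (Ω i)) {h N l : ℕ}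
    {θ δ κ : ℕ → ℝ} (hpar : CountingParameters k (h * 2 ^ k) N l θ δ κ)
    (hN : 2 ^ Fintype.card ι * (h * 2 ^ k + 1) ^ Fintype.card ι ≤ N) {Γ : ℕ → ℝ}
    (hΓ : ∀ I J : EdgeIndex ι k, J.1.card ≤ I.1.card → Nat.card (G.Color I) ≤ Γ J.1.card)
    {ε : ℝ} (hδ : ∀ s, Γ s * δ s ≤ ε / 4)
    (hθ : ∀ s, Γ s ^ 2 * θ s ≤ ε / (4 * 2 ^ Fintype.card ι)) :
    G.reg p h ≤ ε / 2 + ∑ J : EdgeIndex ι k, Γ J.1.card / κ J.1.card * G.irregularity p l J := by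
  classical
  have hne : ∀ i, Nonempty (Ω i) := fun i => by
    by_contra hn
    rw [not_nonempty_iff] at hn
    simpa using (hp i).2
  have hC : ∀ I, (0 : ℝ) < Nat.card (G.Color I) := fun I => by
    have : Nonempty (G.Color I) := ⟨G.color I fun i => (hne i.1).some⟩
    exact_mod_cast Nat.card_pos
  have hΓ0 : ∀ J : EdgeIndex ι k, 0 < Γ J.1.card := fun J => (hC J).trans_le (hΓ J J le_rfl)
  have hirr := fun J => G.irregularity_nonneg (p := p) hp l J
  have hterm : ∀ J : EdgeIndex ι k, 0 ≤ Γ J.1.card / κ J.1.card * G.irregularity p l J := fun J =>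
    mul_nonneg (div_nonneg (hΓ0 J).le (hpar.κ_pos _).le) (hirr J)
  have hε' : 0 ≤ ε / (4 * 2 ^ Fintype.card ι) :=
    (mul_nonneg (sq_nonneg _) (hpar.θ_pos 0).le).trans (hθ 0)
  have hε : 0 ≤ ε := by
    rw [le_div_iff₀ (by positivity), zero_mul] at hε'
    exact hε'
  refine csInf_le ⟨0, fun x hx => hx.1⟩ ⟨add_nonneg (by linarith)
    (Finset.sum_nonneg fun J _ => hterm J), _, isErrorFunction_goodError hp hpar hN, fun I => ?_⟩
  rw [le_div_iff₀ (hC I)]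
  refine (mul_le_mul_of_nonneg_right (expect_goodError_le hp l (fun s => (hpar.θ_pos s).le)
    (fun s => (hpar.δ_pos s).le) hpar.κ_pos I) (hC I).le).trans ?_
  rw [add_mul, Finset.sum_mul]
  have h1 : δ I.1.card * Nat.card (G.Color I) ≤ ε / 4 :=
    (mul_comm _ _).trans_le ((mul_le_mul_of_nonneg_right (hΓ I I le_rfl)
      (hpar.δ_pos _).le).trans (hδ _))
  have h2 : ∀ J ∈ Finset.univ.filter (fun J : EdgeIndex ι k => J.1 ⊆ I.1),
      (θ J.1.card * Nat.card (G.Color J) + G.irregularity p l J / κ J.1.card) *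
        Nat.card (G.Color I) ≤ ε / (4 * 2 ^ Fintype.card ι) +
          Γ J.1.card / κ J.1.card * G.irregularity p l J := by
    intro J hJ
    have hJI := hΓ I J (Finset.card_le_card (Finset.mem_filter.1 hJ).2)
    have hJJ := hΓ J J le_rfl
    rw [add_mul]
    refine add_le_add ?_ ?_
    · refine le_trans ?_ (hθ J.1.card)
      have : (Nat.card (G.Color J) : ℝ) * Nat.card (G.Color I) ≤ Γ J.1.card * Γ J.1.card :=
        mul_le_mul hJJ hJI (hC I).le (hΓ0 J).le
      have := mul_le_mul_of_nonneg_left this (hpar.θ_pos J.1.card).le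
      linarith
    · have := mul_le_mul_of_nonneg_left hJI (div_nonneg (hirr J) (hpar.κ_pos J.1.card).le)
      refine this.trans (le_of_eq ?_)
      ring
  have h3 := Finset.sum_le_sum h2
  rw [Finset.sum_add_distrib, Finset.sum_const, nsmul_eq_mul] at h3
  have h4 : ((Finset.univ.filter (fun J : EdgeIndex ι k => J.1 ⊆ I.1)).card : ℝ) *
      (ε / (4 * 2 ^ Fintype.card ι)) ≤ ε / 4 := by
    have hcard : ((Finset.univ.filter (fun J : EdgeIndex ι k => J.1 ⊆ I.1)).card : ℝ) ≤
        2 ^ Fintype.card ι := by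
      have : (Finset.univ.filter (fun J : EdgeIndex ι k => J.1 ⊆ I.1)).card ≤
          2 ^ Fintype.card ι := by
        rw [← Fintype.card_finset]
        exact (Finset.card_le_univ _).trans (Fintype.card_subtype_le _)
      exact_mod_cast this
    refine (mul_le_mul_of_nonneg_right hcard hε').trans (le_of_eq ?_)
    field_simp
  have h5 := Finset.sum_le_sum_of_subset_of_nonneg (Finset.subset_univ
    (Finset.univ.filter (fun J : EdgeIndex ι k => J.1 ⊆ I.1))) fun J _ _ => hterm J
  linarith

end ColoredHypergraph
end PartiteRegularity

/-! ### Numbers of colors and sample sizes -/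

namespace PartiteRegularity

/-- A multi-level pigeonhole principle: if each `Q t m` is bounded, and monotone in the coordinates
of `m` up to `t`, then there is a bounded `m` at which no `Q t` grows much when the coordinate `t`
is enlarged. -/
theorem exists_small_increments (B : ℝ) : ∀ (n : ℕ) (step : (Fin n → ℕ) → ℕ)
    (η : Fin n → (Fin n → ℕ) → ℝ) (_ : ∀ t m, 0 < η t m)
    (_ : ∀ t m m', (∀ u, t < u → m u = m' u) → η t m = η t m') (L : ℕ),
    ∃ U : ℕ, ∀ Q : Fin n → (Fin n → ℕ) → ℝ, (∀ t m, 0 ≤ Q t m ∧ Q t m ≤ B) →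
      (∀ t m m', m ≤ m' → (∀ u, t < u → m u = m' u) → Q t m ≤ Q t m') →
      ∃ m : Fin n → ℕ, (∀ t, L ≤ m t ∧ m t ≤ U) ∧
        ∀ t, Q t (Function.update m t (m t + step m)) - Q t m ≤ η t m := by
  intro n
  induction n with
  | zero => exact fun _ _ _ _ L => ⟨0, fun Q _ _ => ⟨0, fun t => t.elim0, fun t => t.elim0⟩⟩
  | succ n ih =>
    intro step η hη hη' L
    let S : (Fin n → ℕ) → ℕ → Fin (n + 1) → ℕ := fun m a => Fin.snoc (α := fun _ => ℕ) m a
    have hSc : ∀ m a (t : Fin n), S m a t.castSucc = m t := fun m a t =>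
      Fin.snoc_castSucc (α := fun _ => ℕ) a m t
    have hSl : ∀ m a, S m a (Fin.last n) = a := fun m a => Fin.snoc_last (α := fun _ => ℕ) a m
    have hSu : ∀ m a (t : Fin n) y, S (Function.update m t y) a =
        Function.update (S m a) t.castSucc y := fun m a t y =>
      Fin.snoc_update (α := fun _ => ℕ) a m t y
    have hS : ∀ (t : Fin n) m m' a, (∀ u, t < u → m u = m' u) →
        ∀ u, t.castSucc < u → S m a u = S m' a u := by
      intro t m m' a h u hu
      induction u using Fin.lastCases with
      | last => rw [hSl, hSl]
      | cast u =>
        rw [hSc, hSc]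
        exact h u (Fin.castSucc_lt_castSucc_iff.1 hu)
    have hSle : ∀ m m' a a', m ≤ m' → a ≤ a' → S m a ≤ S m' a' := by
      intro m m' a a' h ha u
      induction u using Fin.lastCases with
      | last => rwa [hSl, hSl]
      | cast u =>
        rw [hSc, hSc]
        exact h u
    -- The top coordinate is fixed as `a`. Requiring the other coordinates to be at least `a` too
    -- makes the configurations for successive values of `a` comparable.
    have ih' := fun a : ℕ => ih (fun m => step (S m a)) (fun t m => η t.castSucc (S m a))
      (fun t m => hη _ _) (fun t m m' h => hη' _ _ _ (hS t m m' a h)) a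
    choose U hU using ih'
    -- At least as large as every coordinate of the configuration found for `a`, even after its step
    -- is added to the top one.
    let next : ℕ → ℕ := fun a => a + U a +
      (Fintype.piFinset fun _ : Fin (n + 1) => Finset.range (a + U a + 1)).sup step
    let a : ℕ → ℕ := fun i => Nat.rec L (fun _ => next) i
    have hasucc : ∀ i, a (i + 1) = next (a i) := fun i => rfl
    have haL : ∀ i, L ≤ a i := by
      intro i
      induction i with
      | zero => exact le_rfl
      | succ i hi =>
        rw [hasucc]
        simp only [next]
        omega
    -- No coordinate lies above the last one, so its tolerance is a constant.
    set η₀ := η (Fin.last n) 0 with hη₀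
    have hη₀' : ∀ m, η (Fin.last n) m = η₀ := fun m =>
      hη' _ _ _ fun u hu => absurd (Fin.le_last u) (not_le.2 hu)
    obtain ⟨J, hJ⟩ := exists_nat_gt (B / η₀)
    refine ⟨∑ i ∈ Finset.range J, (a i + U (a i)), fun Q hQ hQm => ?_⟩
    have hi : ∀ i, ∃ m : Fin n → ℕ, (∀ t, a i ≤ m t ∧ m t ≤ U (a i)) ∧
        ∀ t : Fin n, Q t.castSucc (Function.update (S m (a i)) t.castSucc
          (S m (a i) t.castSucc + step (S m (a i)))) - Q t.castSucc (S m (a i)) ≤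
            η t.castSucc (S m (a i)) := by
      intro i
      obtain ⟨m, hm, hm'⟩ := hU (a i) (fun t m => Q t.castSucc (S m (a i)))
        (fun t m => hQ _ _) fun t m m' hmm h =>
          hQm _ _ _ (hSle _ _ _ _ hmm le_rfl) (hS t m m' (a i) h)
      refine ⟨m, hm, fun t => ?_⟩
      have := hm' t
      rwa [hSu, ← hSc m (a i) t] at this
    choose m hm hm' using hi
    have hmS : ∀ i, S (m i) (a i) ∈
        Fintype.piFinset fun _ : Fin (n + 1) => Finset.range (a i + U (a i) + 1) := by
      intro i
      rw [Fintype.mem_piFinset]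
      intro u
      rw [Finset.mem_range]
      induction u using Fin.lastCases with
      | last =>
        rw [hSl]
        omega
      | cast u =>
        rw [hSc]
        have := (hm i u).2
        omega
    have hinc : ∀ i, Q (Fin.last n) (Function.update (S (m i) (a i)) (Fin.last n)
        (S (m i) (a i) (Fin.last n) + step (S (m i) (a i)))) ≤
          Q (Fin.last n) (S (m (i + 1)) (a (i + 1))) := by
      intro i
      have h1 : step (S (m i) (a i)) ≤ _ := Finset.le_sup (f := step) (hmS i)
      have h2 : a i + U (a i) + step (S (m i) (a i)) ≤ a (i + 1) := by
        rw [hasucc]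
        exact Nat.add_le_add_left h1 _
      refine hQm _ _ _ (fun u => ?_) fun u hu => absurd (Fin.le_last u) (not_le.2 hu)
      induction u using Fin.lastCases with
      | last =>
        rw [Function.update_self, hSl, hSl]
        exact (by omega : a i + step (S (m i) (a i)) ≤ a (i + 1))
      | cast u =>
        rw [Function.update_of_ne (Fin.castSucc_lt_last u).ne, hSc, hSc]
        have := (hm i u).2
        have := (hm (i + 1) u).1
        exact (by omega : m i u ≤ m (i + 1) u)
    have hex : ∃ i < J, Q (Fin.last n) (Function.update (S (m i) (a i)) (Fin.last n)
        (S (m i) (a i) (Fin.last n) + step (S (m i) (a i)))) -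
          Q (Fin.last n) (S (m i) (a i)) ≤ η₀ := by
      by_contra hcon
      push Not at hcon
      -- If every step gained more than `η₀`, monotonicity would chain the gains past the bound `B`
      -- within `J` steps.
      have h1 : ∀ i ≤ J, i * η₀ ≤ Q (Fin.last n) (S (m i) (a i)) := by
        intro i
        induction i with
        | zero => simpa using (hQ _ _).1
        | succ i hi =>
          intro hiJ
          have h2 := hi (by omega)
          have h3 := hcon i (by omega)
          have h4 := hinc i
          push_cast
          linarith
      have h2 := (h1 J le_rfl).trans (hQ _ _).2
      rw [div_lt_iff₀ (hη _ _)] at hJ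
      linarith
    obtain ⟨i, hiJ, hi⟩ := hex
    have hUi : a i + U (a i) ≤ ∑ i ∈ Finset.range J, (a i + U (a i)) :=
      Finset.single_le_sum (f := fun i => a i + U (a i)) (fun _ _ => Nat.zero_le _)
        (Finset.mem_range.2 hiJ)
    refine ⟨S (m i) (a i), fun u => ?_, fun u => ?_⟩
    · induction u using Fin.lastCases with
      | last =>
        rw [hSl]
        exact ⟨haL i, by omega⟩
      | cast u =>
        rw [hSc]
        have := hm i u
        have := haL i
        exact ⟨by omega, by omega⟩
    · induction u using Fin.lastCases with
      | last =>
        rw [hη₀']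
        exact hi
      | cast u => exact hm' i u

/-- A bound for the numbers of colors of the edges of size at least `s` after a regularization,
where `B` bounds the numbers of colors of the original hypergraph with `r` vertex sets. -/
def colorBound (r : ℕ) : (n : ℕ) → (B : ℕ) → (Fin n → ℕ) → ℕ → ℕ
  | 0, B, _, _ => B
  | n + 1, B, m, s => if n + 2 ≤ s then B else
      colorBound r n (B ^ (2 ^ r * (m (Fin.last n) + 1) ^ r)) (fun t => m t.castSucc) s

theorem colorBound_pos (r : ℕ) : ∀ (n : ℕ) {B : ℕ} (_ : 0 < B) (m : Fin n → ℕ) (s : ℕ),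
    0 < colorBound r n B m s
  | 0, _, hB, _, _ => hB
  | n + 1, B, hB, m, s => by
    unfold colorBound
    split_ifs
    · exact hB
    · exact colorBound_pos r n (pow_pos hB _) _ _

theorem colorBound_congr (r : ℕ) : ∀ (n B : ℕ) {m m' : Fin n → ℕ} {s : ℕ}
    (_ : ∀ u : Fin n, s ≤ u + 1 → m u = m' u), colorBound r n B m s = colorBound r n B m' s
  | 0, _, _, _, _, _ => rfl
  | n + 1, B, m, m', s, h => by
    unfold colorBound
    split_ifs with hs
    · rfl
    · rw [h (Fin.last n) (by rw [Fin.val_last]; omega)]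
      exact colorBound_congr r n _ fun u hu => h u.castSucc (by simpa using hu)

/-! ### Color counts and mean energies of random regularizations -/

namespace ColoredHypergraph

variable {ι : Type} [Fintype ι] [DecidableEq ι] {k : ℕ} {Ω : ι → Type v}

/-- A new color has one entry for each `K` and each `g`. Using `m + 1` instead of `m` keeps the
powers monotone in the exponent also when `m = 0`. -/
theorem card_color_regularizeStep_le (G : ColoredHypergraph.{v, w} k Ω) {B : ℕ} (hB : 0 < B)
    (hG : ∀ I, Nat.card (G.Color I) ≤ B) (s : ℕ) {m : ℕ} (φ : PartMap Ω m) (I : EdgeIndex ι k) :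
    Nat.card ((G.regularizeStep s φ).Color I) ≤
      B ^ (2 ^ Fintype.card ι * (m + 1) ^ Fintype.card ι) := by
  classical
  change Nat.card (∀ K : {K : EdgeIndex ι k // I.1 ⊆ K.1 ∧ (K = I ∨ K.1.card ≤ s + 1)},
    (↥(K.1.1 \ I.1) → Fin m) → G.Color K.1) ≤ _
  rw [Nat.card_pi]
  have h1 : ∀ K : {K : EdgeIndex ι k // I.1 ⊆ K.1 ∧ (K = I ∨ K.1.card ≤ s + 1)},
      Nat.card ((↥(K.1.1 \ I.1) → Fin m) → G.Color K.1) ≤ B ^ (m + 1) ^ Fintype.card ι := by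
    intro K
    rw [Nat.card_fun]
    refine (Nat.pow_le_pow_left (hG K.1) _).trans (Nat.pow_le_pow_right hB ?_)
    rw [Nat.card_fun, Nat.card_fin, Nat.card_eq_fintype_card]
    refine (Nat.pow_le_pow_left m.le_succ _).trans (Nat.pow_le_pow_right m.succ_pos ?_)
    exact (Fintype.card_coe _).trans_le (Finset.card_le_univ (K.1.1 \ I.1))
  refine (Finset.prod_le_pow_card _ _ _ fun K _ => h1 K).trans ?_
  rw [← pow_mul, mul_comm]
  refine Nat.pow_le_pow_right hB (Nat.mul_le_mul_right _ ?_)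
  rw [Finset.card_univ, ← Fintype.card_finset]
  exact (Fintype.card_subtype_le _).trans (Fintype.card_subtype_le _)

theorem card_color_regularizeStep_le_of_lt (G : ColoredHypergraph.{v, w} k Ω) {s m : ℕ}
    (φ : PartMap Ω m) {I : EdgeIndex ι k} (hI : s < I.1.card) :
    Nat.card ((G.regularizeStep s φ).Color I) ≤ Nat.card (G.Color I) := by
  have := G.finite_color I
  refine Nat.card_le_card_of_injective
    (fun c : (G.regularizeStep s φ).Color I => c ⟨I, subset_rfl, Or.inl rfl⟩
      fun i => absurd i.2 (by simp)) fun c c' h => ?_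
  funext ⟨K, hIK, hK⟩ g
  have hKI : K = I := by
    rcases hK with hK | hK
    · exact hK
    · exact Subtype.ext (Finset.eq_of_subset_of_card_le hIK (by omega)).symm
  subst hKI
  convert h using 1 <;>
  · congr 1
    funext i
    exact absurd i.2 (by simp)

theorem card_color_regularize_le_of_lt : ∀ (n : ℕ) (G : ColoredHypergraph.{v, w} k Ω)
    {m : Fin n → ℕ} (φ : ∀ u, PartMap Ω (m u)) {I : EdgeIndex ι k} (_ : n < I.1.card),
    Nat.card ((G.regularize n φ).Color I) ≤ Nat.card (G.Color I)
  | 0, _, _, _, _, _ => le_rfl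
  | n + 1, G, _, _, _, hI => (card_color_regularize_le_of_lt n _ _ (by omega)).trans
      (G.card_color_regularizeStep_le_of_lt _ hI)

theorem card_color_regularize_le : ∀ (n : ℕ) (G : ColoredHypergraph.{v, w} k Ω) {B : ℕ}
    (_ : 0 < B) (_ : ∀ I, Nat.card (G.Color I) ≤ B) {m : Fin n → ℕ} (φ : ∀ u, PartMap Ω (m u))
    (I : EdgeIndex ι k) {s : ℕ} (_ : s ≤ I.1.card),
    Nat.card ((G.regularize n φ).Color I) ≤ colorBound (Fintype.card ι) n B m s
  | 0, _, _, _, hG, _, _, I, _, _ => hG I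
  | n + 1, G, B, hB, hG, m, φ, I, s, hs => by
    unfold colorBound
    split_ifs with hn
    · exact (card_color_regularize_le_of_lt (n + 1) G φ (by omega)).trans (hG I)
    · exact card_color_regularize_le n _ (pow_pos hB _)
        (G.card_color_regularizeStep_le hB hG _ _) _ I hs

variable [∀ i, Fintype (Ω i)] {p : ∀ i, Ω i → ℝ}

/-- The expected energy, on the edges of size `s`, of a random regularization. -/
noncomputable def meanEnergy (G : ColoredHypergraph.{v, w} k Ω) (p : ∀ i, Ω i → ℝ) (s : ℕ) {n : ℕ}
    (m : Fin n → ℕ) : ℝ :=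
  ∑ I : EdgeIndex ι k with I.1.card = s,
    expect (mapsLaw p m) fun φ => (G.regularize n φ).energy p I

theorem meanEnergy_nonneg (hp : ∀ i, p i ∈ stdSimplex ℝ (Ω i)) (G : ColoredHypergraph.{v, w} k Ω)
    (s : ℕ) {n : ℕ} (m : Fin n → ℕ) : 0 ≤ G.meanEnergy p s m :=
  Finset.sum_nonneg fun I _ => expect_nonneg (mapsLaw_nonneg hp) fun _ => energy_nonneg hp _ I

theorem meanEnergy_le (hp : ∀ i, p i ∈ stdSimplex ℝ (Ω i)) (G : ColoredHypergraph.{v, w} k Ω)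
    (s : ℕ) {n : ℕ} (m : Fin n → ℕ) : G.meanEnergy p s m ≤ 2 ^ Fintype.card ι := by
  have h1 : ∀ I : EdgeIndex ι k,
      expect (mapsLaw p m) (fun φ => (G.regularize n φ).energy p I) ≤ 1 := fun I =>
    (expect_mono (mapsLaw_nonneg hp) fun _ => energy_le_one hp _ I).trans_eq
      (expect_const (sum_mapsLaw hp m) 1)
  refine (Finset.sum_le_card_nsmul _ _ 1 fun I _ => h1 I).trans ?_
  rw [nsmul_eq_mul, mul_one]
  have : (Finset.univ.filter fun I : EdgeIndex ι k => I.1.card = s).card ≤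
      2 ^ Fintype.card ι := by
    rw [← Fintype.card_finset]
    exact (Finset.card_le_univ _).trans (Fintype.card_subtype_le _)
  exact_mod_cast this

theorem range_truncate_subset {n : ℕ} {m m' : Fin n → ℕ} (hm : m ≤ m')
    (φ : ∀ t, PartMap Ω (m' t)) (u : Fin n) (i : ι) :
    Set.range (truncate hm φ u i) ⊆ Set.range (φ u i) := by
  rintro _ ⟨j, rfl⟩
  exact ⟨_, rfl⟩

theorem range_subset_range_truncate {n : ℕ} {m m' : Fin n → ℕ} (hm : m ≤ m')
    (φ : ∀ t, PartMap Ω (m' t)) {u : Fin n} (hu : m u = m' u) (i : ι) :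
    Set.range (φ u i) ⊆ Set.range (truncate hm φ u i) := by
  rintro _ ⟨j, rfl⟩
  exact ⟨Fin.cast hu.symm j, rfl⟩

/-- Truncating the larger sample couples the two regularizations. The samples agree from level `s`
on and lower levels do not recolor edges of size `s`, so these keep their partition while their
frames become finer. -/
theorem meanEnergy_mono (hp : ∀ i, p i ∈ stdSimplex ℝ (Ω i)) (G : ColoredHypergraph.{v, w} k Ω)
    {s n : ℕ} {m m' : Fin n → ℕ} (hm : m ≤ m') (hs : ∀ u : Fin n, s ≤ u + 1 → m u = m' u) :
    G.meanEnergy p s m ≤ G.meanEnergy p s m' := by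
  refine Finset.sum_le_sum fun I hI => ?_
  rw [← expect_truncate hp hm]
  refine expect_mono (mapsLaw_nonneg hp) fun φ => ?_
  refine energy_mono hp (s := s) ((RefinesFrom.refl 0 G).regularize n fun u _ i =>
    range_truncate_subset hm φ u i) ((RefinesFrom.refl s G).regularize n fun u hu i =>
    range_subset_range_truncate hm φ (hs u hu) i) ?_
  exact (Finset.mem_filter.1 hI).2.ge

/-- The index `t` stands for level `t + 1`, which refines the frames of the edges of size `t + 2`
but not the partition of these edges. The last `l` points of the enlarged sample act as the fresh
sample of the irregularity. -/
theorem sum_expect_irregularity_le (hp : ∀ i, p i ∈ stdSimplex ℝ (Ω i))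
    (G : ColoredHypergraph.{v, w} k Ω) {n : ℕ} (m : Fin n → ℕ) (t : Fin n) (l : ℕ) :
    ∑ I : EdgeIndex ι k with I.1.card = (t : ℕ) + 2,
      expect (mapsLaw p m) (fun φ => (G.regularize n φ).irregularity p l I) ≤
    G.meanEnergy p (t + 2) (Function.update m t (m t + l)) - G.meanEnergy p (t + 2) m := by
  have hm : m ≤ Function.update m t (m t + l) := by
    intro u
    rcases eq_or_ne u t with rfl | hu
    · simp
    · rw [Function.update_of_ne hu]
  unfold meanEnergy irregularity
  rw [← Finset.sum_sub_distrib]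
  refine Finset.sum_le_sum fun I hI => ?_
  have hI : I.1.card = t + 2 := (Finset.mem_filter.1 hI).2
  rw [expect_sub]
  refine sub_le_sub_right ?_ _
  have ht : m t + l = Function.update m t (m t + l) t := by simp
  rw [← expect_truncate_natAdd hp hm t ht
    fun φ ψ => ((G.regularize n φ).regularizeStep (I.1.card - 1) ψ).energy p I]
  refine expect_mono (mapsLaw_nonneg hp) fun φ => ?_
  rw [show I.1.card - 1 = t + 1 by omega]
  refine energy_mono hp (s := t + 2)
    (regularize_refinesFrom_regularizeStep n G (range_truncate_subset hm φ) t ?_) ?_ hI.ge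
  · rintro i _ ⟨j, rfl⟩
    exact ⟨_, rfl⟩
  · refine ((regularizeStep_refinesFrom _ _ _).mono (Nat.zero_le _)).trans ?_
    refine (RefinesFrom.refl _ G).regularize n fun u hu i =>
      range_subset_range_truncate hm φ ?_ i
    rw [Function.update_of_ne]
    rintro rfl
    omega

/-- Here the level `|I| - 1` is 0, and a step of level 0 changes no partition. So size 1 needs no
sample of its own. -/
theorem irregularity_eq_zero (hp : ∀ i, p i ∈ stdSimplex ℝ (Ω i)) (G : ColoredHypergraph.{v, w} k Ω)
    (l : ℕ) {I : EdgeIndex ι k} (hI : I.1.card = 1) : G.irregularity p l I = 0 := by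
  have h : ∀ ψ : PartMap Ω l, (G.regularizeStep (I.1.card - 1) ψ).energy p I = G.energy p I := by
    intro ψ
    rw [hI]
    have h1 := G.regularizeStep_refinesFrom 0 ψ
    have h2 : RefinesFrom 0 G (G.regularizeStep 0 ψ) := fun J _ =>
      G.refinesFrom_regularizeStep one_pos ψ J J.2.1.card_pos
    exact le_antisymm (energy_mono hp h2 h1 (Nat.zero_le _)) (energy_mono hp h1 h2 (Nat.zero_le _))
  unfold irregularity
  simp only [h]
  rw [expect_const (sum_mapLaw p hp l), sub_self]

end ColoredHypergraph
end PartiteRegularity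

/-! ### The regularity lemma -/

namespace PartiteRegularity

section Parameters

variable (k r R N : ℕ) (ε g : ℝ) (Γ : ℕ → ℝ)

/-- The least relative density of a typical color, if there are at most `g` colors. -/
noncomputable def densityThreshold : ℝ :=
  min 1 (ε / (4 * 2 ^ r * g ^ 2))

/-- The error of the relative density of a good color, if there are at most `g` colors. -/
noncomputable def errorThreshold : ℝ :=
  min 1 (ε / (4 * g))

/-- The greatest mean square deviation of a typical color, if there are at most `g` colors. -/
noncomputable def deviationThreshold : ℝ :=
  (errorThreshold ε g * densityThreshold r ε g ^ N / (2 * N)) ^ 2 / (2 * 16 ^ k)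

/-- The number of sample points, if there are at most `Γ s` colors of size `s`. -/
noncomputable def sampleSize : ℕ :=
  ⌈1 / (∏ s ∈ Finset.range (k + 1), densityThreshold r ε (Γ s)) ^ N⌉₊ * R

variable {k r R N ε g Γ}

theorem densityThreshold_pos (hε : 0 < ε) (hg : 0 < g) : 0 < densityThreshold r ε g :=
  lt_min one_pos (by positivity)

theorem errorThreshold_pos (hε : 0 < ε) (hg : 0 < g) : 0 < errorThreshold ε g :=
  lt_min one_pos (by positivity)

theorem deviationThreshold_pos (hε : 0 < ε) (hg : 0 < g) (hN : 0 < N) :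
    0 < deviationThreshold k r N ε g := by
  have h1 := densityThreshold_pos (r := r) hε hg
  have h2 := errorThreshold_pos hε hg
  unfold deviationThreshold
  positivity

/-- `ρ` is chosen to turn both conditions on `κ` into equalities. The product of the density
thresholds, all at most 1, is a common lower bound `ϑ`, and `M` is `1 / ϑ ^ N` rounded up. -/
theorem countingParameters (hε : 0 < ε) (hΓ : ∀ s, 0 < Γ s) (hN : 0 < N) :
    CountingParameters k R N (sampleSize k r R N ε Γ) (fun s => densityThreshold r ε (Γ s))
      (fun s => errorThreshold ε (Γ s)) (fun s => deviationThreshold k r N ε (Γ s)) where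
  θ_pos s := densityThreshold_pos hε (hΓ s)
  θ_le s := min_le_left _ _
  δ_pos s := errorThreshold_pos hε (hΓ s)
  δ_le s := min_le_left _ _
  κ_pos s := deviationThreshold_pos hε (hΓ s) hN
  κ_le s := by
    have h1 := densityThreshold_pos (r := r) hε (hΓ s)
    have h2 := errorThreshold_pos hε (hΓ s)
    refine ⟨errorThreshold ε (Γ s) * densityThreshold r ε (Γ s) ^ N / (2 * N), by positivity,
      le_of_eq ?_, le_of_eq ?_⟩
    · unfold deviationThreshold
      field_simp
    · field_simp
  sample := by
    have h1 : ∀ s, 0 < densityThreshold r ε (Γ s) := fun s => densityThreshold_pos hε (hΓ s)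
    have h0 : 0 < ∏ s ∈ Finset.range (k + 1), densityThreshold r ε (Γ s) :=
      Finset.prod_pos fun s _ => h1 s
    refine ⟨_, ∏ s ∈ Finset.range (k + 1), densityThreshold r ε (Γ s),
      Nat.ceil_pos.2 (by positivity), le_rfl, h0,
      Finset.prod_le_one (fun s _ => (h1 s).le) fun s _ => min_le_left _ _, fun s _ hs => ?_, ?_⟩
    · rw [← Finset.mul_prod_erase _ _ (Finset.mem_range.2 (Nat.lt_succ_of_le hs))]
      exact mul_le_of_le_one_right (h1 s).le
        (Finset.prod_le_one (fun s _ => (h1 s).le) fun s _ => min_le_left _ _)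
    · rw [one_div_le (by exact_mod_cast Nat.ceil_pos.2 (by positivity)) (by positivity)]
      exact Nat.le_ceil _

end Parameters

namespace ColoredHypergraph

variable {ι : Type} [Fintype ι] [DecidableEq ι] {k : ℕ} {Ω : ι → Type v} [∀ i, Fintype (Ω i)]
  {p : ∀ i, Ω i → ℝ}

/-- If no mean energy grows much when the corresponding sample is enlarged, then the expected
regularity of the regularization is at most `ε`. -/
theorem expect_reg_le (hp : ∀ i, p i ∈ stdSimplex ℝ (Ω i)) {n : ℕ}
    (G : ColoredHypergraph.{v, w} (n + 1) Ω) {h N l : ℕ} {θ δ κ : ℕ → ℝ}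
    (hpar : CountingParameters (n + 1) (h * 2 ^ (n + 1)) N l θ δ κ)
    (hN : 2 ^ Fintype.card ι * (h * 2 ^ (n + 1) + 1) ^ Fintype.card ι ≤ N) {Γ : ℕ → ℝ}
    (hΓ0 : ∀ s, 0 < Γ s) {m : Fin n → ℕ}
    (hΓ : ∀ (φ : ∀ t, PartMap Ω (m t)) (I J : EdgeIndex ι (n + 1)), J.1.card ≤ I.1.card →
      Nat.card ((G.regularize n φ).Color I) ≤ Γ J.1.card)
    {ε : ℝ} (hδ : ∀ s, Γ s * δ s ≤ ε / 4)
    (hθ : ∀ s, Γ s ^ 2 * θ s ≤ ε / (4 * 2 ^ Fintype.card ι)) (hε : 0 ≤ ε)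
    (hm : ∀ t : Fin n, G.meanEnergy p (t + 2) (Function.update m t (m t + l)) -
      G.meanEnergy p (t + 2) m ≤ κ (t + 2) * ε / (2 * (n + 1) * Γ (t + 2))) :
    expect (mapsLaw p m) (fun φ => (G.regularize n φ).reg p h) ≤ ε := by
  classical
  refine (expect_mono (mapsLaw_nonneg hp) fun φ => reg_le hp hpar hN (hΓ φ) hδ hθ).trans ?_
  rw [expect_add, expect_const (sum_mapsLaw hp m), expect_sum]
  set F : EdgeIndex ι (n + 1) → ℝ := fun J =>
    expect (mapsLaw p m) fun φ => (G.regularize n φ).irregularity p l J with hF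
  have h1 : ∀ J : EdgeIndex ι (n + 1), expect (mapsLaw p m) (fun φ =>
      Γ J.1.card / κ J.1.card * (G.regularize n φ).irregularity p l J) =
      Γ J.1.card / κ J.1.card * F J := fun J => expect_const_mul _ _
  simp only [h1]
  rw [← Finset.sum_fiberwise_of_maps_to (t := Finset.range (n + 2))
    (g := fun J : EdgeIndex ι (n + 1) => J.1.card)
    (fun J _ => Finset.mem_range.2 (Nat.lt_succ_of_le J.2.2))]
  have h2 : ∀ s, ∑ J : EdgeIndex ι (n + 1) with J.1.card = s, Γ J.1.card / κ J.1.card * F J =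
      Γ s / κ s * ∑ J : EdgeIndex ι (n + 1) with J.1.card = s, F J := by
    intro s
    rw [Finset.mul_sum]
    exact Finset.sum_congr rfl fun J hJ => by rw [(Finset.mem_filter.1 hJ).2]
  simp only [h2]
  have h30 : ∑ J : EdgeIndex ι (n + 1) with J.1.card = 0, F J = 0 :=
    Finset.sum_eq_zero fun J hJ => absurd (Finset.mem_filter.1 hJ).2 J.2.1.card_pos.ne'
  have h31 : ∑ J : EdgeIndex ι (n + 1) with J.1.card = 1, F J = 0 :=
    Finset.sum_eq_zero fun J hJ => by
      simp only [hF, irregularity_eq_zero hp _ _ (Finset.mem_filter.1 hJ).2]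
      exact expect_const (sum_mapsLaw hp m) 0
  -- Sizes 0 and 1 contribute nothing; the sizes `t + 2` with `t < n` match the `n` levels of
  -- sampling.
  rw [Finset.sum_range_succ', Finset.sum_range_succ', zero_add, h30, h31, mul_zero, mul_zero,
    add_zero, add_zero]
  have h4 : ∀ t ∈ Finset.range n, Γ (t + 1 + 1) / κ (t + 1 + 1) *
      ∑ J : EdgeIndex ι (n + 1) with J.1.card = t + 1 + 1, F J ≤ ε / (2 * (n + 1)) := by
    intro t ht
    have h5 := (sum_expect_irregularity_le hp G m ⟨t, Finset.mem_range.1 ht⟩ l).trans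
      (hm ⟨t, Finset.mem_range.1 ht⟩)
    have hΓt := hΓ0 (t + 2)
    have hκt := hpar.κ_pos (t + 2)
    refine (mul_le_mul_of_nonneg_left h5 (div_nonneg hΓt.le hκt.le)).trans (le_of_eq ?_)
    simp only
    field_simp
  have h6 := Finset.sum_le_sum h4
  rw [Finset.sum_const, Finset.card_range, nsmul_eq_mul] at h6
  have h7 : (n : ℝ) * (ε / (2 * (n + 1))) ≤ ε / 2 := by
    rw [mul_div_assoc', div_le_div_iff₀ (by positivity) two_pos]
    nlinarith
  linarith

theorem IsRegular.mono {G : ColoredHypergraph.{v, w} k Ω} {h : ℕ} {ε ε' : ℝ} (hε : ε ≤ ε')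
    (hG : G.IsRegular p h ε) : G.IsRegular p h ε' := by
  obtain ⟨δ, hδ, hI⟩ := hG
  exact ⟨δ, hδ, fun I => (hI I).trans (div_le_div_of_nonneg_right hε (Nat.cast_nonneg _))⟩

/-- Markov's inequality at `√ε`. The minimum defining `reg` is attained, so a bound for it yields
actual regularity. -/
theorem one_sub_sqrt_le_prob (hp : ∀ i, p i ∈ stdSimplex ℝ (Ω i)) {n : ℕ}
    (G : ColoredHypergraph.{v, w} k Ω) (h : ℕ) {ε : ℝ} (hε : 0 < ε) (m : Fin n → ℕ)
    (hm : expect (mapsLaw p m) (fun φ => (G.regularize n φ).reg p h) ≤ ε) :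
    1 - √ε ≤ prob (mapsLaw p m) {φ | (G.regularize n φ).reg p h ≤ √ε ∧
      (G.regularize n φ).IsRegular p h (√ε)} := by
  have hreg := fun φ : ∀ t, PartMap Ω (m t) => ((G.regularize n φ).isLeast_reg p hp h).1
  refine (one_sub_le_prob (mapsLaw_nonneg hp) (sum_mapsLaw hp m)
    (f := fun φ => (G.regularize n φ).reg p h) (fun φ => (hreg φ).1) (Real.sqrt_pos.2 hε)
    (by rwa [Real.sq_sqrt hε.le])).trans ?_
  exact prob_mono (mapsLaw_nonneg hp) fun φ hφ => ⟨hφ, (hreg φ).2.mono hφ⟩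

/-- The tolerance `η` at `t` depends only on the color bound for size `t + 2`, hence only on the
coordinates above `t`, as `exists_small_increments` requires. The sample size depends on all
coordinates, which is allowed for the step. -/
theorem exists_expect_reg_le (r n h : ℕ) (b : ℕ → ℕ) {ε : ℝ} (hε : 0 < ε) :
    ∃ U : ℕ, ∀ (ι : Type) [Fintype ι] [DecidableEq ι] (_ : Fintype.card ι = r)
      (Ω : ι → Type v) [∀ i, Fintype (Ω i)]
      (p : ∀ i, Ω i → ℝ) (_ : ∀ i, p i ∈ stdSimplex ℝ (Ω i))
      (G : ColoredHypergraph.{v, w} (n + 1) Ω) (_ : G.IsColored b),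
      ∃ m : Fin n → ℕ, (∀ t, m t ≤ U) ∧
        expect (mapsLaw p m) (fun φ => (G.regularize n φ).reg p h) ≤ ε := by
  -- Patterns start with `h` points in each vertex set and are doubled at most once for each edge
  -- size.
  let R := h * 2 ^ (n + 1)
  let N := 2 ^ r * (R + 1) ^ r
  let B := 1 + ∑ i ∈ Finset.range (n + 2), b i
  let Γ : (Fin n → ℕ) → ℕ → ℝ := fun m s => colorBound r n B m s
  have hN : 0 < N := by positivity
  have hB : 0 < B := by simp [B]
  have hΓ0 : ∀ m s, 0 < Γ m s := fun m s => Nat.cast_pos.2 (colorBound_pos r n hB m s)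
  let η : Fin n → (Fin n → ℕ) → ℝ := fun t m =>
    deviationThreshold (n + 1) r N ε (Γ m (t + 2)) * ε / (2 * (n + 1) * Γ m (t + 2))
  obtain ⟨U, hU⟩ := exists_small_increments (2 ^ r) n
    (fun m => sampleSize (n + 1) r R N ε (Γ m)) η
    (fun t m => by
      have h1 := hΓ0 m (t + 2)
      have h2 := deviationThreshold_pos (k := n + 1) (r := r) hε h1 hN
      simp only [η]
      positivity)
    (fun t m m' hmm => by
      have : Γ m (t + 2) = Γ m' (t + 2) := by
        simp only [Γ]
        rw [colorBound_congr r n B fun u hu => hmm u (Fin.lt_def.2 (by omega))]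
      simp only [η, this]) 0
  refine ⟨U, fun ι _ _ hι Ω _ p hp G hG => ?_⟩
  subst hι
  obtain ⟨m, hmU, hm⟩ := hU (fun t m => G.meanEnergy p (t + 2) m)
    (fun t m => ⟨G.meanEnergy_nonneg hp _ m, G.meanEnergy_le hp _ m⟩)
    fun t m m' hmm h => G.meanEnergy_mono hp hmm fun u hu => h u (Fin.lt_def.2 (by omega))
  refine ⟨m, fun t => (hmU t).2, ?_⟩
  have hGB : ∀ I, Nat.card (G.Color I) ≤ B := by
    intro I
    rw [hG I]
    exact (Finset.single_le_sum (f := b) (fun _ _ => Nat.zero_le _)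
      (Finset.mem_range.2 (Nat.lt_succ_of_le I.2.2))).trans (Nat.le_add_left _ _)
  refine expect_reg_le hp G (countingParameters hε (hΓ0 m) hN) le_rfl (hΓ0 m)
    (fun φ I J hJI => ?_) (fun s => ?_) (fun s => ?_) hε.le hm
  · exact Nat.cast_le.2 (card_color_regularize_le n G hB hGB φ I hJI)
  · have h1 := hΓ0 m s
    refine (mul_le_mul_of_nonneg_left (min_le_right _ _) h1.le).trans (le_of_eq ?_)
    field_simp
  · have h1 := hΓ0 m s
    refine (mul_le_mul_of_nonneg_left (min_le_right _ _) (sq_nonneg _)).trans (le_of_eq ?_)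
    field_simp

end ColoredHypergraph
end PartiteRegularity

theorem mainTheorem5 (r k h : ℕ) (hk : 1 ≤ k) (hkr : k ≤ r) (hh : 1 ≤ h) (b : ℕ → ℕ)
    (ε : ℝ) (hε : 0 < ε) :
    ∃ mtilde : Fin (k - 1) → ℕ,
      ∀ (ι : Type) [Fintype ι] [DecidableEq ι] (_ : Fintype.card ι = r)
        (Ω : ι → Type v) [∀ i, Fintype (Ω i)]
        (p : ∀ i, Ω i → ℝ) (_ : ∀ i, p i ∈ stdSimplex ℝ (Ω i))
        (G : PartiteRegularity.ColoredHypergraph.{v, w} k Ω) (_ : G.IsColored b),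
        (∃ m : Fin (k - 1) → ℕ, (∀ t, m t ≤ mtilde t) ∧
          PartiteRegularity.expect (PartiteRegularity.mapsLaw p m)
            (fun φ => (G.regularize (k - 1) φ).reg p h) ≤ ε) ∧
        ∀ m : Fin (k - 1) → ℕ,
          PartiteRegularity.expect (PartiteRegularity.mapsLaw p m)
            (fun φ => (G.regularize (k - 1) φ).reg p h) ≤ ε →
          1 - √ε ≤ PartiteRegularity.prob (PartiteRegularity.mapsLaw p m)
            {φ | (G.regularize (k - 1) φ).reg p h ≤ √ε ∧
              (G.regularize (k - 1) φ).IsRegular p h (√ε)} := by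
  obtain ⟨n, rfl⟩ : ∃ n, k = n + 1 := ⟨k - 1, by omega⟩
  obtain ⟨U, hU⟩ := PartiteRegularity.ColoredHypergraph.exists_expect_reg_le.{v, w} r n h b hε
  refine ⟨fun _ => U, fun ι _ _ hι Ω _ p hp G hG => ⟨hU ι hι Ω p hp G hG, fun m hm => ?_⟩⟩
  exact G.one_sub_sqrt_le_prob hp h hε m hm
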